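/- Let $L>0$. On complex $2\times 2$ matrices put $[A,B]=BA-AB$ and $\langle A,B\rangle=2\,\mathrm{Tr}(AB)$, and let $B_1=\tfrac12\,\mathrm{diag}(1,-1)$. An anchored horizontal hyperbolic Darboux curve is a smooth curve $g:[0,L]\to SL_2(\mathbb C)$ with $g(0)=I$ and $$g^{-1}(s)\frac{dg}{ds}(s)=\Lambda(s)=R(s)B_1R^*(s),\qquad s\in[0,L],$$ for some smooth curve $R:[0,L]\to SU_2$ with $R(0)=I$. Let $\mathrm{Horiz}(\mathcal D_h)(L)$ be the set of these curves and $\mathrm{Horiz}(\mathcal{PD}_h)(L)$ the subset of the frame-periodic ones, i.e. those for which $\Lambda$ is smoothly periodic with period $L$ (derivatives of every order agree at $0$ and $L$). Both sets carry the $C^\infty$ topology inherited from the Fréchet space $C^\infty([0,L],M_2(\mathbb C))$. A tangent vector $v=\frac{\partial h}{\partial t}\big|_{t=0}$ at $g$, given by a family $h(s,t)$ of such curves with $h(s,0)=g(s)$, is represented by the matrix curve $V$ with $$V(0)=0,\qquad \frac{dV}{ds}(s)=\frac{\partial\Lambda}{\partial t}(s,0),\qquad \Lambda(s,t)=h(s,t)^{-1}\frac{\partial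 h}{\partial s}(s,t),$$ that is, $\frac{dV}{ds}=g^{-1}\frac{dv}{ds}-g^{-1}v\,g^{-1}\frac{dg}{ds}$. For tangent vectors $v_1,v_2$ at $g$ represented by $V_1,V_2$ let $$\omega_\Lambda(V_1,V_2)=\frac1i\int_0^L\Big\langle \Lambda(s),\Big[\frac{dV_1}{ds}(s),\frac{dV_2}{ds}(s)\Big]\Big\rangle\,ds .$$ Theorem. Both $\mathrm{Horiz}(\mathcal D_h)(L)$ and $\mathrm{Horiz}(\mathcal{PD}_h)(L)$ are symplectic Fréchet manifolds relative to $\omega$. That is, each is a Hausdorff manifold modelled on a Fréchet space, with smooth coordinate changes, for which the inclusion into $C^\infty([0,L],M_2(\mathbb C))$ is a smooth immersion and a map into the manifold is smooth whenever it is smooth as a map into $C^\infty([0,L],M_2(\mathbb C))$; and on each, $\omega$ is a real-valued smooth differential form of degree two which is closed ($d\omega(X_1,X_2,X_3)=0$ for all smooth vector fields) and non-degenerate (if $\omega(v,w)=0$ for all tangent vectors $w$ at the same point, then $v=0$). -/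

import Mathlib

open Set Filter Topology
open scoped ContDiff Matrix

/-! ## Calculus on Fréchet spaces -/

namespace FrechetCalculus

/-- A Fréchet space: a Hausdorff topological vector space whose topology is given by a countable
family of seminorms and which is (sequentially) complete for these seminorms. -/
def IsFrechetSpace (E : Type) [AddCommGroup E] [Module ℝ E] [TopologicalSpace E] : Prop :=
  T2Space E ∧ ∃ p : ℕ → Seminorm ℝ E, WithSeminorms p ∧
    ∀ x : ℕ → E,
      (∀ k : ℕ, ∀ ε : ℝ, 0 < ε → ∃ N : ℕ, ∀ m n : ℕ, N ≤ m → N ≤ n → p k (x m - x n) < ε) →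
      ∃ a : E, Tendsto x atTop (𝓝 a)

/-- `d` is the directional derivative of `f` at `x` in the direction `h`. -/
def HasDirDeriv {E F : Type} [AddCommGroup E] [Module ℝ E]
    [AddCommGroup F] [Module ℝ F] [TopologicalSpace F] (f : E → F) (x h : E) (d : F) : Prop :=
  Tendsto (fun t : ℝ => t⁻¹ • (f (x + t • h) - f x)) (𝓝[≠] 0) (𝓝 d)

/-- The directional derivative `Df(x)h` (meaningful where the limit exists, in a Hausdorff
target). -/
noncomputable def dirDeriv {E F : Type} [AddCommGroup E] [Module ℝ E]
    [AddCommGroup F] [Module ℝ F] [TopologicalSpace F] (f : E → F) (x h : E) : F :=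
  haveI : Nonempty F := ⟨0⟩
  limUnder (𝓝[≠] (0 : ℝ)) (fun t : ℝ => t⁻¹ • (f (x + t • h) - f x))

/-- Maps of class `C^n` on an open set `U`, in the usual sense of the calculus on Fréchet spaces:
`f` is `C^0` if it is continuous, and `C^(n+1)` if it is continuous, has directional
derivatives `Df(x)h` at all `x ∈ U` in all directions `h`, and the map `(x, h) ↦ Df(x)h` is
`C^n` on `U × E`. -/
def CkOn {F : Type} [AddCommGroup F] [Module ℝ F] [TopologicalSpace F] :
    ℕ → ∀ {E : Type} [AddCommGroup E] [Module ℝ E] [TopologicalSpace E], (E → F) → Set E → Prop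
  | 0, _, _, _, _, f, U => ContinuousOn f U
  | n + 1, E, _, _, _, f, U => ContinuousOn f U ∧ ∃ f' : E × E → F,
      (∀ x ∈ U, ∀ h : E, HasDirDeriv f x h (f' (x, h))) ∧ CkOn n f' (U ×ˢ (univ : Set E))

/-- Smooth (`C^∞`) maps on an open subset of a Fréchet space. -/
def SmoothOn {E F : Type} [AddCommGroup E] [Module ℝ E] [TopologicalSpace E]
    [AddCommGroup F] [Module ℝ F] [TopologicalSpace F] (f : E → F) (U : Set E) : Prop :=
  ∀ n : ℕ, CkOn n f U

/-! ## Symplectic forms on open subsets of a Fréchet space -/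

section Forms

variable {E : Type} [AddCommGroup E] [Module ℝ E] [TopologicalSpace E]

/-- The Lie bracket `[ξ, η] = Dη·ξ - Dξ·η` of vector fields on an open subset of `E`. -/
noncomputable def lieBr (ξ η : E → E) (x : E) : E :=
  dirDeriv η x (ξ x) - dirDeriv ξ x (η x)

/-- The value `dα(ξ, η, ζ)(x)` of the exterior derivative of a `2`-form `α` on the vector fields
`ξ`, `η`, `ζ`. -/
noncomputable def dForm (α : E → E → E → ℝ) (ξ η ζ : E → E) (x : E) : ℝ :=
  dirDeriv (fun y => α y (η y) (ζ y)) x (ξ x)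
    - dirDeriv (fun y => α y (ξ y) (ζ y)) x (η x)
    + dirDeriv (fun y => α y (ξ y) (η y)) x (ζ x)
    - α x (lieBr ξ η x) (ζ x)
    + α x (lieBr ξ ζ x) (η x)
    - α x (lieBr η ζ x) (ξ x)

/-- `α` is a symplectic form on the open set `W`: a smooth, closed and (weakly) nondegenerate
differential form of degree two. -/
structure IsSymplecticOn (α : E → E → E → ℝ) (W : Set E) : Prop where
  smooth : SmoothOn (fun p : E × E × E => α p.1 p.2.1 p.2.2)
    (W ×ˢ (univ : Set (E × E)))
  add_left : ∀ x ∈ W, ∀ u u' v : E, α x (u + u') v = α x u v + α x u' v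
  smul_left : ∀ x ∈ W, ∀ (c : ℝ) (u v : E), α x (c • u) v = c * α x u v
  skew : ∀ x ∈ W, ∀ u v : E, α x u v = - α x v u
  closed : ∀ ξ η ζ : E → E, SmoothOn ξ W → SmoothOn η W → SmoothOn ζ W →
    ∀ x ∈ W, dForm α ξ η ζ x = 0
  nondegenerate : ∀ x ∈ W, ∀ u : E, (∀ v : E, α x u v = 0) → u = 0

end Forms

/-! ## Fréchet manifolds lying in a space of curves -/

/-- The charts of the subset `M` of `F` (which carries the subspace topology) make it a Fréchet
manifold modelled on the Fréchet space `E`: coordinate changes are smooth. The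
remaining fields say that this is the manifold structure that `M` has as a subset of `F`
(they determine it uniquely): the inclusion into `F` is a smooth immersion, and a map into `M` is
smooth as soon as it is smooth as a map into `F`. The tangent space of `M` at a point is thereby
identified with the image in `F` of the derivative of an inverse chart. -/
structure IsFrechetSubmanifold (E : Type) [AddCommGroup E] [Module ℝ E] [TopologicalSpace E]
    {F : Type} [AddCommGroup F] [Module ℝ F] [TopologicalSpace F]
    (M : Set F) [ChartedSpace E M] : Prop where
  model : IsFrechetSpace E
  hausdorff : T2Space M
  transition : ∀ e ∈ atlas E M, ∀ e' ∈ atlas E M,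
    SmoothOn (fun x => e' (e.symm x)) (e.symm.trans e').source
  inclusion : ∀ e ∈ atlas E M, SmoothOn (fun x => (e.symm x : F)) e.target
  immersion : ∀ e ∈ atlas E M, ∀ x ∈ e.target,
    Function.Injective (dirDeriv (fun y => (e.symm y : F)) x)
  initial : ∀ e ∈ atlas E M, ∀ (N : Type) [AddCommGroup N] [Module ℝ N] [TopologicalSpace N],
    IsFrechetSpace N → ∀ (U : Set N) (f : N → M), IsOpen U →
      SmoothOn (fun y => (f y : F)) U → MapsTo f U e.source → SmoothOn (fun y => e (f y)) U

/-- `M` is a symplectic Fréchet manifold relative to `form`, where `form g v w` is the value of the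
form at the point `g` on the tangent vectors `v`, `w` of `M` at `g`. The form is given by a
complex-valued expression; that its values on tangent vectors are real is part of the assertion.
In each chart, `α` is the coordinate expression (the pullback by the inverse chart) of `form`. -/
def IsSymplecticFrechetManifold {F : Type} [AddCommGroup F] [Module ℝ F] [TopologicalSpace F]
    (M : Set F) (form : F → F → F → ℂ) : Prop :=
  ∃ (E : Type) (_ : AddCommGroup E) (_ : Module ℝ E) (_ : TopologicalSpace E)
    (_ : ChartedSpace E M), IsFrechetSubmanifold E M ∧
    ∀ e ∈ atlas E M, ∃ α : E → E → E → ℝ,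
      (∀ x ∈ e.target, ∀ u v : E,
        (α x u v : ℂ) = form (e.symm x : F)
          (dirDeriv (fun y => (e.symm y : F)) x u) (dirDeriv (fun y => (e.symm y : F)) x v)) ∧
      IsSymplecticOn α e.target

end FrechetCalculus

/-! ## The space of smooth curves on `[0, L]` -/

/-- Smooth curves `[0, L] → E`, as functions on `ℝ` that are smooth on `[0, L]` (one-sidedly at
the end points) and are set to `0` outside `[0, L]`. -/
def smoothCurveSubmodule (L : ℝ) (E : Type) [NormedAddCommGroup E] [NormedSpace ℝ E] :
    Submodule ℝ (ℝ → E) where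
  carrier := {f | ContDiffOn ℝ ∞ f (Icc 0 L) ∧ ∀ s, s ∉ Icc 0 L → f s = 0}
  add_mem' := fun {f g} hf hg => ⟨hf.1.add hg.1, fun s hs => by
    simp [hf.2 s hs, hg.2 s hs]⟩
  zero_mem' := ⟨contDiffOn_const, fun _ _ => rfl⟩
  smul_mem' := fun c f hf => ⟨hf.1.const_smul c, fun s hs => by
    simp [hf.2 s hs]⟩

/-- The vector space `C^∞([0, L], E)`. -/
def SmoothCurve (L : ℝ) (E : Type) [NormedAddCommGroup E] [NormedSpace ℝ E] : Type :=
  smoothCurveSubmodule L E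

namespace SmoothCurve

variable {L : ℝ} {E : Type} [NormedAddCommGroup E] [NormedSpace ℝ E]

noncomputable instance : AddCommGroup (SmoothCurve L E) :=
  inferInstanceAs (AddCommGroup (smoothCurveSubmodule L E))

noncomputable instance : Module ℝ (SmoothCurve L E) :=
  inferInstanceAs (Module ℝ (smoothCurveSubmodule L E))

instance : CoeFun (SmoothCurve L E) (fun _ => ℝ → E) := ⟨fun f => f.1⟩

/-- The `C^∞` topology: uniform convergence on `[0, L]` of the derivatives of every order. -/
noncomputable instance : TopologicalSpace (SmoothCurve L E) :=
  TopologicalSpace.induced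
    (fun (f : SmoothCurve L E) (n : ℕ) =>
      UniformFun.ofFun (fun s : Icc (0 : ℝ) L => iteratedDerivWithin n f (Icc 0 L) s))
    inferInstance

/-- The derivative of a curve on `[0, L]` (one-sided at the end points). -/
noncomputable def curveDeriv (L : ℝ) (f : ℝ → E) (s : ℝ) : E := derivWithin f (Icc 0 L) s

end SmoothCurve

/-! ## Horizontal hyperbolic Darboux curves -/

attribute [local instance] Matrix.linftyOpNormedRing Matrix.linftyOpNormedAlgebra

namespace Darboux

/-- `2 × 2` complex matrices. -/
abbrev Mat : Type := Matrix (Fin 2) (Fin 2) ℂ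

/-- The bracket `[A, B] = BA - AB`. -/
def bracket (A B : Mat) : Mat := B * A - A * B

/-- The trace form `⟨A, B⟩ = 2 Tr(AB)`. -/
noncomputable def traceForm (A B : Mat) : ℂ := 2 * (A * B).trace

/-- The Hermitian Pauli matrix `B₁ = ½ diag(1, -1)`. -/
noncomputable def B₁ : Mat := !![1 / 2, 0; 0, -(1 / 2)]

variable {L : ℝ}

/-- The velocity `dg/ds`. -/
noncomputable def velocity (g : SmoothCurve L Mat) (s : ℝ) : Mat := SmoothCurve.curveDeriv L g s

/-- The tangent direction `Λ = g⁻¹ dg/ds` of a curve `g` of invertible matrices. -/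
noncomputable def Lam (g : SmoothCurve L Mat) (s : ℝ) : Mat := (g s)⁻¹ * velocity g s

/-- The space of anchored horizontal hyperbolic Darboux curves: smooth curves `g` in `SL₂(ℂ)` with
`g(0) = I` and `g⁻¹ dg/ds = R B₁ R*` for a smooth curve `R` in `SU₂` with `R(0) = I`. -/
def Horiz (L : ℝ) : Set (SmoothCurve L Mat) :=
  {g | g 0 = 1 ∧ (∀ s ∈ Icc 0 L, (g s).det = 1) ∧
    ∃ R : SmoothCurve L Mat, R 0 = 1 ∧
      ∀ s ∈ Icc 0 L, R s ∈ Matrix.specialUnitaryGroup (Fin 2) ℂ ∧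
        Lam g s = R s * B₁ * (R s)ᴴ}

/-- The frame-periodic ones: `Λ` is smoothly periodic with period `L`, that is, its derivatives
of every order agree at `0` and at `L`. -/
def HorizPeriodic (L : ℝ) : Set (SmoothCurve L Mat) :=
  {g | g ∈ Horiz L ∧ ∀ n : ℕ,
    iteratedDerivWithin n (Lam g) (Icc 0 L) 0 = iteratedDerivWithin n (Lam g) (Icc 0 L) L}

/-- The derivative `δΛ` of `g ↦ Λ = g⁻¹ dg/ds` at `g` in the direction `v` (quotient rule). If
`h(s, t)` is a family of curves with `h(s, 0) = g(s)` and `∂h/∂t (s, 0) = v(s)`, this is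
`∂Λ/∂t (s, 0)`. -/
noncomputable def dLam (g v : SmoothCurve L Mat) (s : ℝ) : Mat :=
  (g s)⁻¹ * velocity v s - (g s)⁻¹ * v s * (g s)⁻¹ * velocity g s

/-- The matrix curve `V` that represents a tangent vector `v` at `g`: `V(0) = 0` and
`dV/ds = δΛ`. -/
noncomputable def tangentRep (g v : SmoothCurve L Mat) (s : ℝ) : Mat := ∫ x in (0 : ℝ)..s, dLam g v x

/-- The form `ω_Λ(V₁, V₂) = (1/i) ∫₀ᴸ ⟨Λ, [dV₁/ds, dV₂/ds]⟩ ds`, evaluated on the curves `V₁`, `V₂`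
that represent the tangent vectors `v₁`, `v₂` at `g`. -/
noncomputable def omega (g v₁ v₂ : SmoothCurve L Mat) : ℂ :=
  (1 / Complex.I) * ∫ s in (0 : ℝ)..L,
    traceForm (Lam g s) (bracket (SmoothCurve.curveDeriv L (tangentRep g v₁) s)
      (SmoothCurve.curveDeriv L (tangentRep g v₂) s))

end Darboux

/-! The anchor g(0) = 1 and the equation g' = gΛ determine g from Λ. The matrices R B₁ R* form the
sphere of traceless Hermitian matrices with eigenvalues ±1/2, that is, the space of complex lines in
ℂ² (`frame_conj`, `exists_frame`). A horizontal curve is therefore the same thing as a smooth curve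
on the Riemann sphere that starts at a fixed point. Such a curve cannot fill the sphere: it misses
some line spanned by (a, 1) (`exists_mem_coordDomain`). The complement of that point is a plane with
affine coordinate z, in which the base point is z = 0 for every a. So each chart is a bijection onto
a whole linear space of curves z: those with z(0) = 0 and, in the periodic case, with equal jets at
both ends. The jet condition passes between Λ and z because pointwise application of a smooth map
preserves it (`iteratedDerivWithin_superpose_eq`). These spaces are closed in C^∞([0, L], ℂ), hence
Fréchet.

Smoothness of the charts and their inverses rests on two facts. Directional derivatives alone have
no general chain rule, so pointwise application of a smooth map is shown to have Hadamard
derivatives of all orders (`hadamardCkOn_superpose`); these compose with directional derivatives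
(`HadamardCkOn.comp`). For the equation g' = gΛ, Duhamel's formula `sub_eq_vary` expresses the
difference of two solutions exactly, and yields uniqueness, continuity (`tendsto_sol`) and the
derivative (`hasDirDeriv_sol`), which is again built from solutions. Since a chart is the
restriction of a smooth map defined on an open set of matrix curves, `smoothOn_chart_comp` gives
both the coordinate changes and the initial property.

The variation dV/ds is δΛ, the image of the coordinate variation under the derivative of the
parametrisation of the sphere. Hence ω becomes the integral over [0, L] of an area form with density
-4 / (|1 + za|² + |z|²)² (`omega_curveVar`); in particular it is real. It is closed because, under
the integral, a 2-form on a real plane is closed (`areaForm_closed`). It is non-degenerate because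
pairing u with iu gives an integrand of constant sign that vanishes only where u does, and both
model spaces are stable under multiplication by i. -/

/-! ## Uniform convergence of derivatives -/

namespace SmoothCurve

section TendstoCk

variable {ι : Type*} {X Y : Type} [NormedAddCommGroup X] [NormedSpace ℝ X]
  [NormedAddCommGroup Y] [NormedSpace ℝ Y] {S : Set ℝ} {l : Filter ι}

/-- Uniform convergence on `S` of the derivatives of order at most `n`. -/
def TendstoCk (S : Set ℝ) (l : Filter ι) : ℕ → (ι → ℝ → X) → (ℝ → X) → Prop
  | 0, F, f => TendstoUniformlyOn F f l S
  | n + 1, F, f => TendstoUniformlyOn F f l S ∧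
      TendstoCk S l n (fun i => derivWithin (F i) S) (derivWithin f S)

theorem TendstoCk.tendstoUniformlyOn {n : ℕ} {F : ι → ℝ → X} {f : ℝ → X}
    (h : TendstoCk S l n F f) : TendstoUniformlyOn F f l S := by
  cases n with
  | zero => exact h
  | succ n => exact h.1

theorem TendstoCk.congr {n : ℕ} {F G : ι → ℝ → X} {f g : ℝ → X} (h : TendstoCk S l n F f)
    (hF : ∀ᶠ i in l, EqOn (F i) (G i) S) (hf : EqOn f g S) : TendstoCk S l n G g := by
  have aux : ∀ {F G : ι → ℝ → X} {f g : ℝ → X}, TendstoUniformlyOn F f l S →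
      (∀ᶠ i in l, EqOn (F i) (G i) S) → EqOn f g S → TendstoUniformlyOn G g l S :=
    fun h hF hf => (h.congr hF).congr_right hf
  induction n generalizing F G f g with
  | zero => exact aux h hF hf
  | succ n ih =>
    refine ⟨aux h.1 hF hf, ih h.2 ?_ fun s hs => (derivWithin_congr hf.symm (hf hs).symm).symm⟩
    filter_upwards [hF] with i hi s hs
    exact derivWithin_congr hi (hi hs)

/-- Links the recursion, which suits induction along the chain rule, to the iterated derivatives
that define the topology. -/
theorem tendstoCk_iff {n : ℕ} {F : ι → ℝ → X} {f : ℝ → X} :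
    TendstoCk S l n F f ↔ ∀ k ≤ n, TendstoUniformlyOn (fun i => iteratedDerivWithin k (F i) S)
      (iteratedDerivWithin k f S) l S := by
  induction n generalizing F f with
  | zero =>
    simp [TendstoCk]
  | succ n ih =>
    constructor
    · rintro ⟨h0, h1⟩ k hk
      cases k with
      | zero => simpa using h0
      | succ k =>
        simpa only [iteratedDerivWithin_succ'] using ih.1 h1 k (by omega)
    · intro h
      refine ⟨by simpa using h 0 (by omega), ih.2 fun k hk => ?_⟩
      simpa only [iteratedDerivWithin_succ'] using h (k + 1) (by omega)

theorem contDiffOn_derivWithin_infty (hS : UniqueDiffOn ℝ S) {f : ℝ → X}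
    (hf : ContDiffOn ℝ ∞ f S) : ContDiffOn ℝ ∞ (derivWithin f S) S :=
  ((contDiffOn_infty_iff_derivWithin hS).1 hf).2

theorem differentiableOn_of_infty {f : ℝ → X} (hf : ContDiffOn ℝ ∞ f S) :
    DifferentiableOn ℝ f S :=
  hf.differentiableOn (by simp)

theorem derivWithin_prodMk (hS : UniqueDiffOn ℝ S) {f : ℝ → X} {g : ℝ → Y}
    (hf : DifferentiableOn ℝ f S) (hg : DifferentiableOn ℝ g S) :
    EqOn (derivWithin (fun s => (f s, g s)) S) (fun s => (derivWithin f S s, derivWithin g S s))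
      S := fun s hs =>
  ((hf s hs).hasDerivWithinAt.prodMk (hg s hs).hasDerivWithinAt).derivWithin (hS s hs)

theorem TendstoCk.prodMk (hS : UniqueDiffOn ℝ S) {n : ℕ} {F : ι → ℝ → X} {f : ℝ → X}
    {G : ι → ℝ → Y} {g : ℝ → Y} (hF : TendstoCk S l n F f) (hG : TendstoCk S l n G g)
    (hFs : ∀ i, ContDiffOn ℝ ∞ (F i) S) (hfs : ContDiffOn ℝ ∞ f S)
    (hGs : ∀ i, ContDiffOn ℝ ∞ (G i) S) (hgs : ContDiffOn ℝ ∞ g S) :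
    TendstoCk S l n (fun i s => (F i s, G i s)) (fun s => (f s, g s)) := by
  have aux : ∀ {F : ι → ℝ → X} {f : ℝ → X} {G : ι → ℝ → Y} {g : ℝ → Y},
      TendstoUniformlyOn F f l S → TendstoUniformlyOn G g l S →
      TendstoUniformlyOn (fun i s => (F i s, G i s)) (fun s => (f s, g s)) l S := by
    intro F f G g hF hG
    rw [Metric.tendstoUniformlyOn_iff] at *
    intro ε hε
    filter_upwards [hF ε hε, hG ε hε] with i h1 h2 s hs
    exact max_lt (h1 s hs) (h2 s hs)
  induction n generalizing F f G g with
  | zero => exact aux hF hG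
  | succ n ih =>
    refine ⟨aux hF.1 hG.1, (ih hF.2 hG.2 (fun i => contDiffOn_derivWithin_infty hS (hFs i))
      (contDiffOn_derivWithin_infty hS hfs) (fun i => contDiffOn_derivWithin_infty hS (hGs i))
      (contDiffOn_derivWithin_infty hS hgs)).congr (Eventually.of_forall fun i => ?_) ?_⟩
    · exact (derivWithin_prodMk hS (differentiableOn_of_infty (hFs i))
        (differentiableOn_of_infty (hGs i))).symm
    · exact (derivWithin_prodMk hS (differentiableOn_of_infty hfs)
        (differentiableOn_of_infty hgs)).symm

/-- The image of `f` is compact and `Ψ` is continuous at each of its points as a map on the whole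
space, so `Ψ` is uniformly continuous at the image even against nearby points outside it. -/
theorem tendstoUniformlyOn_comp_of_continuousAt {A B : Type*} [UniformSpace A] [UniformSpace B]
    (hS : IsCompact S) {f : ℝ → A} (hf : ContinuousOn f S) {Ψ : A → B}
    (hΨ : ∀ s ∈ S, ContinuousAt Ψ (f s)) {F : ι → ℝ → A} (hF : TendstoUniformlyOn F f l S) :
    TendstoUniformlyOn (fun i s => Ψ (F i s)) (fun s => Ψ (f s)) l S := by
  intro r hr
  have := (hS.image_of_continuousOn hf).uniformContinuousAt_of_continuousAt Ψ
    (by rintro _ ⟨s, hs, rfl⟩; exact hΨ s hs) hr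
  filter_upwards [hF _ this] with i hi s hs
  exact hi s hs (mem_image_of_mem f hs)

theorem eventually_mem_of_tendstoUniformlyOn {A : Type*} [UniformSpace A]
    (hS : IsCompact S) {f : ℝ → A} (hf : ContinuousOn f S) {O : Set A} (hO : IsOpen O)
    (hfO : ∀ s ∈ S, f s ∈ O) {F : ι → ℝ → A} (hF : TendstoUniformlyOn F f l S) :
    ∀ᶠ i in l, ∀ s ∈ S, F i s ∈ O := by
  obtain ⟨r, hr, hrO⟩ := lebesgue_number_of_compact_open (hS.image_of_continuousOn hf) hO
    (by rintro _ ⟨s, hs, rfl⟩; exact hfO s hs)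
  filter_upwards [hF r hr] with i hi s hs
  exact hrO.2 (f s) (mem_image_of_mem f hs) (hi s hs)

/-- The second component of the tangent map of `Φ`. -/
noncomputable def tmap (Φ : X → Y) (p : X × X) : Y := fderiv ℝ Φ p.1 p.2

theorem contDiffOn_tmap {Φ : X → Y} {O : Set X} (hO : IsOpen O) (hΦ : ContDiffOn ℝ ∞ Φ O) :
    ContDiffOn ℝ ∞ (tmap Φ) (O ×ˢ (univ : Set X)) := by
  have h1 : ContDiffOn ℝ ∞ (fderiv ℝ Φ) O := hΦ.fderiv_of_isOpen hO (by simp)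
  have h2 : ContDiffOn ℝ ∞ (fun p : X × X => fderiv ℝ Φ p.1) (O ×ˢ (univ : Set X)) :=
    h1.comp contDiff_fst.contDiffOn fun p hp => hp.1
  exact h2.clm_apply contDiff_snd.contDiffOn

theorem contDiffOn_superpose {Φ : X → Y} {O : Set X} (hΦ : ContDiffOn ℝ ∞ Φ O) {f : ℝ → X}
    (hf : ContDiffOn ℝ ∞ f S) (hfO : ∀ s ∈ S, f s ∈ O) :
    ContDiffOn ℝ ∞ (fun s => Φ (f s)) S :=
  hΦ.comp hf hfO

/-- The derivative of a superposition is again a superposition, of the tangent map with the pair of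
`f` and its derivative. This is what closes the inductions on the order of differentiation; the
source space grows while the target stays. -/
theorem derivWithin_superpose (hS : UniqueDiffOn ℝ S) {Φ : X → Y} {O : Set X} (hO : IsOpen O)
    (hΦ : ContDiffOn ℝ ∞ Φ O) {f : ℝ → X} (hf : ContDiffOn ℝ ∞ f S) (hfO : ∀ s ∈ S, f s ∈ O) :
    EqOn (derivWithin (fun s => Φ (f s)) S) (fun s => tmap Φ (f s, derivWithin f S s)) S := by
  intro s hs
  have h1 : HasFDerivAt Φ (fderiv ℝ Φ (f s)) (f s) :=
    ((hΦ.contDiffAt (hO.mem_nhds (hfO s hs))).differentiableAt (by simp)).hasFDerivAt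
  exact (h1.comp_hasDerivWithinAt s
    (differentiableOn_of_infty hf s hs).hasDerivWithinAt).derivWithin (hS s hs)

/-- Induction through the chain rule. The approximating curves need not stay in `O`, but uniform
convergence and compactness force them into it eventually, and only there is the chain rule applied.
-/
theorem TendstoCk.superpose (hS : UniqueDiffOn ℝ S) (hSc : IsCompact S) {n : ℕ} {Φ : X → Y}
    {O : Set X} (hO : IsOpen O) (hΦ : ContDiffOn ℝ ∞ Φ O) {F : ι → ℝ → X} {f : ℝ → X}
    (hF : TendstoCk S l n F f) (hFs : ∀ i, ContDiffOn ℝ ∞ (F i) S) (hf : ContDiffOn ℝ ∞ f S)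
    (hfO : ∀ s ∈ S, f s ∈ O) :
    TendstoCk S l n (fun i s => Φ (F i s)) (fun s => Φ (f s)) := by
  have aux : TendstoUniformlyOn (fun i s => Φ (F i s)) (fun s => Φ (f s)) l S :=
    tendstoUniformlyOn_comp_of_continuousAt hSc hf.continuousOn
      (fun s hs => hΦ.continuousOn.continuousAt (hO.mem_nhds (hfO s hs))) hF.tendstoUniformlyOn
  induction n generalizing X with
  | zero => exact aux
  | succ n ih =>
    refine ⟨aux, ?_⟩
    have hf' := contDiffOn_derivWithin_infty hS hf
    have hF' := fun i => contDiffOn_derivWithin_infty hS (hFs i)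
    have hn : TendstoCk S l n F f := tendstoCk_iff.2 fun k hk => tendstoCk_iff.1 hF k (by omega)
    have hpair := hn.prodMk hS hF.2 hFs hf hF' hf'
    have hO' : IsOpen (O ×ˢ (univ : Set X)) := hO.prod isOpen_univ
    have hT := contDiffOn_tmap hO hΦ
    have hm : ∀ s ∈ S, (f s, derivWithin f S s) ∈ O ×ˢ (univ : Set X) :=
      fun s hs => ⟨hfO s hs, mem_univ _⟩
    refine (ih hO' hT hpair (fun i => (hFs i).prodMk (hF' i)) (hf.prodMk hf') hm ?_).congr ?_ ?_
    · exact tendstoUniformlyOn_comp_of_continuousAt hSc (hf.prodMk hf').continuousOn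
        (fun s hs => hT.continuousOn.continuousAt (hO'.mem_nhds (hm s hs)))
        hpair.tendstoUniformlyOn
    · filter_upwards [eventually_mem_of_tendstoUniformlyOn hSc hf.continuousOn hO hfO
        hF.1] with i hi
      exact (derivWithin_superpose hS hO hΦ (hFs i) hi).symm
    · exact (derivWithin_superpose hS hO hΦ hf hfO).symm

/-- The difference quotient of `Φ`, extended by the derivative to `t = 0`. -/
noncomputable def slopeExt (Φ : X → Y) (p : ℝ × X × X) : Y :=
  open Classical in
  if p.1 = 0 then fderiv ℝ Φ p.2.1 p.2.2 else p.1⁻¹ • (Φ (p.2.1 + p.1 • p.2.2) - Φ p.2.1)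

/-- Strict differentiability at `x` controls the quotients while base point and direction both move;
on the slice t = 0 the claim is the continuity of the tangent map. -/
theorem continuousAt_slopeExt {Φ : X → Y} {O : Set X} (hO : IsOpen O) (hΦ : ContDiffOn ℝ ∞ Φ O)
    {x : X} (hx : x ∈ O) (v : X) : ContinuousAt (slopeExt Φ) (0, x, v) := by
  have hst : HasStrictFDerivAt Φ (fderiv ℝ Φ x) x :=
    (hΦ.contDiffAt (hO.mem_nhds hx)).hasStrictFDerivAt (by simp)
  have hT : ContinuousAt (tmap Φ) (x, v) := (contDiffOn_tmap hO hΦ).continuousOn.continuousAt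
    ((hO.prod isOpen_univ).mem_nhds ⟨hx, mem_univ _⟩)
  have h0 : slopeExt Φ (0, x, v) = fderiv ℝ Φ x v := by simp [slopeExt]
  have hsnd : Tendsto (fun p : ℝ × X × X => p.2) (𝓝 (0, x, v)) (𝓝 (x, v)) :=
    continuous_snd.tendsto _
  have hT' : Tendsto (fun p : ℝ × X × X => tmap Φ p.2) (𝓝 (0, x, v)) (𝓝 (fderiv ℝ Φ x v)) :=
    Tendsto.comp (f := fun p : ℝ × X × X => p.2) hT hsnd
  have hL : Tendsto (fun p : ℝ × X × X => fderiv ℝ Φ x p.2.2) (𝓝 (0, x, v))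
      (𝓝 (fderiv ℝ Φ x v)) :=
    ((fderiv ℝ Φ x).continuous.comp (continuous_snd.comp continuous_snd)).tendsto _
  have hpts : Tendsto (fun p : ℝ × X × X => (p.2.1 + p.1 • p.2.2, p.2.1)) (𝓝 (0, x, v))
      (𝓝 (x, x)) := by
    have : Continuous (fun p : ℝ × X × X => (p.2.1 + p.1 • p.2.2, p.2.1)) := by fun_prop
    simpa using this.tendsto (0, x, v)
  have hlo := hst.isLittleO.comp_tendsto hpts
  rw [ContinuousAt, h0, Metric.tendsto_nhds]
  intro ε hε
  have hb : ∀ᶠ p : ℝ × X × X in 𝓝 (0, x, v), ‖p.2.2‖ < ‖v‖ + 1 := by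
    have : Continuous (fun p : ℝ × X × X => ‖p.2.2‖) := by fun_prop
    exact this.tendsto (0, x, v) (gt_mem_nhds (by simp))
  -- With this constant the strict-derivative error, at most `c * |t| * ‖w‖` for a direction `w`
  -- with `‖w‖ < ‖v‖ + 1`, is at most `ε / 2` after division by `|t|`.
  have hc : 0 < ε / 2 / (‖v‖ + 1) := by positivity
  filter_upwards [Metric.tendsto_nhds.1 hT' ε hε, Metric.tendsto_nhds.1 hL (ε / 2) (by positivity),
    hlo.def hc, hb] with p h1 h2 h3 h4
  by_cases hp : p.1 = 0
  · simpa [slopeExt, hp, tmap] using h1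
  · simp only [slopeExt, hp, if_false]
    refine (dist_triangle _ (fderiv ℝ Φ x p.2.2) _).trans_lt ?_
    have : dist (p.1⁻¹ • (Φ (p.2.1 + p.1 • p.2.2) - Φ p.2.1)) (fderiv ℝ Φ x p.2.2) ≤ ε / 2 := by
      simp only [Function.comp_apply, add_sub_cancel_left, map_smul] at h3
      have he : p.1⁻¹ • (Φ (p.2.1 + p.1 • p.2.2) - Φ p.2.1) - fderiv ℝ Φ x p.2.2
          = p.1⁻¹ • (Φ (p.2.1 + p.1 • p.2.2) - Φ p.2.1 - p.1 • fderiv ℝ Φ x p.2.2) := by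
        rw [smul_sub p.1⁻¹ (_ - _), inv_smul_smul₀ hp]
      rw [dist_eq_norm, he, norm_smul, norm_inv]
      rw [norm_smul] at h3
      have hp' : 0 < ‖p.1‖ := norm_pos_iff.2 hp
      rw [inv_mul_le_iff₀ hp']
      refine h3.trans ?_
      rw [mul_comm (ε / 2 / _), mul_assoc]
      refine mul_le_mul_of_nonneg_left ?_ hp'.le
      calc ‖p.2.2‖ * (ε / 2 / (‖v‖ + 1)) ≤ (‖v‖ + 1) * (ε / 2 / (‖v‖ + 1)) := by gcongr
        _ = ε / 2 := by field_simp
    linarith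

theorem tmap_tmap {Φ : X → Y} {O : Set X} (hO : IsOpen O) (hΦ : ContDiffOn ℝ ∞ Φ O)
    {x : X} (hx : x ∈ O) (v h k : X) :
    tmap (tmap Φ) ((x, v), (h, k)) = fderiv ℝ (fderiv ℝ Φ) x h v + fderiv ℝ Φ x k := by
  have hd : HasFDerivAt (fderiv ℝ Φ) (fderiv ℝ (fderiv ℝ Φ) x) x :=
    (((hΦ.fderiv_of_isOpen hO (m := ∞) (by simp)).contDiffAt
      (hO.mem_nhds hx)).differentiableAt (by simp)).hasFDerivAt
  have h1 : HasFDerivAt (fun p : X × X => fderiv ℝ Φ p.1)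
      ((fderiv ℝ (fderiv ℝ Φ) x).comp (ContinuousLinearMap.fst ℝ X X)) (x, v) :=
    HasFDerivAt.comp (x, v) (f := Prod.fst) hd hasFDerivAt_fst
  have h2 := h1.clm_apply (hasFDerivAt_snd (𝕜 := ℝ) (p := (x, v)))
  have h3 : fderiv ℝ (tmap Φ) (x, v) = _ := h2.fderiv
  simp only [tmap] at h3 ⊢
  rw [show (fun p : X × X => fderiv ℝ Φ p.1 p.2) = tmap Φ from rfl] at *
  simp [h2.fderiv, add_comm]

/-- Symmetry of the second derivative. It allows differentiation along the curve to be exchanged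
with differentiation in the direction of variation. -/
theorem tmap_symm {Φ : X → Y} {O : Set X} (hO : IsOpen O) (hΦ : ContDiffOn ℝ ∞ Φ O)
    {x : X} (hx : x ∈ O) (v h k : X) :
    tmap (tmap Φ) ((x, v), (h, k)) = tmap (tmap Φ) ((x, h), (v, k)) := by
  rw [tmap_tmap hO hΦ hx, tmap_tmap hO hΦ hx]
  have := (hΦ.contDiffAt (hO.mem_nhds hx)).isSymmSndFDerivAt
    (by simpa using WithTop.coe_le_coe.2 (le_top : (2 : ℕ∞) ≤ ⊤))
  rw [this.eq]

/-- Differentiating the quotient in s gives the quotient of `tmap Φ` at (f, f') in the direction (U,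
U'), so induction applies; at order zero the claim is the continuity of `slopeExt Φ`. The direction
varies with the index because Hadamard derivatives are wanted. -/
theorem TendstoCk.slope (hS : UniqueDiffOn ℝ S) (hSc : IsCompact S) {n : ℕ} {Φ : X → Y}
    {O : Set X} (hO : IsOpen O) (hΦ : ContDiffOn ℝ ∞ Φ O) {f u : ℝ → X} {U : ι → ℝ → X}
    {t : ι → ℝ} (ht : Tendsto t l (𝓝[≠] 0))
    (hU : TendstoCk S l n U u) (hUs : ∀ i, ContDiffOn ℝ ∞ (U i) S) (hu : ContDiffOn ℝ ∞ u S)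
    (hf : ContDiffOn ℝ ∞ f S) (hfO : ∀ s ∈ S, f s ∈ O) :
    TendstoCk S l n (fun i s => (t i)⁻¹ • (Φ (f s + t i • U i s) - Φ (f s)))
      (fun s => tmap Φ (f s, u s)) := by
  have ht0 : Tendsto t l (𝓝 0) := ht.mono_right nhdsWithin_le_nhds
  have htu : TendstoUniformlyOn (fun i (_ : ℝ) => t i) (fun _ => 0) l S := by
    rw [Metric.tendstoUniformlyOn_iff]
    intro ε hε
    filter_upwards [Metric.tendsto_nhds.1 ht0 ε hε] with i hi s _
    rwa [dist_comm]
  have htne : ∀ᶠ i in l, t i ≠ 0 := ht self_mem_nhdsWithin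
  have tripleU : ∀ {X : Type} [NormedAddCommGroup X] {f u : ℝ → X} {U : ι → ℝ → X},
      TendstoUniformlyOn U u l S →
      TendstoUniformlyOn (fun i s => (t i, f s, U i s)) (fun s => ((0 : ℝ), f s, u s)) l S := by
    intro X _ f u U h
    rw [Metric.tendstoUniformlyOn_iff] at *
    intro ε hε
    filter_upwards [htu ε hε, h ε hε] with i h1 h2 s hs
    refine max_lt (h1 s hs) (max_lt ?_ (h2 s hs))
    simpa using hε
  induction n generalizing X with
  | zero =>
    refine TendstoCk.congr (n := 0) (tendstoUniformlyOn_comp_of_continuousAt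
      (Ψ := slopeExt Φ) (f := fun s => ((0 : ℝ), f s, u s)) hSc
      (continuousOn_const.prodMk (hf.continuousOn.prodMk hu.continuousOn))
      (fun s hs => continuousAt_slopeExt hO hΦ (hfO s hs) (u s)) (tripleU hU)) ?_ ?_
    · filter_upwards [htne] with i hi s _
      simp [slopeExt, hi]
    · intro s _
      simp [slopeExt, tmap]
  | succ n ih =>
    refine ⟨TendstoCk.congr (n := 0) (tendstoUniformlyOn_comp_of_continuousAt
      (Ψ := slopeExt Φ) (f := fun s => ((0 : ℝ), f s, u s)) hSc
      (continuousOn_const.prodMk (hf.continuousOn.prodMk hu.continuousOn))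
      (fun s hs => continuousAt_slopeExt hO hΦ (hfO s hs) (u s))
      (tripleU hU.tendstoUniformlyOn)) ?_ ?_, ?_⟩
    · filter_upwards [htne] with i hi s _
      simp [slopeExt, hi]
    · intro s _
      simp [slopeExt, tmap]
    have hf' := contDiffOn_derivWithin_infty hS hf
    have hu' := contDiffOn_derivWithin_infty hS hu
    have hU' := fun i => contDiffOn_derivWithin_infty hS (hUs i)
    have hn : TendstoCk S l n U u := tendstoCk_iff.2 fun k hk => tendstoCk_iff.1 hU k (by omega)
    have hpair := hn.prodMk hS hU.2 hUs hu hU' hu'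
    have hO' : IsOpen (O ×ˢ (univ : Set X)) := hO.prod isOpen_univ
    refine (ih hO' (contDiffOn_tmap hO hΦ) hpair (fun i => (hUs i).prodMk (hU' i))
      (hu.prodMk hu') (hf.prodMk hf') (fun s hs => ⟨hfO s hs, mem_univ _⟩)).congr ?_ ?_
    · have hconv : TendstoUniformlyOn (fun i s => f s + t i • U i s) f l S := by
        have := tendstoUniformlyOn_comp_of_continuousAt
          (Ψ := fun p : ℝ × X × X => p.2.1 + p.1 • p.2.2) (f := fun s => ((0 : ℝ), f s, u s)) hSc
          (continuousOn_const.prodMk (hf.continuousOn.prodMk hu.continuousOn))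
          (fun s hs => by fun_prop) (tripleU (f := f) hU.tendstoUniformlyOn)
        simpa using this
      filter_upwards [eventually_mem_of_tendstoUniformlyOn hSc hf.continuousOn hO hfO
        hconv] with i hi s hs
      have hfi : ContDiffOn ℝ ∞ (fun s => f s + t i • U i s) S :=
        hf.add ((hUs i).const_smul (t i))
      have hd1 := derivWithin_superpose hS hO hΦ hfi hi hs
      have hd2 := derivWithin_superpose hS hO hΦ hf hfO hs
      have hdf : derivWithin (fun s => f s + t i • U i s) S s
          = derivWithin f S s + t i • derivWithin (U i) S s :=
        ((differentiableOn_of_infty hf s hs).hasDerivWithinAt.add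
          ((differentiableOn_of_infty (hUs i) s hs).hasDerivWithinAt.const_smul
            (t i))).derivWithin (hS s hs)
      have hD1 := (differentiableOn_of_infty (contDiffOn_superpose hΦ hfi hi) s
        hs).hasDerivWithinAt
      have hD2 := (differentiableOn_of_infty (contDiffOn_superpose hΦ hf hfO) s
        hs).hasDerivWithinAt
      have := ((hD1.sub hD2).const_smul (t i)⁻¹).derivWithin (hS s hs)
      refine Eq.trans ?_ this.symm
      rw [hd1, hd2]
      simp only [hdf]
      rfl
    · intro s hs
      have := derivWithin_superpose hS hO' (contDiffOn_tmap hO hΦ) (hf.prodMk hu)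
        (fun s hs => ⟨hfO s hs, mem_univ _⟩) hs
      refine Eq.trans ?_ this.symm
      simp only
      rw [derivWithin_prodMk hS (differentiableOn_of_infty hf) (differentiableOn_of_infty hu) hs]
      -- The limit of the derivatives is the second tangent map at ((f, f'), (u, u')), whereas the
      -- derivative of the limit is the one at ((f, u), (f', u')).
      exact tmap_symm hO hΦ (hfO s hs) _ _ _

/-- Superposition operators preserve the equality of the jets at two points. -/
theorem iteratedDerivWithin_superpose_eq (hS : UniqueDiffOn ℝ S) {Φ : X → Y} {O : Set X}
    (hO : IsOpen O) (hΦ : ContDiffOn ℝ ∞ Φ O) {f : ℝ → X} (hf : ContDiffOn ℝ ∞ f S)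
    (hfO : ∀ s ∈ S, f s ∈ O) {p q : ℝ} (hp : p ∈ S) (hq : q ∈ S)
    (h : ∀ n, iteratedDerivWithin n f S p = iteratedDerivWithin n f S q) (n : ℕ) :
    iteratedDerivWithin n (fun s => Φ (f s)) S p
      = iteratedDerivWithin n (fun s => Φ (f s)) S q := by
  induction n generalizing X with
  | zero =>
    have := h 0
    simp only [iteratedDerivWithin_zero] at this ⊢
    rw [this]
  | succ n ih =>
    have hf' := contDiffOn_derivWithin_infty hS hf
    rw [iteratedDerivWithin_succ', iteratedDerivWithin_congr (derivWithin_superpose hS hO hΦ hf hfO) hp,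
      iteratedDerivWithin_congr (derivWithin_superpose hS hO hΦ hf hfO) hq]
    refine ih (hO.prod isOpen_univ) (contDiffOn_tmap hO hΦ) (hf.prodMk hf')
      (fun s hs => ⟨hfO s hs, mem_univ _⟩) fun m => ?_
    -- The jet of the pair of `f` and its derivative consists of jets of `f`, so the hypothesis at
    -- `p` and `q` is inherited by the pair.
    have key : ∀ m, ∀ s ∈ S, iteratedDerivWithin m (fun s => (f s, derivWithin f S s)) S s
        = (iteratedDerivWithin m f S s, iteratedDerivWithin (m + 1) f S s) := by
      intro m
      induction m with
      | zero => intro s hs; simp [iteratedDerivWithin_succ']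
      | succ m ihm =>
        intro s hs
        rw [iteratedDerivWithin_succ, derivWithin_congr ihm (ihm s hs),
          derivWithin_prodMk hS (fun x hx => ?_) (fun x hx => ?_) hs]
        · simp only [iteratedDerivWithin_succ]
        · exact hf.differentiableOn_iteratedDerivWithin (by exact_mod_cast WithTop.coe_lt_top _) hS x hx
        · exact hf.differentiableOn_iteratedDerivWithin (by exact_mod_cast WithTop.coe_lt_top _) hS x hx
    rw [key m p hp, key m q hq, h m, h (m + 1)]

end TendstoCk

end SmoothCurve

/-! ## The chain rule for Hadamard differentiable outer maps -/

namespace FrechetCalculus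

section ChainRule

set_option linter.unusedSectionVars false

variable {E F G : Type} [AddCommGroup E] [Module ℝ E] [TopologicalSpace E]
  [AddCommGroup F] [Module ℝ F] [TopologicalSpace F]
  [AddCommGroup G] [Module ℝ G] [TopologicalSpace G]

theorem HasDirDeriv.dirDeriv_eq [T2Space F] {f : E → F} {x h : E} {d : F}
    (hf : HasDirDeriv f x h d) : dirDeriv f x h = d :=
  Tendsto.limUnder_eq hf

theorem HasDirDeriv.prodMk {f : E → F} {g : E → G} {x h : E} {d : F} {d' : G}
    (hf : HasDirDeriv f x h d) (hg : HasDirDeriv g x h d') :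
    HasDirDeriv (fun y => (f y, g y)) x h (d, d') :=
  Tendsto.prodMk_nhds hf hg

theorem HasDirDeriv.congr [ContinuousAdd E] [ContinuousSMul ℝ E] {f g : E → F} {x h : E} {d : F}
    {U : Set E} (hU : IsOpen U) (hx : x ∈ U) (hfg : EqOn f g U) (hf : HasDirDeriv f x h d) :
    HasDirDeriv g x h d := by
  refine Tendsto.congr' ?_ hf
  have hc : Continuous (fun t : ℝ => x + t • h) := by fun_prop
  have : ∀ᶠ t : ℝ in 𝓝 0, x + t • h ∈ U := hc.tendsto 0 (hU.mem_nhds (by simpa using hx))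
  filter_upwards [nhdsWithin_le_nhds this] with t ht
  rw [hfg ht, hfg hx]

theorem CkOn.of_succ {n : ℕ} {f : E → F} {U : Set E} (h : CkOn (n + 1) f U) : CkOn n f U := by
  induction n generalizing E with
  | zero => exact h.1
  | succ n ih =>
    obtain ⟨h0, f', h1, h2⟩ := h
    exact ⟨h0, f', h1, ih h2⟩

theorem CkOn.comp_clm {n : ℕ} {f : F → G} {V : Set F} (hf : CkOn n f V) (A : E →L[ℝ] F)
    {U : Set E} (hA : MapsTo A U V) : CkOn n (fun x => f (A x)) U := by
  induction n generalizing E F with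
  | zero => exact ContinuousOn.comp hf A.continuous.continuousOn hA
  | succ n ih =>
    obtain ⟨h0, f', h1, h2⟩ := hf
    refine ⟨h0.comp A.continuous.continuousOn hA, fun p => f' (A.prodMap A p), fun x hx h => ?_,
      ih h2 (A.prodMap A) fun p hp => ⟨hA hp.1, mem_univ _⟩⟩
    simpa [HasDirDeriv] using h1 (A x) (hA hx) (A h)

theorem CkOn.prodMk {n : ℕ} {f : E → F} {g : E → G} {U : Set E} (hf : CkOn n f U)
    (hg : CkOn n g U) : CkOn n (fun x => (f x, g x)) U := by
  induction n generalizing E with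
  | zero => exact ContinuousOn.prodMk hf hg
  | succ n ih =>
    obtain ⟨h0, f', h1, h2⟩ := hf
    obtain ⟨k0, g', k1, k2⟩ := hg
    exact ⟨h0.prodMk k0, fun p => (f' p, g' p), fun x hx h => (h1 x hx h).prodMk (k1 x hx h),
      ih h2 k2⟩

theorem CkOn.congr [ContinuousAdd E] [ContinuousSMul ℝ E] {n : ℕ} {f g : E → F} {U : Set E}
    (hU : IsOpen U) (hf : CkOn n f U) (hfg : EqOn f g U) : CkOn n g U := by
  cases n with
  | zero => exact ContinuousOn.congr hf hfg.symm
  | succ n =>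
    obtain ⟨h0, f', h1, h2⟩ := hf
    exact ⟨h0.congr hfg.symm, f', fun x hx h => (h1 x hx h).congr hU hx hfg, h2⟩

/-- Derivatives are limits of difference quotients lying in `p`, and `p` is closed, so they lie in
`p` as well. -/
theorem CkOn.codRestrict [ContinuousAdd E] [ContinuousSMul ℝ E] {n : ℕ} {p : Submodule ℝ F}
    (hp : IsClosed (p : Set F)) {f : E → p} {U : Set E} (hU : IsOpen U)
    (hf : CkOn n (fun x => (f x : F)) U) : CkOn n f U := by
  induction n generalizing E with
  | zero => exact (IsInducing.subtypeVal.continuousOn_iff).2 hf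
  | succ n ih =>
    classical
    obtain ⟨h0, f', h1, h2⟩ := hf
    have hmem : ∀ x ∈ U, ∀ h, f' (x, h) ∈ p := fun x hx h =>
      hp.mem_of_tendsto (h1 x hx h) (Eventually.of_forall fun t =>
        p.smul_mem _ (p.sub_mem (f _).2 (f _).2))
    -- The given derivative is controlled only over `U`; elsewhere it may leave `p`, and the value 0
    -- is a harmless default there.
    refine ⟨(IsInducing.subtypeVal.continuousOn_iff).2 h0,
      fun q => if hq : f' q ∈ p then ⟨f' q, hq⟩ else 0, fun x hx h => ?_, ?_⟩
    · have := h1 x hx h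
      rw [HasDirDeriv, tendsto_subtype_rng]
      simpa [HasDirDeriv, hmem x hx h] using this
    · refine ih (hU.prod isOpen_univ) (h2.congr (hU.prod isOpen_univ) fun q hq => ?_)
      have : f' q ∈ p := hmem q.1 hq.1 q.2
      simp [this]

/-- `d` is the Hadamard derivative of `g` at `y` in the direction `k`. -/
def HasHadamardDeriv (g : F → G) (y k : F) (d : G) : Prop :=
  Tendsto (fun p : ℝ × F => p.1⁻¹ • (g (y + p.1 • p.2) - g y)) (𝓝[≠] 0 ×ˢ 𝓝 k) (𝓝 d)

/-- Maps of class `C^n` whose iterated directional derivatives are Hadamard derivatives. -/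
def HadamardCkOn {G : Type} [AddCommGroup G] [Module ℝ G] [TopologicalSpace G] :
    ℕ → ∀ {F : Type} [AddCommGroup F] [Module ℝ F] [TopologicalSpace F], (F → G) → Set F → Prop
  | 0, _, _, _, _, g, V => ContinuousOn g V
  | n + 1, F, _, _, _, g, V => ContinuousOn g V ∧ ∃ g' : F × F → G,
      (∀ y ∈ V, ∀ k : F, HasHadamardDeriv g y k (g' (y, k))) ∧
        HadamardCkOn n g' (V ×ˢ (univ : Set F))

/-- Write f(x + th) = f(x) + t k(t), where k(t) is the difference quotient and tends to `d`. A
Hadamard derivative is exactly what tolerates such a moving direction. -/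
theorem HasHadamardDeriv.comp {f : E → F} {g : F → G} {x h : E} {d : F} {d' : G}
    (hg : HasHadamardDeriv g (f x) d d') (hf : HasDirDeriv f x h d) :
    HasDirDeriv (fun y => g (f y)) x h d' := by
  have h1 : Tendsto (fun t : ℝ => (t, t⁻¹ • (f (x + t • h) - f x))) (𝓝[≠] 0)
      (𝓝[≠] 0 ×ˢ 𝓝 d) := tendsto_id.prodMk hf
  refine Tendsto.congr' ?_ (Tendsto.comp hg h1)
  filter_upwards [self_mem_nhdsWithin] with t ht
  simp only [Function.comp_apply]
  rw [smul_inv_smul₀ (by simpa using ht), add_sub_cancel]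

/-- The derivative of the composite is g'(f(x), f'(x, h)), again a Hadamard map after a pair of
lower order, so induction applies. -/
theorem HadamardCkOn.comp {n : ℕ} {f : E → F} {g : F → G} {U : Set E} {V : Set F}
    (hg : HadamardCkOn n g V) (hf : CkOn n f U) (hfU : MapsTo f U V) :
    CkOn n (fun x => g (f x)) U := by
  induction n generalizing E F with
  | zero => exact ContinuousOn.comp hg hf hfU
  | succ n ih =>
    have hfn := hf.of_succ
    obtain ⟨h0, g', h1, h2⟩ := hg
    obtain ⟨k0, f', k1, k2⟩ := hf
    refine ⟨h0.comp k0 hfU, fun p => g' (f p.1, f' p),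
      fun x hx h => (h1 (f x) (hfU hx) _).comp (k1 x hx h), ?_⟩
    exact ih h2 (CkOn.prodMk (hfn.comp_clm (ContinuousLinearMap.fst ℝ E E) fun p hp => hp.1) k2)
      fun p hp => ⟨hfU hp.1, mem_univ _⟩

theorem HasHadamardDeriv.comp_clm {g : F → G} (A : E →L[ℝ] F) {y k : E} {d : G}
    (hg : HasHadamardDeriv g (A y) (A k) d) : HasHadamardDeriv (fun x => g (A x)) y k d := by
  have h1 : Tendsto (fun p : ℝ × E => (p.1, A p.2)) (𝓝[≠] 0 ×ˢ 𝓝 k) (𝓝[≠] 0 ×ˢ 𝓝 (A k)) :=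
    tendsto_fst.prodMk ((A.continuous.tendsto k).comp tendsto_snd)
  refine Tendsto.congr (fun p => ?_) (Tendsto.comp hg h1)
  simp

theorem HadamardCkOn.comp_clm {n : ℕ} {f : F → G} {V : Set F} (hf : HadamardCkOn n f V)
    (A : E →L[ℝ] F) {U : Set E} (hA : MapsTo A U V) : HadamardCkOn n (fun x => f (A x)) U := by
  induction n generalizing E F with
  | zero => exact ContinuousOn.comp hf A.continuous.continuousOn hA
  | succ n ih =>
    obtain ⟨h0, f', h1, h2⟩ := hf
    exact ⟨h0.comp A.continuous.continuousOn hA, fun p => f' (A.prodMap A p),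
      fun x hx h => (h1 (A x) (hA hx) (A h)).comp_clm A,
      ih h2 (A.prodMap A) fun p hp => ⟨hA hp.1, mem_univ _⟩⟩

theorem hasHadamardDeriv_clm (A : F →L[ℝ] G) (y k : F) : HasHadamardDeriv A y k (A k) := by
  have h1 : Tendsto (fun p : ℝ × F => A p.2) (𝓝[≠] 0 ×ˢ 𝓝 k) (𝓝 (A k)) :=
    (A.continuous.tendsto k).comp tendsto_snd
  refine Tendsto.congr' ?_ h1
  have : ∀ᶠ p : ℝ × F in 𝓝[≠] 0 ×ˢ 𝓝 k, p.1 ≠ 0 := tendsto_fst self_mem_nhdsWithin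
  filter_upwards [this] with p hp
  simp [inv_smul_smul₀ hp]

theorem hadamardCkOn_clm (n : ℕ) (A : F →L[ℝ] G) (V : Set F) : HadamardCkOn n A V := by
  induction n generalizing F with
  | zero => exact A.continuous.continuousOn
  | succ n ih =>
    exact ⟨A.continuous.continuousOn, fun p => A p.2, fun y _ k => hasHadamardDeriv_clm A y k,
      ih (A.comp (ContinuousLinearMap.snd ℝ F F)) _⟩

theorem ckOn_clm (n : ℕ) (A : E →L[ℝ] F) (U : Set E) : CkOn n A U := by
  induction n generalizing E with
  | zero => exact A.continuous.continuousOn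
  | succ n ih =>
    exact ⟨A.continuous.continuousOn, fun p => A p.2,
      fun y _ k => by
        have h : HasHadamardDeriv A y k (A k) := hasHadamardDeriv_clm A y k
        have h1 : Tendsto (fun t : ℝ => (t, k)) (𝓝[≠] 0) (𝓝[≠] 0 ×ˢ 𝓝 k) :=
          tendsto_id.prodMk tendsto_const_nhds
        exact Tendsto.comp h h1,
      ih (A.comp (ContinuousLinearMap.snd ℝ E E)) _⟩

theorem CkOn.clm_comp {n : ℕ} (A : F →L[ℝ] G) {f : E → F} {U : Set E} (hf : CkOn n f U) :
    CkOn n (fun x => A (f x)) U :=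
  (hadamardCkOn_clm n A univ).comp hf (mapsTo_univ _ _)

end ChainRule

end FrechetCalculus

/-! ## The Fréchet space of smooth curves -/

namespace SmoothCurve

/-! ### Curves as functions vanishing outside the interval, and their convergence -/

section Basic

variable {L : ℝ} {X Y : Type} [NormedAddCommGroup X] [NormedSpace ℝ X]
  [NormedAddCommGroup Y] [NormedSpace ℝ Y]

theorem contDiffOn (f : SmoothCurve L X) : ContDiffOn ℝ ∞ f (Icc 0 L) := f.2.1

theorem continuousOn (f : SmoothCurve L X) : ContinuousOn f (Icc 0 L) := f.contDiffOn.continuousOn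

theorem differentiableOn (f : SmoothCurve L X) : DifferentiableOn ℝ f (Icc 0 L) :=
  differentiableOn_of_infty f.contDiffOn

theorem ext_on {f g : SmoothCurve L X} (h : ∀ s ∈ Icc 0 L, f s = g s) : f = g := by
  refine Subtype.ext (funext fun s => ?_)
  by_cases hs : s ∈ Icc 0 L
  · exact h s hs
  · exact (f.2.2 s hs).trans (g.2.2 s hs).symm

@[simp] theorem add_eval (f g : SmoothCurve L X) (s : ℝ) : (f + g) s = f s + g s := rfl
@[simp] theorem sub_eval (f g : SmoothCurve L X) (s : ℝ) : (f - g) s = f s - g s := rfl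
@[simp] theorem smul_eval (c : ℝ) (f : SmoothCurve L X) (s : ℝ) : (c • f) s = c • f s := rfl
@[simp] theorem zero_eval (s : ℝ) : (0 : SmoothCurve L X) s = 0 := rfl

/-- The smooth curve given by the restriction of `f` to `[0, L]` (and `0` if this restriction is not
smooth). -/
noncomputable def ofFun (L : ℝ) (f : ℝ → X) : SmoothCurve L X :=
  open Classical in
  if hf : ContDiffOn ℝ ∞ f (Icc 0 L) then
    ⟨indicator (Icc 0 L) f, hf.congr fun _ hs => indicator_of_mem hs f,
      fun _ hs => indicator_of_notMem hs f⟩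
  else 0

theorem ofFun_apply {f : ℝ → X} (hf : ContDiffOn ℝ ∞ f (Icc 0 L)) {s : ℝ} (hs : s ∈ Icc 0 L) :
    ofFun L f s = f s := by
  have : ofFun L f = ⟨indicator (Icc 0 L) f, hf.congr fun _ hs => indicator_of_mem hs f,
      fun _ hs => indicator_of_notMem hs f⟩ := dif_pos hf
  rw [this]
  exact indicator_of_mem hs f

theorem tendstoUniformlyOn_iff {ι : Type*} {l : Filter ι} {F : ι → SmoothCurve L X}
    {f : SmoothCurve L X} : TendstoUniformlyOn (fun i => F i) f l (Icc 0 L) ↔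
      ∀ ε > 0, ∀ᶠ i in l, ∀ s ∈ Icc 0 L, ‖(F i - f) s‖ < ε := by
  rw [Metric.tendstoUniformlyOn_iff]
  simp_rw [dist_comm (f _), dist_eq_norm]
  rfl

theorem tendsto_iff {ι : Type*} {l : Filter ι} {F : ι → SmoothCurve L X} {f : SmoothCurve L X} :
    Tendsto F l (𝓝 f) ↔ ∀ n, TendstoCk (Icc 0 L) l n (fun i => F i) f := by
  have h1 : Tendsto F l (𝓝 f) ↔ ∀ n, TendstoUniformlyOn
      (fun i => iteratedDerivWithin n (F i) (Icc 0 L)) (iteratedDerivWithin n f (Icc 0 L)) l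
      (Icc 0 L) := by
    rw [nhds_induced, tendsto_comap_iff, tendsto_pi_nhds]
    refine forall_congr' fun n => ?_
    rw [UniformFun.tendsto_iff_tendstoUniformly, tendstoUniformlyOn_iff_tendstoUniformly_comp_coe]
    rfl
  rw [h1]
  constructor
  · exact fun h n => tendstoCk_iff.2 fun k _ => h k
  · exact fun h n => tendstoCk_iff.1 (h n) n le_rfl

theorem eventually_forall_mem {ι : Type*} {l : Filter ι} {F : ι → SmoothCurve L X}
    {f : SmoothCurve L X} (h : Tendsto F l (𝓝 f)) {O : Set X} (hO : IsOpen O)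
    (hf : ∀ s ∈ Icc 0 L, f s ∈ O) : ∀ᶠ i in l, ∀ s ∈ Icc 0 L, F i s ∈ O :=
  eventually_mem_of_tendstoUniformlyOn isCompact_Icc f.continuousOn hO hf (tendsto_iff.1 h 0)

theorem isOpen_forall_mem {O : Set X} (hO : IsOpen O) :
    IsOpen {f : SmoothCurve L X | ∀ s ∈ Icc 0 L, f s ∈ O} :=
  isOpen_iff_mem_nhds.2 fun _ hf => eventually_forall_mem tendsto_id hO hf

end Basic

/-! ### Linear topology, seminorms and completeness -/

section Topology

set_option linter.unusedSectionVars false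

variable {L : ℝ} [hL : Fact (0 < L)] {X Y : Type} [NormedAddCommGroup X] [NormedSpace ℝ X]
  [NormedAddCommGroup Y] [NormedSpace ℝ Y]

variable (L) in
theorem uniqueDiffOn : UniqueDiffOn ℝ (Icc 0 L) := uniqueDiffOn_Icc hL.out

variable (L) in
theorem zero_mem : (0 : ℝ) ∈ Icc 0 L := ⟨le_rfl, hL.out.le⟩

variable (L) in
theorem right_mem : L ∈ Icc 0 L := ⟨hL.out.le, le_rfl⟩

/-- The derivatives of all orders of a smooth curve. -/
noncomputable def jets : SmoothCurve L X →ₗ[ℝ] (∀ _ : ℕ, BoundedContinuousFunction (Icc 0 L) X) where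
  toFun f n := BoundedContinuousFunction.mkOfCompact
    ⟨fun s => iteratedDerivWithin n f (Icc 0 L) s, (f.contDiffOn.continuousOn_iteratedDerivWithin
      (by exact_mod_cast le_top) (uniqueDiffOn L)).domRestrict⟩
  map_add' f g := by
    ext n s
    exact iteratedDerivWithin_add s.2 (uniqueDiffOn L)
      ((f.contDiffOn.of_le (by exact_mod_cast le_top)) s s.2)
      ((g.contDiffOn.of_le (by exact_mod_cast le_top)) s s.2)
  map_smul' c f := by
    ext n s
    exact iteratedDerivWithin_const_smul s.2 (uniqueDiffOn L) c
      ((f.contDiffOn.of_le (by exact_mod_cast le_top)) s s.2)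

@[simp] theorem jets_apply (f : SmoothCurve L X) (n : ℕ) (s : Icc 0 L) :
    jets f n s = iteratedDerivWithin n f (Icc 0 L) s := rfl

/-- On bounded continuous functions the sup-norm topology is that of uniform convergence. The
topology is thus induced by a linear map into a product of normed spaces, from which the vector
space topology, the Hausdorff property and the seminorms are read off. -/
theorem isInducing_jets : IsInducing (jets : SmoothCurve L X → _) := by
  have h1 : IsInducing (Pi.map (fun (_ : ℕ) (f : BoundedContinuousFunction (Icc 0 L) X) =>
      UniformFun.ofFun (f : Icc 0 L → X))) :=
    IsInducing.piMap fun _ => BoundedContinuousFunction.isInducing_coeFn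
  rw [← h1.of_comp_iff]
  exact ⟨rfl⟩

instance : IsTopologicalAddGroup (SmoothCurve L X) := by
  rw [isInducing_jets.eq_induced]
  exact topologicalAddGroup_induced jets

instance : ContinuousSMul ℝ (SmoothCurve L X) := by
  rw [isInducing_jets.eq_induced]
  exact continuousSMul_induced jets

theorem jets_injective : Function.Injective (jets : SmoothCurve L X → _) := by
  intro f g h
  refine ext_on fun s hs => ?_
  have := DFunLike.congr_fun (congr_fun h 0) ⟨s, hs⟩
  simpa using this

instance : T2Space (SmoothCurve L X) :=
  (IsEmbedding.mk isInducing_jets jets_injective).t2Space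

/-- The supremum norms of the derivatives. -/
noncomputable def derivSeminorm (n : ℕ) : Seminorm ℝ (SmoothCurve L X) :=
  (normSeminorm ℝ (BoundedContinuousFunction (Icc 0 L) X)).comp ((LinearMap.proj n).comp jets)

theorem withSeminorms_derivSeminorm :
    WithSeminorms (derivSeminorm : ℕ → Seminorm ℝ (SmoothCurve L X)) := by
  have h1 := withSeminorms_pi (𝕜 := ℝ) (fun _ : ℕ => norm_withSeminorms ℝ
    (BoundedContinuousFunction (Icc 0 L) X))
  have h2 := isInducing_jets.withSeminorms (f := (jets : SmoothCurve L X →ₗ[ℝ] _)) h1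
  exact h2.congr_equiv ((Equiv.sigmaUnique ℕ fun _ => Fin 1).symm)

theorem hasDerivWithinAt_integral [CompleteSpace X] {f : ℝ → X} (hf : ContinuousOn f (Icc 0 L))
    {s : ℝ} (hs : s ∈ Icc 0 L) :
    HasDerivWithinAt (fun x => ∫ y in (0 : ℝ)..x, f y) (f s) (Icc 0 L) s := by
  -- Extension by the end values makes the integrand continuous on the line, so that the two-sided
  -- fundamental theorem covers the end points too.
  have hg : Continuous (IccExtend hL.out.le (domRestrict (Icc 0 L) f)) :=
    (continuousOn_iff_continuous_domRestrict.1 hf).Icc_extend'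
  have heq : EqOn f (IccExtend hL.out.le (domRestrict (Icc 0 L) f)) (Icc 0 L) := fun x hx =>
    (IccExtend_of_mem hL.out.le (domRestrict (Icc 0 L) f) hx).symm
  have h1 : HasDerivWithinAt (fun x => ∫ y in (0 : ℝ)..x,
      IccExtend hL.out.le (domRestrict (Icc 0 L) f) y) (f s) (Icc 0 L) s := by
    rw [heq hs]
    exact (hg.integral_hasStrictDerivAt 0 s).hasDerivAt.hasDerivWithinAt
  have h2 : EqOn (fun x => ∫ y in (0 : ℝ)..x, f y) (fun x => ∫ y in (0 : ℝ)..x,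
      IccExtend hL.out.le (domRestrict (Icc 0 L) f) y) (Icc 0 L) := fun x hx => by
    refine intervalIntegral.integral_congr fun y hy => heq ?_
    rw [uIcc_of_le hx.1] at hy
    exact ⟨hy.1, hy.2.trans hx.2⟩
  exact h1.congr h2 (h2 hs)

theorem integral_eq_sub {f f' : ℝ → X} [CompleteSpace X] (hf' : ContinuousOn f' (Icc 0 L))
    (h : ∀ s ∈ Icc 0 L, HasDerivWithinAt f (f' s) (Icc 0 L) s) {s : ℝ} (hs : s ∈ Icc 0 L) :
    ∫ y in (0 : ℝ)..s, f' y = f s - f 0 := by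
  refine intervalIntegral.integral_eq_sub_of_hasDerivAt_of_le hs.1
    (fun x hx => ((h x ⟨hx.1, hx.2.trans hs.2⟩).continuousWithinAt.mono
      (Icc_subset_Icc_right hs.2))) (fun x hx => ?_) ?_
  · exact (h x ⟨hx.1.le, hx.2.le.trans hs.2⟩).hasDerivAt (Icc_mem_nhds hx.1 (hx.2.trans_le hs.2))
  · refine ContinuousOn.intervalIntegrable ?_
    rw [uIcc_of_le hs.1]
    exact hf'.mono (Icc_subset_Icc_right hs.2)

theorem eqOn_const_of_derivWithin_eq_zero {f : ℝ → X}
    (h : ∀ s ∈ Icc 0 L, HasDerivWithinAt f 0 (Icc 0 L) s) {s : ℝ} (hs : s ∈ Icc 0 L) :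
    f s = f 0 :=
  (convex_Icc 0 L).is_const_of_fderivWithin_eq_zero (𝕜 := ℝ)
    (fun x hx => (h x hx).differentiableWithinAt) (fun x hx => by
      rw [(h x hx).hasFDerivWithinAt.fderivWithin (uniqueDiffOn L x hx)]
      simp) hs (zero_mem L)

theorem integral_sub_le [CompleteSpace X] {f g : ℝ → X} (hf : ContinuousOn f (Icc 0 L))
    (hg : ContinuousOn g (Icc 0 L)) {ε : ℝ} (h : ∀ s ∈ Icc 0 L, dist (f s) (g s) ≤ ε) {s : ℝ}
    (hs : s ∈ Icc 0 L) :
    dist (∫ y in (0 : ℝ)..s, f y) (∫ y in (0 : ℝ)..s, g y) ≤ ε * L := by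
  have hsub : uIcc 0 s ⊆ Icc 0 L := by
    rw [uIcc_of_le hs.1]
    exact Icc_subset_Icc_right hs.2
  have hε : 0 ≤ ε := dist_nonneg.trans (h s hs)
  rw [dist_eq_norm, ← intervalIntegral.integral_sub (hf.mono hsub).intervalIntegrable
    (hg.mono hsub).intervalIntegrable]
  refine (intervalIntegral.norm_integral_le_of_norm_le_const (C := ε) fun x hx => ?_).trans ?_
  · rw [← dist_eq_norm]
    exact h x (hsub (uIoc_subset_uIcc hx))
  · rw [sub_zero, abs_of_nonneg hs.1]
    exact mul_le_mul_of_nonneg_left hs.2 hε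

theorem exists_of_iteratedDeriv {y : ℕ → ℝ → X}
    (hy : ∀ n, ∀ s ∈ Icc 0 L, HasDerivWithinAt (y n) (y (n + 1) s) (Icc 0 L) s) :
    ∃ f : SmoothCurve L X, ∀ n, ∀ s ∈ Icc 0 L, iteratedDerivWithin n f (Icc 0 L) s = y n s := by
  have hsm : ∀ m n : ℕ, ContDiffOn ℝ m (y n) (Icc 0 L) := by
    intro m
    induction m with
    | zero =>
      intro n
      exact contDiffOn_zero.2 fun s hs => (hy n s hs).continuousWithinAt
    | succ m ih =>
      intro n
      rw [show ((m + 1 : ℕ) : WithTop ℕ∞) = (m : WithTop ℕ∞) + 1 by norm_cast,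
        contDiffOn_succ_iff_derivWithin (uniqueDiffOn L)]
      refine ⟨fun s hs => (hy n s hs).differentiableWithinAt, by simp, ?_⟩
      exact (ih (n + 1)).congr fun s hs => (hy n s hs).derivWithin (uniqueDiffOn L s hs)
  have hsm' : ContDiffOn ℝ ∞ (y 0) (Icc 0 L) := contDiffOn_infty.2 fun m => hsm m 0
  refine ⟨ofFun L (y 0), fun n => ?_⟩
  induction n with
  | zero => intro s hs; simpa using ofFun_apply hsm' hs
  | succ n ih =>
    intro s hs
    rw [iteratedDerivWithin_succ, derivWithin_congr ih (ih s hs)]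
    exact (hy n s hs).derivWithin (uniqueDiffOn L s hs)

/-- Every derivative converges uniformly to some z_k. Passing to the limit in the fundamental
theorem of calculus shows that z_k has derivative z_(k+1), so the z_k are the derivatives of one
smooth curve. -/
theorem exists_tendsto_of_cauchy [CompleteSpace X] {x : ℕ → SmoothCurve L X}
    (hx : ∀ k : ℕ, ∀ ε : ℝ, 0 < ε → ∃ N : ℕ, ∀ m n : ℕ, N ≤ m → N ≤ n →
      derivSeminorm k (x m - x n) < ε) : ∃ a, Tendsto x atTop (𝓝 a) := by
  have hc : ∀ k, CauchySeq fun n => jets (x n) k := fun k => Metric.cauchySeq_iff.2 fun ε hε => by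
    obtain ⟨N, hN⟩ := hx k ε hε
    refine ⟨N, fun m hm n hn => ?_⟩
    have := hN m n hm hn
    simpa [derivSeminorm, dist_eq_norm] using this
  choose y hy using fun k => cauchySeq_tendsto_of_complete (hc k)
  have hcontx : ∀ k n, ContinuousOn (iteratedDerivWithin k (x n) (Icc 0 L)) (Icc 0 L) :=
    fun k n => (x n).contDiffOn.continuousOn_iteratedDerivWithin (by exact_mod_cast le_top)
      (uniqueDiffOn L)
  let z : ℕ → ℝ → X := fun k => IccExtend hL.out.le (y k)
  have hz : ∀ k, Continuous (z k) := fun k => (y k).continuous.Icc_extend'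
  have hzy : ∀ k s (hs : s ∈ Icc 0 L), z k s = y k ⟨s, hs⟩ := fun k s hs => IccExtend_of_mem _ _ hs
  have hunif : ∀ k, ∀ ε > 0, ∀ᶠ n in atTop, ∀ s ∈ Icc 0 L,
      dist (iteratedDerivWithin k (x n) (Icc 0 L) s) (z k s) ≤ ε := by
    intro k ε hε
    filter_upwards [Metric.tendsto_nhds.1 (hy k) ε hε] with n hn s hs
    rw [hzy k s hs]
    exact (BoundedContinuousFunction.dist_coe_le_dist (f := jets (x n) k) (g := y k)
      (⟨s, hs⟩ : Icc 0 L)).trans hn.le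
  have hpt : ∀ k, ∀ s ∈ Icc 0 L, Tendsto (fun n => iteratedDerivWithin k (x n) (Icc 0 L) s)
      atTop (𝓝 (z k s)) := by
    intro k s hs
    rw [Metric.tendsto_nhds]
    intro ε hε
    filter_upwards [hunif k (ε / 2) (half_pos hε)] with n hn
    exact (hn s hs).trans_lt (half_lt_self hε)
  have hder : ∀ k n, ∀ s ∈ Icc 0 L, HasDerivWithinAt (iteratedDerivWithin k (x n) (Icc 0 L))
      (iteratedDerivWithin (k + 1) (x n) (Icc 0 L) s) (Icc 0 L) s := by
    intro k n s hs
    rw [iteratedDerivWithin_succ]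
    exact ((x n).contDiffOn.differentiableOn_iteratedDerivWithin
      (by exact_mod_cast WithTop.coe_lt_top _) (uniqueDiffOn L) s hs).hasDerivWithinAt
  have hint : ∀ k, ∀ s ∈ Icc 0 L, z k s = z k 0 + ∫ r in (0 : ℝ)..s, z (k + 1) r := by
    intro k s hs
    have h1 : Tendsto (fun n => ∫ r in (0 : ℝ)..s, iteratedDerivWithin (k + 1) (x n) (Icc 0 L) r)
        atTop (𝓝 (∫ r in (0 : ℝ)..s, z (k + 1) r)) := by
      rw [Metric.tendsto_nhds]
      intro ε hε
      have hL0 := hL.out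
      filter_upwards [hunif (k + 1) (ε / (2 * L)) (by positivity)] with n hn
      refine (integral_sub_le (hcontx (k + 1) n) (hz (k + 1)).continuousOn hn hs).trans_lt ?_
      rw [div_mul_eq_mul_div, div_lt_iff₀ (by positivity)]
      nlinarith
    have h2 : Tendsto (fun n => iteratedDerivWithin k (x n) (Icc 0 L) s) atTop
        (𝓝 (z k 0 + ∫ r in (0 : ℝ)..s, z (k + 1) r)) := by
      refine ((hpt k 0 (zero_mem L)).add h1).congr fun n => ?_
      rw [integral_eq_sub (hcontx (k + 1) n) (hder k n) hs]
      abel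
    exact tendsto_nhds_unique (hpt k s hs) h2
  obtain ⟨a, ha⟩ := exists_of_iteratedDeriv (L := L) (y := z) fun k s hs => by
    have := (hasDerivWithinAt_integral (hz (k + 1)).continuousOn hs).const_add (z k 0)
    exact this.congr (hint k) (hint k s hs)
  refine ⟨a, isInducing_jets.tendsto_nhds_iff.2 (tendsto_pi_nhds.2 fun k => ?_)⟩
  have : jets a k = y k := by
    ext s
    rw [jets_apply, ha k s s.2, hzy k s s.2]
  simpa [this] using hy k

/-- A closed subspace of `C^∞([0, L], X)` is a Fréchet space. -/
theorem isFrechetSpace_submodule [CompleteSpace X] (p : Submodule ℝ (SmoothCurve L X))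
    (hp : IsClosed (p : Set (SmoothCurve L X))) : FrechetCalculus.IsFrechetSpace p := by
  refine ⟨inferInstance, _, IsInducing.withSeminorms withSeminorms_derivSeminorm
    (f := p.subtype) IsInducing.subtypeVal, fun x hx => ?_⟩
  obtain ⟨a, ha⟩ := exists_tendsto_of_cauchy (x := fun n => (x n : SmoothCurve L X)) hx
  exact ⟨⟨a, hp.mem_of_tendsto ha (Eventually.of_forall fun n => (x n).2)⟩,
    tendsto_subtype_rng.2 ha⟩

end Topology

end SmoothCurve

/-! ## Operators on smooth curves -/

namespace SmoothCurve

open FrechetCalculus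

section Operators

set_option linter.unusedSectionVars false

variable {L : ℝ} [hL : Fact (0 < L)] {X Y Z : Type} [NormedAddCommGroup X] [NormedSpace ℝ X]
  [NormedAddCommGroup Y] [NormedSpace ℝ Y] [NormedAddCommGroup Z] [NormedSpace ℝ Z]

theorem contDiffOn_pair (f : SmoothCurve L X) (g : SmoothCurve L Y) :
    ContDiffOn ℝ ∞ (fun s => (f s, g s)) (Icc 0 L) :=
  f.contDiffOn.prodMk g.contDiffOn

/-- The pairing of curves. -/
noncomputable def pairL : (SmoothCurve L X × SmoothCurve L Y) →L[ℝ] SmoothCurve L (X × Y) where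
  toFun p := ofFun L fun s => (p.1 s, p.2 s)
  map_add' p q := ext_on fun s hs => by
    rw [add_eval, ofFun_apply (contDiffOn_pair _ _) hs, ofFun_apply (contDiffOn_pair _ _) hs,
      ofFun_apply (contDiffOn_pair _ _) hs]
    rfl
  map_smul' c p := ext_on fun s hs => by
    rw [smul_eval, ofFun_apply (contDiffOn_pair _ _) hs, ofFun_apply (contDiffOn_pair _ _) hs]
    rfl
  cont := by
    refine continuous_iff_continuousAt.2 fun p => tendsto_iff.2 fun n => ?_
    have h1 := tendsto_iff.1 ((continuous_fst (X := SmoothCurve L X) (Y := SmoothCurve L Y)).tendsto p) n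
    have h2 := tendsto_iff.1 ((continuous_snd (X := SmoothCurve L X) (Y := SmoothCurve L Y)).tendsto p) n
    refine (h1.prodMk (uniqueDiffOn L) h2 (fun q => q.1.contDiffOn) p.1.contDiffOn
      (fun q => q.2.contDiffOn) p.2.contDiffOn).congr (Eventually.of_forall fun q s hs => ?_)
      fun s hs => ?_
    · exact (ofFun_apply (contDiffOn_pair _ _) hs).symm
    · exact (ofFun_apply (contDiffOn_pair _ _) hs).symm

@[simp] theorem pairL_apply (p : SmoothCurve L X × SmoothCurve L Y) {s : ℝ} (hs : s ∈ Icc 0 L) :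
    pairL p s = (p.1 s, p.2 s) :=
  ofFun_apply (contDiffOn_pair _ _) hs

/-- Differentiation of curves. -/
noncomputable def derivL : SmoothCurve L X →L[ℝ] SmoothCurve L X where
  toFun f := ofFun L (derivWithin f (Icc 0 L))
  map_add' f g := ext_on fun s hs => by
    have h := fun f : SmoothCurve L X => contDiffOn_derivWithin_infty (uniqueDiffOn L) f.contDiffOn
    rw [add_eval, ofFun_apply (h _) hs, ofFun_apply (h _) hs, ofFun_apply (h _) hs]
    exact derivWithin_add (f.differentiableOn s hs) (g.differentiableOn s hs)
  map_smul' c f := ext_on fun s hs => by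
    have h := fun f : SmoothCurve L X => contDiffOn_derivWithin_infty (uniqueDiffOn L) f.contDiffOn
    rw [smul_eval, ofFun_apply (h _) hs, ofFun_apply (h _) hs]
    exact derivWithin_const_smul c (f.differentiableOn s hs)
  cont := by
    have h := fun f : SmoothCurve L X => contDiffOn_derivWithin_infty (uniqueDiffOn L) f.contDiffOn
    refine continuous_iff_continuousAt.2 fun f => tendsto_iff.2 fun n => ?_
    refine TendstoCk.congr (tendsto_iff.1 (tendsto_id (x := 𝓝 f)) (n + 1)).2
      (Eventually.of_forall fun g s hs => ?_) fun s hs => ?_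
    · exact (ofFun_apply (h _) hs).symm
    · exact (ofFun_apply (h _) hs).symm

theorem derivL_apply (f : SmoothCurve L X) {s : ℝ} (hs : s ∈ Icc 0 L) :
    derivL f s = derivWithin f (Icc 0 L) s :=
  ofFun_apply (contDiffOn_derivWithin_infty (uniqueDiffOn L) f.contDiffOn) hs

theorem hasDerivWithinAt (f : SmoothCurve L X) {s : ℝ} (hs : s ∈ Icc 0 L) :
    HasDerivWithinAt f (derivL f s) (Icc 0 L) s := by
  rw [derivL_apply f hs]
  exact (f.differentiableOn s hs).hasDerivWithinAt

theorem derivL_eq {f : SmoothCurve L X} {f' : X} {s : ℝ} (hs : s ∈ Icc 0 L)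
    (h : HasDerivWithinAt f f' (Icc 0 L) s) : derivL f s = f' := by
  rw [derivL_apply f hs]
  exact h.derivWithin (uniqueDiffOn L s hs)

theorem contDiffOn_of_hasDerivWithinAt {f f' : ℝ → X} (hf' : ContDiffOn ℝ ∞ f' (Icc 0 L))
    (h : ∀ s ∈ Icc 0 L, HasDerivWithinAt f (f' s) (Icc 0 L) s) : ContDiffOn ℝ ∞ f (Icc 0 L) :=
  (contDiffOn_infty_iff_derivWithin (uniqueDiffOn L)).2
    ⟨fun s hs => (h s hs).differentiableWithinAt,
      hf'.congr fun s hs => (h s hs).derivWithin (uniqueDiffOn L s hs)⟩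

theorem contDiffOn_integral [CompleteSpace X] (f : SmoothCurve L X) :
    ContDiffOn ℝ ∞ (fun s => ∫ y in (0 : ℝ)..s, f y) (Icc 0 L) :=
  contDiffOn_of_hasDerivWithinAt f.contDiffOn fun _ hs => hasDerivWithinAt_integral f.continuousOn hs

theorem intervalIntegrable (f : SmoothCurve L X) {s : ℝ} (hs : s ∈ Icc 0 L) :
    IntervalIntegrable f MeasureTheory.volume 0 s := by
  refine ContinuousOn.intervalIntegrable (f.continuousOn.mono ?_)
  rw [uIcc_of_le hs.1]
  exact Icc_subset_Icc_right hs.2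

/-- The primitive vanishing at `0`. -/
noncomputable def primL [CompleteSpace X] : SmoothCurve L X →L[ℝ] SmoothCurve L X where
  toFun f := ofFun L fun s => ∫ y in (0 : ℝ)..s, f y
  map_add' f g := ext_on fun s hs => by
    rw [add_eval, ofFun_apply (contDiffOn_integral _) hs, ofFun_apply (contDiffOn_integral _) hs,
      ofFun_apply (contDiffOn_integral _) hs,
      ← intervalIntegral.integral_add (f.intervalIntegrable hs) (g.intervalIntegrable hs)]
    rfl
  map_smul' c f := ext_on fun s hs => by
    rw [smul_eval, ofFun_apply (contDiffOn_integral _) hs, ofFun_apply (contDiffOn_integral _) hs]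
    exact intervalIntegral.integral_smul c f
  cont := by
    -- Only the order zero needs an estimate: the derivatives of a primitive are the function itself
    -- and its derivatives.
    have hu : ∀ f : SmoothCurve L X, TendstoUniformlyOn
        (fun (g : SmoothCurve L X) s => ∫ y in (0 : ℝ)..s, g y)
        (fun s => ∫ y in (0 : ℝ)..s, f y) (𝓝 f) (Icc 0 L) := by
      intro f
      have h0 := tendsto_iff.1 (tendsto_id (x := 𝓝 f)) 0
      rw [TendstoCk, Metric.tendstoUniformlyOn_iff] at h0
      rw [Metric.tendstoUniformlyOn_iff]
      intro ε hε
      have hL0 := hL.out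
      filter_upwards [h0 (ε / (2 * L)) (by positivity)] with g hg s hs
      refine (integral_sub_le f.continuousOn g.continuousOn
        (fun s hs => (hg s hs).le) hs).trans_lt ?_
      rw [div_mul_eq_mul_div, div_lt_iff₀ (by positivity)]
      nlinarith
    refine continuous_iff_continuousAt.2 fun f => tendsto_iff.2 fun n => ?_
    refine TendstoCk.congr (F := fun (g : SmoothCurve L X) s => ∫ y in (0 : ℝ)..s, g y)
      (f := fun s => ∫ y in (0 : ℝ)..s, f y) ?_
      (Eventually.of_forall fun g s hs => (ofFun_apply (contDiffOn_integral g) hs).symm)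
      fun s hs => (ofFun_apply (contDiffOn_integral f) hs).symm
    cases n with
    | zero => exact hu f
    | succ n =>
      refine ⟨hu f, (tendsto_iff.1 (tendsto_id (x := 𝓝 f)) n).congr
        (Eventually.of_forall fun g s hs => ?_) fun s hs => ?_⟩
      · exact ((hasDerivWithinAt_integral g.continuousOn hs).derivWithin
          (uniqueDiffOn L s hs)).symm
      · exact ((hasDerivWithinAt_integral f.continuousOn hs).derivWithin
          (uniqueDiffOn L s hs)).symm

theorem primL_apply [CompleteSpace X] (f : SmoothCurve L X) {s : ℝ} (hs : s ∈ Icc 0 L) :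
    primL f s = ∫ y in (0 : ℝ)..s, f y :=
  ofFun_apply (contDiffOn_integral f) hs

@[simp] theorem primL_zero [CompleteSpace X] (f : SmoothCurve L X) : primL f 0 = 0 := by
  rw [primL_apply f (zero_mem L), intervalIntegral.integral_same]

theorem derivL_primL [CompleteSpace X] (f : SmoothCurve L X) : derivL (primL f) = f :=
  ext_on fun _ hs => derivL_eq hs <|
    (hasDerivWithinAt_integral f.continuousOn hs).congr (fun _ hx => primL_apply f hx)
      (primL_apply f hs)

theorem eq_of_derivL_eq {f g : SmoothCurve L X} (h : derivL f = derivL g) (h0 : f 0 = g 0) :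
    f = g := by
  refine ext_on fun s hs => ?_
  have := eqOn_const_of_derivWithin_eq_zero (f := fun s => f s - g s) (fun s hs => by
    have := (f.hasDerivWithinAt hs).sub (g.hasDerivWithinAt hs)
    rwa [h, sub_self] at this) hs
  rwa [h0, sub_self, sub_eq_zero] at this

theorem eval_eq_of_derivL_eq_zero {f : SmoothCurve L X} (h : ∀ s ∈ Icc 0 L, derivL f s = 0)
    {s : ℝ} (hs : s ∈ Icc 0 L) : f s = f 0 :=
  eqOn_const_of_derivWithin_eq_zero (fun s hs => h s hs ▸ f.hasDerivWithinAt hs) hs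

/-- Evaluation at a point. -/
noncomputable def evalL (s : ℝ) : SmoothCurve L X →L[ℝ] X where
  toFun f := f s
  map_add' _ _ := rfl
  map_smul' _ _ := rfl
  cont := by
    by_cases hs : s ∈ Icc 0 L
    · exact continuous_iff_continuousAt.2 fun f =>
        (tendsto_iff.1 (tendsto_id (x := 𝓝 f)) 0).tendstoUniformlyOn.tendsto_at hs
    · exact continuous_const.congr fun f => (f.2.2 s hs).symm

@[simp] theorem evalL_apply (s : ℝ) (f : SmoothCurve L X) : evalL s f = f s := rfl

theorem continuous_iteratedDerivWithin (n : ℕ) {s : ℝ} (hs : s ∈ Icc 0 L) :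
    Continuous fun f : SmoothCurve L X => iteratedDerivWithin n f (Icc 0 L) s :=
  continuous_iff_continuousAt.2 fun f =>
    (tendstoCk_iff.1 (tendsto_iff.1 (tendsto_id (x := 𝓝 f)) n) n le_rfl).tendsto_at hs

/-- The superposition operator `f ↦ Φ ∘ f`. -/
noncomputable def superpose (Φ : X → Y) (f : SmoothCurve L X) : SmoothCurve L Y :=
  ofFun L fun s => Φ (f s)

theorem superpose_apply {Φ : X → Y} {O : Set X} (hΦ : ContDiffOn ℝ ∞ Φ O) {f : SmoothCurve L X}
    (hf : ∀ s ∈ Icc 0 L, f s ∈ O) {s : ℝ} (hs : s ∈ Icc 0 L) : superpose Φ f s = Φ (f s) :=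
  ofFun_apply (contDiffOn_superpose hΦ f.contDiffOn hf) hs

theorem superpose_apply' {Φ : X → Y} (hΦ : ContDiff ℝ ∞ Φ) (f : SmoothCurve L X)
    {s : ℝ} (hs : s ∈ Icc 0 L) : superpose Φ f s = Φ (f s) :=
  superpose_apply hΦ.contDiffOn (fun _ _ => mem_univ _) hs

theorem derivL_superpose {Φ : X → Y} {O : Set X} (hO : IsOpen O) (hΦ : ContDiffOn ℝ ∞ Φ O)
    {f : SmoothCurve L X} (hf : ∀ s ∈ Icc 0 L, f s ∈ O) {s : ℝ} (hs : s ∈ Icc 0 L) :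
    derivL (superpose Φ f) s = fderiv ℝ Φ (f s) (derivL f s) := by
  rw [derivL_apply _ hs, derivL_apply _ hs,
    derivWithin_congr (fun x hx => superpose_apply hΦ hf hx) (superpose_apply hΦ hf hs)]
  exact derivWithin_superpose (uniqueDiffOn L) hO hΦ f.contDiffOn hf hs

theorem contDiff_of_linear [FiniteDimensional ℝ X] (A : X →ₗ[ℝ] Y) : ContDiff ℝ ∞ A :=
  A.toContinuousLinearMap.contDiff

theorem fderiv_of_linear [FiniteDimensional ℝ X] (A : X →ₗ[ℝ] Y) (x v : X) :
    fderiv ℝ A x v = A v :=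
  congr_fun (congr_arg _ (A.toContinuousLinearMap.fderiv (x := x))) v

theorem tendsto_superpose {ι : Type*} {l : Filter ι} {Φ : X → Y} {O : Set X} (hO : IsOpen O)
    (hΦ : ContDiffOn ℝ ∞ Φ O) {F : ι → SmoothCurve L X} {f : SmoothCurve L X}
    (hF : Tendsto F l (𝓝 f)) (hf : ∀ s ∈ Icc 0 L, f s ∈ O) :
    Tendsto (fun i => superpose Φ (F i)) l (𝓝 (superpose Φ f)) := by
  refine tendsto_iff.2 fun n => ?_
  refine ((tendsto_iff.1 hF n).superpose (uniqueDiffOn L) isCompact_Icc hO hΦ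
    (fun i => (F i).contDiffOn) f.contDiffOn hf).congr ?_ ?_
  · filter_upwards [eventually_forall_mem hF hO hf] with i hi s hs
    exact (superpose_apply hΦ hi hs).symm
  · exact fun s hs => (superpose_apply hΦ hf hs).symm

/-- An instance of `TendstoCk.slope`, indexed by the pairs of step and direction along the product
filter that defines Hadamard derivatives. -/
theorem hasHadamardDeriv_superpose {Φ : X → Y} {O : Set X} (hO : IsOpen O)
    (hΦ : ContDiffOn ℝ ∞ Φ O) {f : SmoothCurve L X} (hf : ∀ s ∈ Icc 0 L, f s ∈ O)
    (u : SmoothCurve L X) :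
    HasHadamardDeriv (superpose Φ) f u (superpose (tmap Φ) (pairL (f, u))) := by
  refine tendsto_iff.2 fun n => ?_
  have hu : Tendsto (fun p : ℝ × SmoothCurve L X => p.2) (𝓝[≠] 0 ×ˢ 𝓝 u) (𝓝 u) := tendsto_snd
  have ht : Tendsto (fun p : ℝ × SmoothCurve L X => p.1) (𝓝[≠] 0 ×ˢ 𝓝 u) (𝓝[≠] 0) := tendsto_fst
  have hconv : Tendsto (fun p : ℝ × SmoothCurve L X => f + p.1 • p.2) (𝓝[≠] 0 ×ˢ 𝓝 u) (𝓝 f) := by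
    have := (tendsto_const_nhds (x := f)).add ((ht.mono_right nhdsWithin_le_nhds).smul hu)
    simpa using this
  refine ((tendsto_iff.1 hu n).slope (uniqueDiffOn L) isCompact_Icc hO hΦ ht
    (fun p => p.2.contDiffOn) u.contDiffOn f.contDiffOn hf).congr ?_ ?_
  · filter_upwards [eventually_forall_mem hconv hO hf] with p hp s hs
    rw [smul_eval, sub_eval, superpose_apply hΦ hp hs, superpose_apply hΦ hf hs]
    rfl
  · intro s hs
    have : ∀ s ∈ Icc 0 L, pairL (f, u) s ∈ O ×ˢ (univ : Set X) := fun s hs => by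
      rw [pairL_apply _ hs]
      exact ⟨hf s hs, mem_univ _⟩
    rw [superpose_apply (contDiffOn_tmap hO hΦ) this hs, pairL_apply _ hs]

/-- Superposition operators are smooth. -/
theorem hadamardCkOn_superpose (n : ℕ) {Φ : X → Y} {O : Set X} (hO : IsOpen O)
    (hΦ : ContDiffOn ℝ ∞ Φ O) :
    HadamardCkOn n (superpose Φ : SmoothCurve L X → SmoothCurve L Y)
      {f | ∀ s ∈ Icc 0 L, f s ∈ O} := by
  have hc : ContinuousOn (superpose Φ : SmoothCurve L X → SmoothCurve L Y)
      {f | ∀ s ∈ Icc 0 L, f s ∈ O} := fun f hf =>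
    (tendsto_superpose hO hΦ tendsto_id hf).mono_left nhdsWithin_le_nhds
  induction n generalizing X with
  | zero => exact hc
  | succ n ih =>
    refine ⟨hc, fun p => superpose (tmap Φ) (pairL p),
      fun f hf u => hasHadamardDeriv_superpose hO hΦ hf u, ?_⟩
    refine (ih (hO.prod isOpen_univ) (contDiffOn_tmap hO hΦ) ?_).comp_clm pairL
      fun p hp s hs => ?_
    · exact fun f hf => (tendsto_superpose (hO.prod isOpen_univ) (contDiffOn_tmap hO hΦ)
        tendsto_id hf).mono_left nhdsWithin_le_nhds
    · rw [pairL_apply _ hs]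
      exact ⟨hp.1 s hs, mem_univ _⟩

theorem CkOn.superpose {n : ℕ} {Φ : X → Y} {O : Set X} (hO : IsOpen O)
    (hΦ : ContDiffOn ℝ ∞ Φ O) {E : Type} [AddCommGroup E] [Module ℝ E] [TopologicalSpace E]
    {f : E → SmoothCurve L X} {U : Set E} (hf : CkOn n f U)
    (h : ∀ x ∈ U, ∀ s ∈ Icc 0 L, f x s ∈ O) : CkOn n (fun x => superpose Φ (f x)) U :=
  (hadamardCkOn_superpose n hO hΦ).comp hf h

theorem CkOn.superpose' {n : ℕ} {Φ : X → Y} (hΦ : ContDiff ℝ ∞ Φ)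
    {E : Type} [AddCommGroup E] [Module ℝ E] [TopologicalSpace E]
    {f : E → SmoothCurve L X} {U : Set E} (hf : CkOn n f U) :
    CkOn n (fun x => SmoothCurve.superpose Φ (f x)) U :=
  CkOn.superpose isOpen_univ hΦ.contDiffOn hf fun _ _ _ _ => mem_univ _

/-- Pointwise application of a smooth map of two variables. -/
theorem CkOn.superpose₂ {n : ℕ} {Φ : X × Y → Z} (hΦ : ContDiff ℝ ∞ Φ)
    {E : Type} [AddCommGroup E] [Module ℝ E] [TopologicalSpace E]
    {f : E → SmoothCurve L X} {g : E → SmoothCurve L Y} {U : Set E} (hf : CkOn n f U)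
    (hg : CkOn n g U) : CkOn n (fun x => SmoothCurve.superpose Φ (pairL (f x, g x))) U :=
  CkOn.superpose' hΦ ((hf.prodMk hg).clm_comp pairL)

end Operators

end SmoothCurve

/-! ## Linear differential equations -/

section LinearODE

variable {A : Type*} [NormedRing A] [NormedAlgebra ℝ A]

/-- The Picard iterates of the equation `g' = g Λ`. -/
noncomputable def picardIterate (Λ : ℝ → A) : ℕ → ℝ → A
  | 0 => fun _ => 1
  | n + 1 => fun s => ∫ x in (0 : ℝ)..s, picardIterate Λ n x * Λ x

theorem continuous_picardIterate [CompleteSpace A] {Λ : ℝ → A} (hΛ : Continuous Λ) (n : ℕ) :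
    Continuous (picardIterate Λ n) := by
  induction n with
  | zero => exact continuous_const
  | succ n ih =>
    exact continuous_iff_continuousAt.2 fun s =>
      ((ih.mul hΛ).integral_hasStrictDerivAt 0 s).hasDerivAt.continuousAt

theorem hasDerivAt_picardIterate [CompleteSpace A] {Λ : ℝ → A} (hΛ : Continuous Λ) (n : ℕ)
    (s : ℝ) : HasDerivAt (picardIterate Λ (n + 1)) (picardIterate Λ n s * Λ s) s :=
  (((continuous_picardIterate hΛ n).mul hΛ).integral_hasStrictDerivAt 0 s).hasDerivAt

/-- Each integration contributes a factor K|s| and a new divisor, giving the exponential series. The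
factor `‖1‖` is there since the unit is not assumed to have norm one. -/
theorem norm_picardIterate_le [CompleteSpace A] {Λ : ℝ → A} (hΛ : Continuous Λ) {K : ℝ}
    (hK : ∀ s, ‖Λ s‖ ≤ K) (n : ℕ) (s : ℝ) :
    ‖picardIterate Λ n s‖ ≤ ‖(1 : A)‖ * (K ^ n * |s| ^ n / n.factorial) := by
  have hK0 : 0 ≤ K := (norm_nonneg _).trans (hK 0)
  induction n generalizing s with
  | zero => simp [picardIterate]
  | succ n ih =>
    have hc := (continuous_picardIterate hΛ n).mul hΛ
    calc ‖picardIterate Λ (n + 1) s‖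
        ≤ ∫ x in uIoc 0 s, ‖picardIterate Λ n x * Λ x‖ :=
          intervalIntegral.norm_integral_le_integral_norm_uIoc
      _ ≤ ∫ x in uIoc 0 s, ‖(1 : A)‖ * K ^ (n + 1) / n.factorial * |x - 0| ^ n := by
          refine MeasureTheory.setIntegral_mono ?_ ?_ fun x => ?_
          · exact (hc.norm.continuousOn.integrableOn_compact isCompact_uIcc).mono_set
              uIoc_subset_uIcc
          · refine ((Continuous.continuousOn (by fun_prop)).integrableOn_compact
              isCompact_uIcc).mono_set uIoc_subset_uIcc
          · refine (norm_mul_le _ _).trans ((mul_le_mul (ih x) (hK x) (norm_nonneg _)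
              (by positivity)).trans_eq ?_)
            rw [sub_zero]
            ring
      _ = ‖(1 : A)‖ * (K ^ (n + 1) * |s| ^ (n + 1) / (n + 1).factorial) := by
          rw [MeasureTheory.integral_const_mul, integral_pow_abs_sub_uIoc, sub_zero,
            Nat.factorial_succ]
          push_cast
          field_simp

/-- The sum of the Picard iterates solves the equation: the derivative of each iterate is the
preceding one times `Λ`, and termwise differentiation is justified by the exponential bound. -/
theorem exists_hasDerivAt_mul [CompleteSpace A] {Λ : ℝ → A} (hΛ : Continuous Λ) {K : ℝ}
    (hK : ∀ s, ‖Λ s‖ ≤ K) :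
    ∃ g : ℝ → A, g 0 = 1 ∧ ∀ s, HasDerivAt g (g s * Λ s) s := by
  have hK0 : 0 ≤ K := (norm_nonneg _).trans (hK 0)
  have hsum : ∀ s, Summable fun n => picardIterate Λ n s := fun s => by
    refine Summable.of_norm_bounded (g := fun n : ℕ => ‖(1 : A)‖ * ((K * |s|) ^ n / n.factorial))
      ((Real.summable_pow_div_factorial _).mul_left _) fun n => ?_
    rw [mul_pow]
    exact norm_picardIterate_le hΛ hK n s
  have hsum' : ∀ s, Summable fun n => picardIterate Λ (n + 1) s := fun s =>
    (summable_nat_add_iff 1).2 (hsum s)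
  have heq : ∀ s, ∑' n, picardIterate Λ n s = 1 + ∑' n, picardIterate Λ (n + 1) s := fun s =>
    (hsum s).tsum_eq_zero_add
  -- The zeroth iterate is split off, so that the remaining terms all vanish at 0 and differentiate
  -- to the full series times `Λ`.
  refine ⟨fun s => 1 + ∑' n, picardIterate Λ (n + 1) s, ?_, fun s => ?_⟩
  · simp [picardIterate]
  · have hd := hasDerivAt_tsum_of_isPreconnected (g := fun n => picardIterate Λ (n + 1))
      (g' := fun n s => picardIterate Λ n s * Λ s)
      -- A summable bound for the derivatives, uniform on the ball of radius |s| + 1, which contains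
      -- both 0 and `s`.
      (u := fun n : ℕ => ‖(1 : A)‖ * ((K * (|s| + 1)) ^ n / n.factorial) * K)
      (t := Metric.ball 0 (|s| + 1)) (y₀ := 0) (y := s)
      (((Real.summable_pow_div_factorial _).mul_left _).mul_right _) Metric.isOpen_ball
      (convex_ball _ _).isPreconnected (fun n y _ => hasDerivAt_picardIterate hΛ n y)
      (fun n y hy => ?_) (by simp; positivity) (hsum' 0) (by simp)
    · rw [(hsum s).tsum_mul_right, heq s] at hd
      exact hd.const_add 1
    · have hy' : |y| ≤ |s| + 1 := by simpa using (Metric.mem_ball.1 hy).le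
      refine (norm_mul_le _ _).trans (mul_le_mul ((norm_picardIterate_le hΛ hK n y).trans ?_)
        (hK y) (norm_nonneg _) (by positivity))
      rw [mul_pow]
      gcongr

end LinearODE

/-! ### Solutions on the interval and their regularity -/

namespace SmoothCurve

variable {L : ℝ} [hL : Fact (0 < L)] {A : Type} [NormedRing A] [NormedAlgebra ℝ A]

/-- Bootstrapping: if `g` is of class C^n, then so is its derivative `g Λ`. -/
theorem contDiffOn_of_hasDerivWithinAt_mul {g : ℝ → A} (Λ : SmoothCurve L A)
    (hg : ∀ s ∈ Icc 0 L, HasDerivWithinAt g (g s * Λ s) (Icc 0 L) s) :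
    ContDiffOn ℝ ∞ g (Icc 0 L) := by
  refine contDiffOn_infty.2 fun n => ?_
  induction n with
  | zero => exact contDiffOn_zero.2 fun s hs => (hg s hs).continuousWithinAt
  | succ n ih =>
    rw [show ((n + 1 : ℕ) : WithTop ℕ∞) = (n : WithTop ℕ∞) + 1 by norm_cast,
      contDiffOn_succ_iff_derivWithin (uniqueDiffOn L)]
    refine ⟨fun s hs => (hg s hs).differentiableWithinAt, by simp, ?_⟩
    exact (ih.mul (Λ.contDiffOn.of_le (by exact_mod_cast le_top))).congr fun s hs =>
      (hg s hs).derivWithin (uniqueDiffOn L s hs)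

theorem exists_solution [CompleteSpace A] (Λ : SmoothCurve L A) :
    ∃ g : SmoothCurve L A, g 0 = 1 ∧ ∀ s ∈ Icc 0 L, derivL g s = g s * Λ s := by
  -- The coefficient is continued by its end values to a bounded continuous function on the line, as
  -- the global existence result requires.
  have hc := (continuousOn_iff_continuous_domRestrict.1 Λ.continuousOn)
  have hΛ : Continuous (IccExtend hL.out.le (domRestrict (Icc 0 L) Λ)) := hc.Icc_extend'
  obtain ⟨K, hK⟩ := isCompact_Icc.exists_bound_of_continuousOn Λ.continuousOn
  obtain ⟨g, hg0, hg⟩ := exists_hasDerivAt_mul hΛ (K := K) fun s => hK _ (projIcc 0 L _ s).2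
  have hg' : ∀ s ∈ Icc 0 L, HasDerivWithinAt g (g s * Λ s) (Icc 0 L) s := fun s hs => by
    have := (hg s).hasDerivWithinAt (s := Icc 0 L)
    rwa [IccExtend_of_mem hL.out.le _ hs] at this
  have hsm := contDiffOn_of_hasDerivWithinAt_mul Λ hg'
  refine ⟨ofFun L g, (ofFun_apply hsm (zero_mem L)).trans hg0, fun s hs => derivL_eq hs ?_⟩
  rw [ofFun_apply hsm hs]
  exact (hg' s hs).congr (fun x hx => ofFun_apply hsm hx) (ofFun_apply hsm hs)

/-- The solution of `g' = g Λ`, `g(0) = 1`. -/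
noncomputable def sol [CompleteSpace A] (Λ : SmoothCurve L A) : SmoothCurve L A :=
  (exists_solution Λ).choose

@[simp] theorem sol_zero [CompleteSpace A] (Λ : SmoothCurve L A) : sol Λ 0 = 1 :=
  (exists_solution Λ).choose_spec.1

theorem derivL_sol [CompleteSpace A] (Λ : SmoothCurve L A) {s : ℝ} (hs : s ∈ Icc 0 L) :
    derivL (sol Λ) s = sol Λ s * Λ s :=
  (exists_solution Λ).choose_spec.2 s hs

end SmoothCurve

/-! ## Matrix equations with traceless coefficients -/

namespace Darboux

open FrechetCalculus SmoothCurve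

/-- The adjugate of `2 × 2` matrices, as a real-linear map. -/
noncomputable def adjL : Mat →ₗ[ℝ] Mat where
  toFun M := M.adjugate
  map_add' M N := by
    ext i j
    fin_cases i <;> fin_cases j <;> simp [Matrix.adjugate_fin_two, add_comm]
  map_smul' c M := by
    ext i j
    fin_cases i <;> fin_cases j <;> simp [Matrix.adjugate_fin_two]

theorem contDiff_adjugate : ContDiff ℝ ∞ (fun M : Mat => M.adjugate) := contDiff_of_linear adjL

theorem adjugate_of_trace_eq_zero {M : Mat} (hM : M.trace = 0) : M.adjugate = -M := by
  rw [Matrix.trace_fin_two] at hM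
  have h1 : M 1 1 = -M 0 0 := by linear_combination hM
  ext i j
  fin_cases i <;> fin_cases j <;> simp [Matrix.adjugate_fin_two, h1]

variable {L : ℝ} [hL : Fact (0 < L)]

/-- The pointwise product of matrix curves. -/
noncomputable def mulC (f g : SmoothCurve L Mat) : SmoothCurve L Mat :=
  superpose (fun p : Mat × Mat => p.1 * p.2) (pairL (f, g))

theorem contDiff_mul_mat : ContDiff ℝ ∞ (fun p : Mat × Mat => p.1 * p.2) :=
  contDiff_fst.mul contDiff_snd

theorem mulC_apply (f g : SmoothCurve L Mat) {s : ℝ} (hs : s ∈ Icc 0 L) :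
    mulC f g s = f s * g s := by
  rw [mulC, superpose_apply' contDiff_mul_mat _ hs, pairL_apply _ hs]

/-- The pointwise adjugate of a matrix curve. -/
noncomputable def adjC (f : SmoothCurve L Mat) : SmoothCurve L Mat := superpose (fun M : Mat => M.adjugate) f

theorem adjC_apply (f : SmoothCurve L Mat) {s : ℝ} (hs : s ∈ Icc 0 L) :
    adjC f s = (f s).adjugate :=
  superpose_apply' contDiff_adjugate f hs

section CkOn

variable {E : Type} [AddCommGroup E] [Module ℝ E] [TopologicalSpace E] {n : ℕ} {U : Set E}
  {f g h : E → SmoothCurve L Mat}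

theorem ckOn_mulC (hf : CkOn n f U) (hg : CkOn n g U) : CkOn n (fun x => mulC (f x) (g x)) U :=
  CkOn.superpose₂ contDiff_mul_mat hf hg

theorem ckOn_adjC (hf : CkOn n f U) : CkOn n (fun x => adjC (f x)) U :=
  CkOn.superpose' contDiff_adjugate hf

end CkOn

/-- The curve `(∫ g₁ U adj(g₂)) g₂`. -/
noncomputable def vary (g₁ U g₂ : SmoothCurve L Mat) : SmoothCurve L Mat :=
  mulC (primL (mulC (mulC g₁ U) (adjC g₂))) g₂

theorem ckOn_vary {E : Type} [AddCommGroup E] [Module ℝ E] [TopologicalSpace E] {n : ℕ}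
    {U : Set E} {f g h : E → SmoothCurve L Mat} (hf : CkOn n f U) (hg : CkOn n g U)
    (hh : CkOn n h U) : CkOn n (fun x => vary (f x) (g x) (h x)) U :=
  ckOn_mulC ((ckOn_mulC (ckOn_mulC hf hg) (ckOn_adjC hh)).clm_comp primL) hh

theorem continuous_vary :
    Continuous fun p : SmoothCurve L Mat × SmoothCurve L Mat × SmoothCurve L Mat =>
      vary p.1 p.2.1 p.2.2 := by
  have h := ckOn_vary (n := 0) (U := univ)
    (f := fun p : SmoothCurve L Mat × SmoothCurve L Mat × SmoothCurve L Mat => p.1)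
    (g := fun p => p.2.1) (h := fun p => p.2.2) continuous_fst.continuousOn
    (continuous_fst.comp continuous_snd).continuousOn
    (continuous_snd.comp continuous_snd).continuousOn
  exact continuousOn_univ.1 h

theorem vary_smul (c : ℝ) (g₁ U g₂ : SmoothCurve L Mat) :
    vary g₁ (c • U) g₂ = c • vary g₁ U g₂ := by
  have h1 : mulC (mulC g₁ (c • U)) (adjC g₂) = c • mulC (mulC g₁ U) (adjC g₂) := by
    refine ext_on fun s hs => ?_
    rw [smul_eval, mulC_apply _ _ hs, mulC_apply _ _ hs, mulC_apply _ _ hs, mulC_apply _ _ hs,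
      smul_eval, mul_smul_comm, smul_mul_assoc]
  refine ext_on fun s hs => ?_
  rw [vary, vary, h1, map_smul, smul_eval, mulC_apply _ _ hs, mulC_apply _ _ hs, smul_eval,
    smul_mul_assoc]

theorem derivL_mulC (f g : SmoothCurve L Mat) {s : ℝ} (hs : s ∈ Icc 0 L) :
    derivL (mulC f g) s = derivL f s * g s + f s * derivL g s :=
  derivL_eq hs <| ((f.hasDerivWithinAt hs).mul (g.hasDerivWithinAt hs)).congr
    (fun _ hx => mulC_apply f g hx) (mulC_apply f g hs)

theorem derivL_adjC (f : SmoothCurve L Mat) {s : ℝ} (hs : s ∈ Icc 0 L) :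
    derivL (adjC f) s = (derivL f s).adjugate :=
  (derivL_superpose isOpen_univ contDiff_adjugate.contDiffOn (fun _ _ => mem_univ _) hs).trans
    (fderiv_of_linear adjL _ _)

/-- The adjugate is linear on 2 × 2 matrices, reverses products and is negation on traceless ones.
Hence adj(g₂)' = -Λ₂ adj(g₂), the equation that an inverse of `g₂` satisfies, without any inverse
being taken. -/
theorem derivL_mul_adjugate {g₁ g₂ : SmoothCurve L Mat} {Λ₁ Λ₂ : Mat} {s : ℝ}
    (hs : s ∈ Icc 0 L) (h₁ : derivL g₁ s = g₁ s * Λ₁) (h₂ : derivL g₂ s = g₂ s * Λ₂)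
    (ht : Λ₂.trace = 0) :
    derivL (mulC g₁ (adjC g₂)) s = g₁ s * (Λ₁ - Λ₂) * (g₂ s).adjugate := by
  rw [derivL_mulC _ _ hs, derivL_adjC _ hs, adjC_apply _ hs, h₁, h₂, Matrix.adjugate_mul_distrib,
    adjugate_of_trace_eq_zero ht]
  noncomm_ring

/-- By `derivL_mul_adjugate` for two equal curves, the product is constant. This gives invertibility
and determinant one together. -/
theorem mul_adjugate_eq_one {g : SmoothCurve L Mat} {Λ : ℝ → Mat} (h0 : g 0 = 1)
    (h : ∀ s ∈ Icc 0 L, derivL g s = g s * Λ s) (ht : ∀ s ∈ Icc 0 L, (Λ s).trace = 0) {s : ℝ}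
    (hs : s ∈ Icc 0 L) : g s * (g s).adjugate = 1 := by
  have := eval_eq_of_derivL_eq_zero (f := mulC g (adjC g)) (fun s hs => by
    rw [derivL_mul_adjugate hs (h s hs) (h s hs) (ht s hs), sub_self, mul_zero, zero_mul]) hs
  rwa [mulC_apply _ _ hs, mulC_apply _ _ (zero_mem L), adjC_apply _ hs, adjC_apply _ (zero_mem L),
    h0, Matrix.adjugate_one, one_mul] at this

theorem det_eq_one_of_mul_adjugate {M : Mat} (h : M * M.adjugate = 1) : M.det = 1 := by
  rw [Matrix.mul_adjugate] at h
  have := congr_fun (congr_fun h 0) 0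
  simpa using this

/-- Duhamel's formula: the derivative of g₁ adj(g₂) is g₁ (Λ₁ - Λ₂) adj(g₂); integrate and multiply
by g₂ on the right. Only the second coefficient has to be traceless. -/
theorem sub_eq_vary {g₁ g₂ Λ₁ Λ₂ : SmoothCurve L Mat} (h₁0 : g₁ 0 = 1) (h₂0 : g₂ 0 = 1)
    (h₁ : ∀ s ∈ Icc 0 L, derivL g₁ s = g₁ s * Λ₁ s)
    (h₂ : ∀ s ∈ Icc 0 L, derivL g₂ s = g₂ s * Λ₂ s) (ht : ∀ s ∈ Icc 0 L, (Λ₂ s).trace = 0) :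
    g₁ - g₂ = vary g₁ (Λ₁ - Λ₂) g₂ := by
  have key : mulC g₁ (adjC g₂) - mulC g₂ (adjC g₂)
      = primL (mulC (mulC g₁ (Λ₁ - Λ₂)) (adjC g₂)) := by
    refine eq_of_derivL_eq ?_ ?_
    · rw [derivL_primL]
      refine ext_on fun s hs => ?_
      rw [map_sub, sub_eval, derivL_mul_adjugate hs (h₁ s hs) (h₂ s hs) (ht s hs),
        derivL_mul_adjugate hs (h₂ s hs) (h₂ s hs) (ht s hs), mulC_apply _ _ hs,
        mulC_apply _ _ hs, adjC_apply _ hs, sub_eval, sub_self, mul_zero, zero_mul, sub_zero]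
    · rw [primL_zero, sub_eval, mulC_apply _ _ (zero_mem L), mulC_apply _ _ (zero_mem L), h₁0,
        h₂0, sub_self]
  refine ext_on fun s hs => ?_
  have h1 := mul_adjugate_eq_one h₂0 h₂ ht hs
  have h2 : (g₂ s).adjugate * g₂ s = 1 := by
    rw [Matrix.adjugate_mul, ← Matrix.mul_adjugate, h1]
  rw [vary, ← key, mulC_apply _ _ hs, sub_eval, sub_eval, mulC_apply _ _ hs, mulC_apply _ _ hs,
    adjC_apply _ hs, h1, sub_mul, mul_assoc, h2, mul_one, one_mul]

theorem sol_sub {Λ₁ Λ₂ : SmoothCurve L Mat} (ht : ∀ s ∈ Icc 0 L, (Λ₂ s).trace = 0) :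
    sol Λ₁ - sol Λ₂ = vary (sol Λ₁) (Λ₁ - Λ₂) (sol Λ₂) :=
  sub_eq_vary (sol_zero _) (sol_zero _) (fun _ hs => derivL_sol _ hs)
    (fun _ hs => derivL_sol _ hs) ht

theorem det_sol {Λ : SmoothCurve L Mat} (ht : ∀ s ∈ Icc 0 L, (Λ s).trace = 0) {s : ℝ}
    (hs : s ∈ Icc 0 L) : (sol Λ s).det = 1 :=
  det_eq_one_of_mul_adjugate
    (mul_adjugate_eq_one (sol_zero Λ) (fun _ hs => derivL_sol Λ hs) ht hs)

/-- Uniqueness is Duhamel's formula with equal coefficients: the right-hand side vanishes. -/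
theorem eq_sol {g Λ : SmoothCurve L Mat} (h0 : g 0 = 1)
    (h : ∀ s ∈ Icc 0 L, derivL g s = g s * Λ s) (ht : ∀ s ∈ Icc 0 L, (Λ s).trace = 0) :
    g = sol Λ := by
  have h1 := sub_eq_vary h0 (sol_zero Λ) h (fun _ hs => derivL_sol Λ hs) ht
  have h2 := vary_smul 0 g 0 (sol Λ)
  rwa [sub_self, ← zero_smul ℝ (0 : SmoothCurve L Mat), h2, zero_smul, sub_eq_zero] at h1

theorem norm_vary_le {g₁ U g₂ : SmoothCurve L Mat} {a b c d : ℝ} (ha : ∀ s ∈ Icc 0 L, ‖g₁ s‖ ≤ a)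
    (hb : ∀ s ∈ Icc 0 L, ‖U s‖ ≤ b) (hc : ∀ s ∈ Icc 0 L, ‖(g₂ s).adjugate‖ ≤ c)
    (hd : ∀ s ∈ Icc 0 L, ‖g₂ s‖ ≤ d) {s : ℝ} (hs : s ∈ Icc 0 L) :
    ‖vary g₁ U g₂ s‖ ≤ a * b * c * L * d := by
  have ha0 := (norm_nonneg _).trans (ha s hs)
  have hb0 := (norm_nonneg _).trans (hb s hs)
  have hc0 := (norm_nonneg _).trans (hc s hs)
  have hd0 := (norm_nonneg _).trans (hd s hs)
  rw [vary, mulC_apply _ _ hs, primL_apply _ hs]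
  refine (norm_mul_le _ _).trans (mul_le_mul ?_ (hd s hs) (norm_nonneg _)
    (mul_nonneg (by positivity) hL.out.le))
  refine (intervalIntegral.norm_integral_le_of_norm_le_const (C := a * b * c)
    fun x hx => ?_).trans ?_
  · have hx' : x ∈ Icc 0 L := by
      have := uIoc_subset_uIcc hx
      rw [uIcc_of_le hs.1] at this
      exact ⟨this.1, this.2.trans hs.2⟩
    rw [mulC_apply _ _ hx', mulC_apply _ _ hx', adjC_apply _ hx']
    refine (norm_mul_le _ _).trans (mul_le_mul ((norm_mul_le _ _).trans
      (mul_le_mul (ha x hx') (hb x hx') (norm_nonneg _) ha0)) (hc x hx') (norm_nonneg _)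
      (by positivity))
  · rw [sub_zero, abs_of_nonneg hs.1]
    exact mul_le_mul_of_nonneg_left hs.2 (by positivity)

/-- Uniform convergence comes from Duhamel's formula, evaluated where the difference of the
solutions is largest; there it bounds the maximum by itself with a small factor, so Grönwall's
inequality is not needed. The equation g' = gΛ then lifts the convergence to all derivatives. -/
theorem tendsto_sol {ι : Type*} {l : Filter ι} {F : ι → SmoothCurve L Mat}
    {Λ : SmoothCurve L Mat} (ht : ∀ s ∈ Icc 0 L, (Λ s).trace = 0) (hF : Tendsto F l (𝓝 Λ)) :
    Tendsto (fun i => sol (F i)) l (𝓝 (sol Λ)) := by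
  have hLpos := hL.out
  have huni : TendstoUniformlyOn (fun i => sol (F i)) (sol Λ) l (Icc 0 L) := by
    obtain ⟨M₁, hM₁⟩ := isCompact_Icc.exists_bound_of_continuousOn (sol Λ).continuousOn
    obtain ⟨M₂, hM₂⟩ := isCompact_Icc.exists_bound_of_continuousOn (adjC (sol Λ)).continuousOn
    set M := max 1 (max M₁ M₂) with hM
    have hMpos : 0 < M := lt_of_lt_of_le one_pos (le_max_left _ _)
    have hd : ∀ s ∈ Icc 0 L, ‖sol Λ s‖ ≤ M := fun s hs =>
      (hM₁ s hs).trans ((le_max_left _ _).trans (le_max_right _ _))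
    have hc : ∀ s ∈ Icc 0 L, ‖(sol Λ s).adjugate‖ ≤ M := fun s hs => by
      rw [← adjC_apply _ hs]
      exact (hM₂ s hs).trans ((le_max_right _ _).trans (le_max_right _ _))
    refine tendstoUniformlyOn_iff.2 fun ε hε => ?_
    set η := min (1 / 2) (ε / (4 * M)) with hη
    have hηpos : 0 < η := by positivity
    have h0 := tendstoUniformlyOn_iff.1 (tendsto_iff.1 hF 0).tendstoUniformlyOn
    -- The tolerance cancels the factors in `norm_vary_le`, leaving e ≤ (M + e)η for the maximal
    -- difference e. With η ≤ 1/2 and Mη ≤ ε/4 this gives e ≤ ε/2.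
    filter_upwards [h0 (η / (L * M ^ 2)) (by positivity)] with i hi
    obtain ⟨s₀, hs₀, hmax⟩ := isCompact_Icc.exists_isMaxOn ⟨0, zero_mem L⟩
      ((sol (F i) - sol Λ).continuousOn.norm)
    set e := ‖(sol (F i) - sol Λ) s₀‖ with he
    have hle : ∀ s ∈ Icc 0 L, ‖sol (F i) s - sol Λ s‖ ≤ e := fun s hs => hmax hs
    have ha : ∀ s ∈ Icc 0 L, ‖sol (F i) s‖ ≤ M + e := fun s hs => by
      have := norm_add_le (sol Λ s) (sol (F i) s - sol Λ s)
      rw [add_sub_cancel] at this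
      linarith [hd s hs, hle s hs]
    have hb : ∀ s ∈ Icc 0 L, ‖(F i - Λ) s‖ ≤ η / (L * M ^ 2) := fun s hs => (hi s hs).le
    have h1 : e ≤ (M + e) * (η / (L * M ^ 2)) * M * L * M := by
      have := norm_vary_le ha hb hc hd hs₀
      rwa [← sol_sub ht] at this
    have h2 : (M + e) * (η / (L * M ^ 2)) * M * L * M = (M + e) * η := by
      field_simp
    have he0 : 0 ≤ e := norm_nonneg _
    have h3 : e * η ≤ e * (1 / 2) := mul_le_mul_of_nonneg_left (min_le_left _ _) he0
    have h4 : M * η ≤ M * (ε / (4 * M)) := mul_le_mul_of_nonneg_left (min_le_right _ _) hMpos.le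
    have h5 : M * (ε / (4 * M)) = ε / 4 := by field_simp
    intro s hs
    exact (hle s hs).trans_lt (by nlinarith)
  refine tendsto_iff.2 fun n => ?_
  induction n with
  | zero => exact huni
  | succ n ih =>
    refine ⟨huni, ?_⟩
    refine ((ih.prodMk (uniqueDiffOn L) (tendsto_iff.1 hF n) (fun i => (sol (F i)).contDiffOn)
      (sol Λ).contDiffOn (fun i => (F i).contDiffOn) Λ.contDiffOn).superpose (uniqueDiffOn L)
      isCompact_Icc isOpen_univ contDiff_mul_mat.contDiffOn (fun i => contDiffOn_pair _ _)
      (contDiffOn_pair _ _) fun _ _ => mem_univ _).congr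
      (Eventually.of_forall fun i s hs => ?_) fun s hs => ?_
    · exact (derivL_sol (F i) hs).symm.trans (derivL_apply _ hs)
    · exact (derivL_sol Λ hs).symm.trans (derivL_apply _ hs)

/-! ### Smooth dependence of the solution on its coefficient -/

section Smooth

set_option linter.unusedSectionVars false

variable {E : Type} [AddCommGroup E] [Module ℝ E] [TopologicalSpace E]

/-- By Duhamel's formula the difference quotient of the solutions is exactly `vary` applied to the
difference quotient of the coefficients; continuity of `vary` and `tendsto_sol` give the limit. -/
theorem hasDirDeriv_sol {Λ : E → SmoothCurve L Mat} {x h : E} {U : SmoothCurve L Mat}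
    (ht : ∀ s ∈ Icc 0 L, (Λ x s).trace = 0) (hΛ : HasDirDeriv Λ x h U) :
    HasDirDeriv (fun y => sol (Λ y)) x h (vary (sol (Λ x)) U (sol (Λ x))) := by
  have h1 : Tendsto (fun t : ℝ => Λ (x + t • h)) (𝓝[≠] 0) (𝓝 (Λ x)) := by
    have h2 : Tendsto (fun t : ℝ => t) (𝓝[≠] 0) (𝓝 0) := nhdsWithin_le_nhds
    have h3 := (tendsto_const_nhds (x := Λ x)).add (h2.smul hΛ)
    rw [zero_smul, add_zero] at h3
    refine h3.congr' ?_
    filter_upwards [self_mem_nhdsWithin] with t ht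
    rw [smul_inv_smul₀ (by simpa using ht), add_sub_cancel]
  have h2 := (tendsto_sol ht h1).prodMk_nhds (Tendsto.prodMk_nhds hΛ
    (tendsto_const_nhds (x := sol (Λ x))))
  refine ((continuous_vary.tendsto _).comp h2).congr fun t => ?_
  simp only [Function.comp_apply]
  rw [vary_smul, sol_sub ht]

/-- The derivative is expressed by the solution itself, the derivative of the coefficient and smooth
operations, so smoothness follows by induction on the order. -/
theorem ckOn_sol {n : ℕ} {Λ : E → SmoothCurve L Mat} {U : Set E}
    (ht : ∀ x ∈ U, ∀ s ∈ Icc 0 L, (Λ x s).trace = 0) (hΛ : CkOn n Λ U) :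
    CkOn n (fun x => sol (Λ x)) U := by
  induction n with
  | zero => exact fun x hx => tendsto_sol (ht x hx) (hΛ x hx)
  | succ n ih =>
    have hn := ih hΛ.of_succ
    obtain ⟨h0, Λ', h1, h2⟩ := hΛ
    refine ⟨fun x hx => tendsto_sol (ht x hx) (h0 x hx),
      fun p => vary (sol (Λ p.1)) (Λ' p) (sol (Λ p.1)),
      fun x hx h => hasDirDeriv_sol (ht x hx) (h1 x hx h), ?_⟩
    have h3 : CkOn n (fun p : E × E => sol (Λ p.1)) (U ×ˢ (univ : Set E)) :=
      hn.comp_clm (ContinuousLinearMap.fst ℝ E E) fun p hp => hp.1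
    exact ckOn_vary h3 h2 h3

end Smooth

end Darboux

/-! ## Affine coordinates on the sphere -/

namespace Darboux

open FrechetCalculus SmoothCurve
open scoped ComplexConjugate

/-- The traceless Hermitian matrix that corresponds to the projection onto the line spanned by
`(x, y)`. -/
noncomputable def lineProj (x y : ℂ) : Mat :=
  !![x * conj x / (x * conj x + y * conj y) - 1 / 2, x * conj y / (x * conj x + y * conj y);
    y * conj x / (x * conj x + y * conj y), y * conj y / (x * conj x + y * conj y) - 1 / 2]

theorem lineProj_mul {c : ℂ} (hc : c ≠ 0) (x y : ℂ) : lineProj (c * x) (c * y) = lineProj x y := by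
  have hc' : c * conj c ≠ 0 := mul_ne_zero hc (by simpa using hc)
  have h : ∀ p r, c * p * conj (c * r) / (c * x * conj (c * x) + c * y * conj (c * y))
      = p * conj r / (x * conj x + y * conj y) := fun p r => by
    rw [← mul_div_mul_left (p * conj r) _ hc']
    simp only [map_mul]
    ring_nf
  simp only [lineProj, h]

/-- The special unitary matrix with first column `(x, y)`. -/
noncomputable def frame (x y : ℂ) : Mat := !![x, -conj y; y, conj x]

theorem frame_mem {x y : ℂ} (h : x * conj x + y * conj y = 1) :
    frame x y ∈ Matrix.specialUnitaryGroup (Fin 2) ℂ := by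
  rw [Matrix.mem_specialUnitaryGroup_iff, Matrix.mem_unitaryGroup_iff]
  constructor
  · ext i j
    fin_cases i <;> fin_cases j <;>
      simp [frame, Matrix.mul_apply, Fin.sum_univ_two, Matrix.star_eq_conjTranspose] <;>
      first | linear_combination h | ring
  · simp only [frame, Matrix.det_fin_two_of]
    linear_combination h

theorem frame_conj {x y : ℂ} (h : x * conj x + y * conj y = 1) :
    frame x y * B₁ * (frame x y)ᴴ = lineProj x y := by
  ext i j
  fin_cases i <;> fin_cases j <;>
    simp [frame, B₁, lineProj, Matrix.mul_apply, Fin.sum_univ_two, h] <;>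
    first | linear_combination (1 / 2) * h | linear_combination (-1 / 2) * h | ring

/-- For a unitary matrix of determinant one the conjugate transpose equals the adjugate, and
comparing entries expresses the second column by the first. -/
theorem exists_frame {R : Mat} (hR : R ∈ Matrix.specialUnitaryGroup (Fin 2) ℂ) :
    ∃ x y, x * conj x + y * conj y = 1 ∧ R = frame x y := by
  rw [Matrix.mem_specialUnitaryGroup_iff, Matrix.mem_unitaryGroup_iff'] at hR
  obtain ⟨h1, h2⟩ := hR
  have h3 : star R = R.adjugate := by
    have : R * R.adjugate = 1 := by rw [Matrix.mul_adjugate, h2, one_smul]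
    calc star R = star R * (R * R.adjugate) := by rw [this, mul_one]
      _ = R.adjugate := by rw [← mul_assoc, h1, one_mul]
  have h00 := congr_fun (congr_fun h3 0) 0
  have h01 := congr_fun (congr_fun h3 0) 1
  have hn := congr_fun (congr_fun h1 0) 0
  simp only [Matrix.star_eq_conjTranspose, Matrix.conjTranspose_apply, Matrix.adjugate_fin_two,
    Matrix.of_apply, Matrix.cons_val', Matrix.cons_val_zero, Matrix.cons_val_one,
    Matrix.cons_val_fin_one, Matrix.mul_apply, Fin.sum_univ_two, Matrix.one_apply_eq,
    Complex.star_def] at h00 h01 hn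
  refine ⟨R 0 0, R 1 0, by linear_combination hn, ?_⟩
  ext i j
  fin_cases i <;> fin_cases j
  · rfl
  · simpa [frame] using (neg_eq_iff_eq_neg.1 h01.symm)
  · rfl
  · simpa [frame] using h00.symm

/-- The numerator of the affine coordinate. -/
noncomputable def coordNum (a : ℂ) (M : Mat) : ℂ := M 1 0 - conj a * (M 1 1 + 1 / 2)

/-- The denominator of the affine coordinate. -/
noncomputable def coordDen (a : ℂ) (M : Mat) : ℂ :=
  M 0 0 + 1 / 2 - a * M 1 0 - conj a * M 0 1 + a * conj a * (M 1 1 + 1 / 2)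

/-- The affine coordinate `z` of the line spanned by `(1 + z a, z)`. -/
noncomputable def coord (a : ℂ) (M : Mat) : ℂ := coordNum a M / coordDen a M

/-- The point of the sphere with affine coordinate `z`. -/
noncomputable def param (a z : ℂ) : Mat := lineProj (1 + z * a) z

/-- Together with `coordDen_lineProj` this shows that the coordinate is y / (x - a y), hence
undefined exactly at the line spanned by (a, 1). Both formulas are affine in the matrix entries, so
the coordinate is a smooth function on an open set of matrices and needs no choice of (x, y). -/
theorem coordNum_lineProj (a x y : ℂ) :
    coordNum a (lineProj x y) = y * conj (x - a * y) / (x * conj x + y * conj y) := by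
  simp [coordNum, lineProj]
  field_simp

theorem coordDen_lineProj (a : ℂ) {x y : ℂ} (h : x * conj x + y * conj y ≠ 0) :
    coordDen a (lineProj x y)
      = (x - a * y) * conj (x - a * y) / (x * conj x + y * conj y) := by
  simp [coordDen, lineProj]
  field_simp
  ring

theorem normSq_add_ne_zero (a z : ℂ) :
    (1 + z * a) * conj (1 + z * a) + z * conj z ≠ 0 := by
  rw [Complex.mul_conj, Complex.mul_conj, ← Complex.ofReal_add, Complex.ofReal_ne_zero]
  intro h
  have h1 := Complex.normSq_nonneg (1 + z * a)
  have h2 := Complex.normSq_nonneg z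
  have hz : z = 0 := Complex.normSq_eq_zero.1 (by linarith)
  subst hz
  simp at h

theorem coordDen_param (a z : ℂ) : coordDen a (param a z) ≠ 0 := by
  rw [param, coordDen_lineProj a (normSq_add_ne_zero a z)]
  refine div_ne_zero ?_ (normSq_add_ne_zero a z)
  have : 1 + z * a - a * z = 1 := by ring
  rw [this]
  simp

theorem coord_param (a z : ℂ) : coord a (param a z) = z := by
  rw [coord, param, coordNum_lineProj,
    coordDen_lineProj a (normSq_add_ne_zero a z), div_div_div_cancel_right₀ (normSq_add_ne_zero a z)]
  have : 1 + z * a - a * z = 1 := by ring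
  rw [this]
  simp

/-- Dividing (x, y) by x - a y brings it to the form (1 + z a, z) and does not change the line. -/
theorem param_coord {a x y : ℂ} (h : x * conj x + y * conj y = 1)
    (hd : coordDen a (lineProj x y) ≠ 0) :
    param a (coord a (lineProj x y)) = lineProj x y := by
  have h1 : x * conj x + y * conj y ≠ 0 := by rw [h]; exact one_ne_zero
  rw [coordDen_lineProj a h1, h, div_one] at hd
  have hc : conj (x - a * y) ≠ 0 := right_ne_zero_of_mul hd
  have hx : x - a * y ≠ 0 := left_ne_zero_of_mul hd
  have h2 : coord a (lineProj x y) = (x - a * y)⁻¹ * y := by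
    rw [coord, coordNum_lineProj, coordDen_lineProj a h1, h, div_one, div_one,
      mul_div_mul_right _ _ hc]
    field_simp
  have h3 : 1 + (x - a * y)⁻¹ * y * a = (x - a * y)⁻¹ * x := by
    field_simp
    ring
  rw [h2, param, h3, lineProj_mul (inv_ne_zero hx)]

theorem trace_lineProj {x y : ℂ} (h : x * conj x + y * conj y ≠ 0) :
    (lineProj x y).trace = 0 := by
  simp [lineProj, Matrix.trace_fin_two]
  field_simp
  ring

theorem trace_param (a z : ℂ) : (param a z).trace = 0 := trace_lineProj (normSq_add_ne_zero a z)

/-- The base point has coordinate 0 in every chart, which makes the anchoring a linear condition on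
z. -/
theorem param_zero (a : ℂ) : param a 0 = B₁ := by
  ext i j
  fin_cases i <;> fin_cases j <;> simp [param, lineProj, B₁]
  norm_num

theorem coord_B₁ (a : ℂ) : coord a B₁ = 0 := by
  rw [← param_zero a, coord_param]

theorem contDiff_conj : ContDiff ℝ ∞ (fun z : ℂ => conj z) := Complex.conjCLE.contDiff

theorem contDiff_of_entries {X : Type} [NormedAddCommGroup X] [NormedSpace ℝ X] {f₁ f₂ f₃ f₄ : X → ℂ}
    (h₁ : ContDiff ℝ ∞ f₁) (h₂ : ContDiff ℝ ∞ f₂) (h₃ : ContDiff ℝ ∞ f₃) (h₄ : ContDiff ℝ ∞ f₄) :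
    ContDiff ℝ ∞ (fun x => (!![f₁ x, f₂ x; f₃ x, f₄ x] : Mat)) := by
  let A : (ℂ × ℂ × ℂ × ℂ) →ₗ[ℝ] Mat :=
    { toFun := fun p => !![p.1, p.2.1; p.2.2.1, p.2.2.2]
      map_add' := fun p q => by
        ext i j
        fin_cases i <;> fin_cases j <;> simp
      map_smul' := fun c p => by
        ext i j
        fin_cases i <;> fin_cases j <;> simp }
  exact (contDiff_of_linear A).comp (h₁.prodMk (h₂.prodMk (h₃.prodMk h₄)))

theorem contDiff_entry (i j : Fin 2) : ContDiff ℝ ∞ (fun M : Mat => M i j) :=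
  contDiff_of_linear (⟨⟨fun M => M i j, fun _ _ => rfl⟩, fun _ _ => rfl⟩ : Mat →ₗ[ℝ] ℂ)

theorem contDiff_param (a : ℂ) : ContDiff ℝ ∞ (param a) := by
  have h1 : ContDiff ℝ ∞ (fun z : ℂ => 1 + z * a) := by fun_prop
  have h2 : ContDiff ℝ ∞ (fun z : ℂ => conj (1 + z * a)) := contDiff_conj.comp h1
  have h3 := contDiff_conj
  have h4 : ContDiff ℝ ∞ (fun z : ℂ => z) := contDiff_id
  have hq : ContDiff ℝ ∞ (fun z : ℂ => (1 + z * a) * conj (1 + z * a) + z * conj z) :=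
    (h1.mul h2).add (h4.mul h3)
  have hi := hq.inv (normSq_add_ne_zero a)
  unfold param lineProj
  simp only [div_eq_mul_inv]
  exact contDiff_of_entries (((h1.mul h2).mul hi).sub contDiff_const) ((h1.mul h3).mul hi)
    ((h4.mul h2).mul hi) (((h4.mul h3).mul hi).sub contDiff_const)

theorem contDiff_coordDen (a : ℂ) : ContDiff ℝ ∞ (coordDen a) := by
  have h := contDiff_entry
  exact ((((h 0 0).add contDiff_const).sub (contDiff_const.mul (h 1 0))).sub
    (contDiff_const.mul (h 0 1))).add (contDiff_const.mul ((h 1 1).add contDiff_const))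

theorem contDiffOn_coord (a : ℂ) : ContDiffOn ℝ ∞ (coord a) {M | coordDen a M ≠ 0} := by
  have h := contDiff_entry
  have hnum : ContDiff ℝ ∞ (coordNum a) :=
    (h 1 0).sub (contDiff_const.mul ((h 1 1).add contDiff_const))
  exact hnum.contDiffOn.mul ((contDiff_coordDen a).contDiffOn.inv fun _ hM => hM)

/-- The squared length of `(1 + z a, z)`. -/
noncomputable def lenSq (a z : ℂ) : ℝ := Complex.normSq (1 + z * a) + Complex.normSq z

theorem ofReal_lenSq (a z : ℂ) :
    (lenSq a z : ℂ) = (1 + z * a) * conj (1 + z * a) + z * conj z := by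
  rw [Complex.mul_conj, Complex.mul_conj, lenSq, Complex.ofReal_add]

theorem lenSq_pos (a z : ℂ) : 0 < lenSq a z := by
  have h := normSq_add_ne_zero a z
  rw [← ofReal_lenSq, Complex.ofReal_ne_zero] at h
  exact lt_of_le_of_ne (add_nonneg (Complex.normSq_nonneg _) (Complex.normSq_nonneg _)) h.symm

theorem contDiff_normSq : ContDiff ℝ ∞ Complex.normSq := by
  have : (Complex.normSq : ℂ → ℝ) = fun z => z.re * z.re + z.im * z.im := by
    ext z
    exact Complex.normSq_apply z
  rw [this]
  have h1 : ContDiff ℝ ∞ (fun z : ℂ => z.re) := Complex.reCLM.contDiff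
  have h2 : ContDiff ℝ ∞ (fun z : ℂ => z.im) := Complex.imCLM.contDiff
  exact (h1.mul h1).add (h2.mul h2)

theorem contDiff_lenSq (a : ℂ) : ContDiff ℝ ∞ (lenSq a) :=
  (contDiff_normSq.comp (by fun_prop : ContDiff ℝ ∞ (fun z : ℂ => 1 + z * a))).add contDiff_normSq

/-- A lift of `param` to the special unitary group. -/
noncomputable def paramFrame (a z : ℂ) : Mat :=
  frame (((√(lenSq a z))⁻¹ : ℝ) * (1 + z * a)) (((√(lenSq a z))⁻¹ : ℝ) * z)

theorem contDiff_paramFrame (a : ℂ) : ContDiff ℝ ∞ (paramFrame a) := by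
  have h0 : ContDiff ℝ ∞ (fun z : ℂ => (((√(lenSq a z))⁻¹ : ℝ) : ℂ)) :=
    Complex.ofRealCLM.contDiff.comp
      (((contDiff_lenSq a).sqrt fun z => (lenSq_pos a z).ne').inv fun z =>
        (Real.sqrt_pos.2 (lenSq_pos a z)).ne')
  have h1 : ContDiff ℝ ∞ (fun z : ℂ => 1 + z * a) := by fun_prop
  have h2 := h0.mul h1
  have h3 := h0.mul (contDiff_id (𝕜 := ℝ) (E := ℂ))
  exact contDiff_of_entries h2 (contDiff_conj.comp h3).neg h3 (contDiff_conj.comp h2)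

theorem paramFrame_norm (a z : ℂ) :
    (((√(lenSq a z))⁻¹ : ℝ) * (1 + z * a)) * conj (((√(lenSq a z))⁻¹ : ℝ) * (1 + z * a))
      + (((√(lenSq a z))⁻¹ : ℝ) * z) * conj (((√(lenSq a z))⁻¹ : ℝ) * z) = 1 := by
  have h1 : (((√(lenSq a z))⁻¹ : ℝ) : ℂ) * (((√(lenSq a z))⁻¹ : ℝ) : ℂ) * (lenSq a z : ℂ) = 1 := by
    rw [← Complex.ofReal_mul, ← Complex.ofReal_mul, ← mul_inv,
      Real.mul_self_sqrt (lenSq_pos a z).le, inv_mul_cancel₀ (lenSq_pos a z).ne',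
      Complex.ofReal_one]
  rw [ofReal_lenSq] at h1
  rw [map_mul, map_mul, Complex.conj_ofReal]
  linear_combination h1

theorem paramFrame_mem (a z : ℂ) : paramFrame a z ∈ Matrix.specialUnitaryGroup (Fin 2) ℂ :=
  frame_mem (paramFrame_norm a z)

theorem paramFrame_conj (a z : ℂ) :
    paramFrame a z * B₁ * (paramFrame a z)ᴴ = param a z := by
  rw [paramFrame, frame_conj (paramFrame_norm a z), lineProj_mul, param]
  rw [Complex.ofReal_ne_zero]
  exact inv_ne_zero (Real.sqrt_pos.2 (lenSq_pos a z)).ne'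

theorem paramFrame_zero (a : ℂ) : paramFrame a 0 = 1 := by
  ext i j
  fin_cases i <;> fin_cases j <;> simp [paramFrame, frame, lenSq]

/-- The derivative of `param a` at `z` in the direction `u`. -/
noncomputable def paramDeriv (a z u : ℂ) : Mat :=
  ((lenSq a z : ℂ)⁻¹ * (lenSq a z : ℂ)⁻¹) •
    !![-(u * conj z * conj (1 + z * a)) - conj u * (1 + z * a) * z,
      conj u * (1 + z * a) * (1 + z * a) - u * conj z * conj z;
      u * conj (1 + z * a) * conj (1 + z * a) - conj u * z * z,
      u * conj (1 + z * a) * conj z + conj u * z * (1 + z * a)]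

theorem hasDerivAt_conj_line (b c : ℂ) : HasDerivAt (fun t : ℝ => conj (b + t * c)) (conj c) 0 := by
  have h : HasDerivAt (fun t : ℝ => b + t * c) c 0 := by
    simpa using ((Complex.ofRealCLM.hasDerivAt (x := 0)).mul_const c).const_add b
  exact Complex.conjCLE.hasFDerivAt.comp_hasDerivAt 0 h

theorem fderiv_param (a z u : ℂ) : fderiv ℝ (param a) z u = paramDeriv a z u := by
  have hP : HasFDerivAt (param a) (fderiv ℝ (param a) z) z :=
    ((contDiff_param a).differentiable (by simp) z).hasFDerivAt
  have hline : ∀ b c : ℂ, HasDerivAt (fun t : ℝ => b + t * c) c 0 := fun b c => by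
    simpa using ((Complex.ofRealCLM.hasDerivAt (x := 0)).mul_const c).const_add b
  have hz := hline z u
  have hz' := hasDerivAt_conj_line z u
  have hw := hline (1 + z * a) (u * a)
  have hw' := hasDerivAt_conj_line (1 + z * a) (u * a)
  -- Conjugates make the parametrisation non-holomorphic, so its real derivative is computed
  -- entrywise along the line z + t u with real t.
  have hwe : ∀ t : ℝ, 1 + (z + t * u) * a = 1 + z * a + t * (u * a) := fun t => by ring
  have hq0 := normSq_add_ne_zero a z
  have hq : HasDerivAt (fun t : ℝ => (1 + z * a + t * (u * a)) * conj (1 + z * a + t * (u * a))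
      + (z + t * u) * conj (z + t * u)) _ 0 := (hw.mul hw').add (hz.mul hz')
  have hentry : ∀ i j : Fin 2, HasDerivAt (fun t : ℝ => param a (z + t * u) i j)
      (fderiv ℝ (param a) z u i j) 0 := by
    intro i j
    have h1 : HasFDerivAt (fun M : Mat => M i j) (fderiv ℝ (fun M : Mat => M i j) (param a z))
        (param a z) := ((contDiff_entry i j).differentiable (by simp) _).hasFDerivAt
    have hz0 : z + ((0 : ℝ) : ℂ) * u = z := by simp
    have h2 := (hz0.symm ▸ hP : HasFDerivAt (param a) (fderiv ℝ (param a) z)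
      (z + ((0 : ℝ) : ℂ) * u)).comp_hasDerivAt (0 : ℝ) hz
    have h3 : HasFDerivAt (fun M : Mat => M i j) (fderiv ℝ (fun M : Mat => M i j) (param a z))
        ((param a ∘ fun t : ℝ => z + t * u) 0) := by
      simpa using h1
    have h4 := h3.comp_hasDerivAt (0 : ℝ) h2
    exact h4.congr_deriv (fderiv_of_linear
      (⟨⟨fun M => M i j, fun _ _ => rfl⟩, fun _ _ => rfl⟩ : Mat →ₗ[ℝ] ℂ) _ _)
  have hqt : ∀ {N : ℝ → ℂ} {N' : ℂ}, HasDerivAt N N' 0 → HasDerivAt (fun t : ℝ => N t /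
      ((1 + z * a + t * (u * a)) * conj (1 + z * a + t * (u * a)) + (z + t * u) * conj (z + t * u)))
      _ 0 := fun hN => hN.div hq (by simpa using hq0)
  have hq0' : (1 + z * a) * (1 + conj z * conj a) + z * conj z ≠ 0 := by simpa using hq0
  ext i j
  rw [paramDeriv, ofReal_lenSq]
  refine (hentry i j).unique ?_
  fin_cases i <;> fin_cases j
  · have h := (hqt (hw.mul hw')).sub_const (1 / 2)
    refine (h.congr_of_eventuallyEq (Eventually.of_forall fun t => ?_)).congr_deriv ?_
    · simp [param, lineProj, hwe]
    · simp
      field_simp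
      ring
  · have h := hqt (hw.mul hz')
    refine (h.congr_of_eventuallyEq (Eventually.of_forall fun t => ?_)).congr_deriv ?_
    · simp [param, lineProj, hwe]
    · simp
      field_simp
      ring
  · have h := hqt (hz.mul hw')
    refine (h.congr_of_eventuallyEq (Eventually.of_forall fun t => ?_)).congr_deriv ?_
    · simp [param, lineProj, hwe]
    · simp
      field_simp
      ring
  · have h := (hqt (hz.mul hz')).sub_const (1 / 2)
    refine (h.congr_of_eventuallyEq (Eventually.of_forall fun t => ?_)).congr_deriv ?_
    · simp [param, lineProj, hwe]
    · simp
      field_simp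
      ring

/-- The coordinate expression of the area form. -/
noncomputable def areaForm (a : ℂ) (p : ℂ × ℂ × ℂ) : ℝ :=
  -4 * (conj p.2.1 * p.2.2).im * ((lenSq a p.1)⁻¹ * (lenSq a p.1)⁻¹)

theorem traceForm_bracket_paramDeriv (a z u v : ℂ) :
    traceForm (param a z) (bracket (paramDeriv a z u) (paramDeriv a z v))
      = Complex.I * areaForm a (z, u, v) := by
  have him : Complex.I * ((conj u * v).im : ℂ) = (conj u * v - u * conj v) / 2 := by
    rw [Complex.im_eq_sub_conj]
    simp
    field_simp
  have hA : Complex.I * areaForm a (z, u, v) = 2 * (u * conj v - conj u * v) *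
      ((lenSq a z : ℂ)⁻¹ * (lenSq a z : ℂ)⁻¹) := by
    simp only [areaForm]
    push_cast
    linear_combination (-4 * ((lenSq a z : ℂ)⁻¹ * (lenSq a z : ℂ)⁻¹)) * him
  rw [hA, ofReal_lenSq]
  have hi := inv_mul_cancel₀ (normSq_add_ne_zero a z)
  simp only [traceForm, bracket, param, lineProj, paramDeriv, ofReal_lenSq, div_eq_mul_inv]
  -- With the conjugates as independent variables, the identity becomes polynomial, modulo the
  -- relation that `i` inverts w w' + z z'.
  generalize ((1 + z * a) * conj (1 + z * a) + z * conj z)⁻¹ = i at *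
  generalize conj (1 + z * a) = w' at *
  generalize 1 + z * a = w at *
  generalize conj z = z' at *
  generalize conj u = u' at *
  generalize conj v = v' at *
  simp [Matrix.trace_fin_two]
  -- With q = i (w w' + z z') the trace is 2 (u v' - u' v) i² q³, and q³ - 1 = (q² + q + 1)(q - 1).
  linear_combination 2 * (u * v' - u' * v) * i ^ 2 *
    ((i * (w * w' + z * z')) ^ 2 + i * (w * w' + z * z') + 1) * hi

end Darboux

/-! ## Coordinates on the space of horizontal curves -/

namespace Darboux

open FrechetCalculus SmoothCurve
open scoped ComplexConjugate

variable {L : ℝ} [hL : Fact (0 < L)]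

/-- The curve `adj(g) dg/ds`. -/
noncomputable def lamC (g : SmoothCurve L Mat) : SmoothCurve L Mat := mulC (adjC g) (derivL g)

theorem lamC_apply (g : SmoothCurve L Mat) {s : ℝ} (hs : s ∈ Icc 0 L) :
    lamC g s = (g s).adjugate * derivL g s := by
  rw [lamC, mulC_apply _ _ hs, adjC_apply _ hs]

theorem inv_eq_adjugate {M : Mat} (h : M.det = 1) : M⁻¹ = M.adjugate := by
  rw [Matrix.inv_def, h, Ring.inverse_one, one_smul]

/-- Replaces the inverse by the adjugate, so that the tangent direction extends smoothly to all
matrix curves. -/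
theorem Lam_eq_lamC {g : SmoothCurve L Mat} {s : ℝ} (hs : s ∈ Icc 0 L) (h : (g s).det = 1) :
    Lam g s = lamC g s := by
  rw [lamC_apply g hs, Lam, inv_eq_adjugate h, velocity, curveDeriv, derivL_apply g hs]

theorem derivL_eq_mul_lamC {g : SmoothCurve L Mat} {s : ℝ} (hs : s ∈ Icc 0 L)
    (h : (g s).det = 1) : derivL g s = g s * lamC g s := by
  rw [lamC_apply g hs, ← mul_assoc, Matrix.mul_adjugate, h, one_smul, one_mul]

/-- The curve on the sphere with affine coordinate `z`. -/
noncomputable def paramC (a : ℂ) (z : SmoothCurve L ℂ) : SmoothCurve L Mat := superpose (param a) z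

theorem paramC_apply (a : ℂ) (z : SmoothCurve L ℂ) {s : ℝ} (hs : s ∈ Icc 0 L) :
    paramC a z s = param a (z s) :=
  superpose_apply' (contDiff_param a) z hs

theorem trace_paramC (a : ℂ) (z : SmoothCurve L ℂ) : ∀ s ∈ Icc 0 L, (paramC a z s).trace = 0 :=
  fun s hs => by rw [paramC_apply a z hs, trace_param]

/-- The anchored curve whose tangent direction has affine coordinate `z`. -/
noncomputable def curveOf (a : ℂ) (z : SmoothCurve L ℂ) : SmoothCurve L Mat := sol (paramC a z)

theorem det_curveOf (a : ℂ) (z : SmoothCurve L ℂ) {s : ℝ} (hs : s ∈ Icc 0 L) :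
    (curveOf a z s).det = 1 :=
  det_sol (trace_paramC a z) hs

theorem lamC_curveOf (a : ℂ) (z : SmoothCurve L ℂ) : lamC (curveOf a z) = paramC a z := by
  refine ext_on fun s hs => ?_
  rw [lamC_apply _ hs, curveOf, derivL_sol _ hs, ← mul_assoc, Matrix.adjugate_mul]
  rw [show (sol (paramC a z) s).det = 1 from det_curveOf a z hs, one_smul, one_mul]

theorem Lam_curveOf (a : ℂ) (z : SmoothCurve L ℂ) {s : ℝ} (hs : s ∈ Icc 0 L) :
    Lam (curveOf a z) s = param a (z s) := by
  rw [Lam_eq_lamC hs (det_curveOf a z hs), lamC_curveOf, paramC_apply a z hs]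

theorem curveOf_mem_horiz (a : ℂ) {z : SmoothCurve L ℂ} (hz : z 0 = 0) :
    curveOf a z ∈ Horiz L := by
  refine ⟨sol_zero _, fun s hs => det_curveOf a z hs, superpose (paramFrame a) z, ?_,
    fun s hs => ?_⟩
  · rw [superpose_apply' (contDiff_paramFrame a) z (zero_mem L), hz, paramFrame_zero]
  · rw [superpose_apply' (contDiff_paramFrame a) z hs, paramFrame_conj, Lam_curveOf a z hs]
    exact ⟨paramFrame_mem a (z s), rfl⟩

theorem exists_lamC_eq_lineProj {g : SmoothCurve L Mat} (hg : g ∈ Horiz L) {s : ℝ}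
    (hs : s ∈ Icc 0 L) :
    ∃ x y : ℂ, x * conj x + y * conj y = 1 ∧ lamC g s = lineProj x y := by
  obtain ⟨-, hdet, R, -, hR⟩ := hg
  obtain ⟨x, y, hxy, hf⟩ := exists_frame (hR s hs).1
  refine ⟨x, y, hxy, ?_⟩
  rw [← Lam_eq_lamC hs (hdet s hs), (hR s hs).2, hf, frame_conj hxy]

theorem lamC_zero {g : SmoothCurve L Mat} (hg : g ∈ Horiz L) : lamC g 0 = B₁ := by
  obtain ⟨-, hdet, R, hR0, hR⟩ := hg
  rw [← Lam_eq_lamC (zero_mem L) (hdet 0 (zero_mem L)), (hR 0 (zero_mem L)).2, hR0]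
  simp

theorem trace_lamC {g : SmoothCurve L Mat} (hg : g ∈ Horiz L) :
    ∀ s ∈ Icc 0 L, (lamC g s).trace = 0 := fun s hs => by
  obtain ⟨x, y, hxy, h⟩ := exists_lamC_eq_lineProj hg hs
  rw [h, trace_lineProj (by rw [hxy]; exact one_ne_zero)]

/-- The curves whose tangent direction has an affine coordinate. -/
def coordDomain (L : ℝ) [Fact (0 < L)] (a : ℂ) : Set (SmoothCurve L Mat) :=
  {g | ∀ s ∈ Icc 0 L, coordDen a (lamC g s) ≠ 0}

/-- The affine coordinate of the tangent direction of a curve. -/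
noncomputable def coordC (a : ℂ) (g : SmoothCurve L Mat) : SmoothCurve L ℂ :=
  superpose (coord a) (lamC g)

theorem isOpen_coordDen_ne (a : ℂ) : IsOpen {M : Mat | coordDen a M ≠ 0} :=
  (contDiff_coordDen a).continuous.isOpen_preimage _ isOpen_ne

theorem coordC_apply {a : ℂ} {g : SmoothCurve L Mat} (hg : g ∈ coordDomain L a) {s : ℝ}
    (hs : s ∈ Icc 0 L) : coordC a g s = coord a (lamC g s) :=
  superpose_apply (contDiffOn_coord a) hg hs

theorem coordC_curveOf (a : ℂ) (z : SmoothCurve L ℂ) : coordC a (curveOf a z) = z := by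
  refine ext_on fun s hs => ?_
  rw [coordC, lamC_curveOf, superpose_apply (contDiffOn_coord a) (fun s hs => ?_) hs,
    paramC_apply a z hs, coord_param]
  rw [paramC_apply a z hs]
  exact coordDen_param a _

theorem curveOf_mem_coordDomain (a : ℂ) (z : SmoothCurve L ℂ) : curveOf a z ∈ coordDomain L a :=
  fun s hs => by
    rw [lamC_curveOf, paramC_apply a z hs]
    exact coordDen_param a _

/-- The coordinate recovers the tangent direction on the sphere, and an anchored curve is the unique
solution of g' = gΛ. -/
theorem curveOf_coordC {a : ℂ} {g : SmoothCurve L Mat} (hg : g ∈ Horiz L)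
    (hga : g ∈ coordDomain L a) : curveOf a (coordC a g) = g := by
  have h : paramC a (coordC a g) = lamC g := ext_on fun s hs => by
    obtain ⟨x, y, hxy, h⟩ := exists_lamC_eq_lineProj hg hs
    have hd := hga s hs
    rw [paramC_apply _ _ hs, coordC_apply hga hs]
    rw [h] at hd ⊢
    exact param_coord hxy hd
  rw [curveOf, h]
  exact (eq_sol hg.1 (fun s hs => derivL_eq_mul_lamC hs (hg.2.1 s hs)) (trace_lamC hg)).symm

theorem coordC_zero {a : ℂ} {g : SmoothCurve L Mat} (hg : g ∈ Horiz L)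
    (hga : g ∈ coordDomain L a) : coordC a g 0 = 0 := by
  rw [coordC_apply hga (zero_mem L), lamC_zero hg, coord_B₁]

/-- The entry y x̄ of the tangent direction traces a smooth curve in ℂ, whose image has Hausdorff
dimension at most one and so omits some `c` with |c| < 1/2. The chart is chosen so that its missing
line has this entry equal to `c`. -/
theorem exists_mem_coordDomain {g : SmoothCurve L Mat} (hg : g ∈ Horiz L) :
    ∃ a, g ∈ coordDomain L a := by
  have hsm : ContDiffOn ℝ 1 (fun s => lamC g s 1 0) (Icc 0 L) :=
    ((contDiff_entry 1 0).comp_contDiffOn (lamC g).contDiffOn).of_le (by exact_mod_cast le_top)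
  have hdense := hsm.dense_compl_image_of_dimH_lt_finrank (convex_Icc 0 L) Subset.rfl (by
    rw [Complex.finrank_real_complex]
    calc dimH (Icc 0 L) ≤ dimH (univ : Set ℝ) := dimH_mono (subset_univ _)
      _ < _ := by rw [Real.dimH_univ]; norm_num)
  obtain ⟨c, hc, hcn⟩ := hdense.exists_mem_open (Metric.isOpen_ball (x := (0 : ℂ)) (ε := 1 / 2))
    ⟨0, by simp⟩
  have hn : Complex.normSq c < 1 / 4 := by
    have : ‖c‖ < 1 / 2 := by simpa using hcn
    rw [Complex.normSq_eq_norm_sq]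
    nlinarith [norm_nonneg c]
  set r := √(1 - 4 * Complex.normSq c) with hr
  have hr2 : r * r = 1 - 4 * Complex.normSq c := Real.mul_self_sqrt (by linarith)
  have hr0 : 0 ≤ r := Real.sqrt_nonneg _
  -- The line spanned by (a, 1) has entry ā / (1 + |a|²). With a = t c̄ this equals `c` as soon as 1
  -- + t²|c|² = t; the present `t` is a root of that equation, in a form that is also valid for c =
  -- 0.
  set t : ℝ := 2 / (1 + r) with ht
  have ht2 : 1 + t * t * Complex.normSq c = t := by
    rw [ht]
    field_simp
    nlinarith
  have ht0 : t ≠ 0 := by positivity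
  have ht2' : 1 + (t : ℂ) * t * (c * conj c) = t := by
    rw [Complex.mul_conj]
    exact_mod_cast ht2
  refine ⟨t * conj c, fun s hs hden => hc ⟨s, hs, ?_⟩⟩
  obtain ⟨x, y, hxy, h⟩ := exists_lamC_eq_lineProj hg hs
  have hxy0 : x * conj x + y * conj y ≠ 0 := by rw [hxy]; exact one_ne_zero
  rw [h, coordDen_lineProj _ hxy0, hxy, div_one, Complex.mul_conj, Complex.ofReal_eq_zero,
    Complex.normSq_eq_zero, sub_eq_zero] at hden
  have hM : lamC g s 1 0 = y * conj x := by
    rw [h, lineProj, hxy]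
    simp
  have hx' : conj x = t * c * conj y := by
    rw [hden]
    simp
  rw [hx'] at hM hxy
  rw [hden] at hxy
  have hty : (t : ℂ) * (y * conj y) = 1 := by
    linear_combination hxy - y * conj y * ht2'
  simp only [hM]
  linear_combination c * hty

/-! ### Smoothness of the coordinates and of their inverses -/

section CkOn

variable {E : Type} [AddCommGroup E] [Module ℝ E] [TopologicalSpace E] {n : ℕ} {U : Set E}

theorem ckOn_lamC {f : E → SmoothCurve L Mat} (hf : CkOn n f U) :
    CkOn n (fun x => lamC (f x)) U :=
  ckOn_mulC (ckOn_adjC hf) (hf.clm_comp derivL)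

theorem ckOn_coordC {a : ℂ} {f : E → SmoothCurve L Mat} (hf : CkOn n f U)
    (h : ∀ x ∈ U, f x ∈ coordDomain L a) : CkOn n (fun x => coordC a (f x)) U :=
  CkOn.superpose (isOpen_coordDen_ne a) (contDiffOn_coord a) (ckOn_lamC hf) h

theorem ckOn_curveOf {a : ℂ} {f : E → SmoothCurve L ℂ} (hf : CkOn n f U) :
    CkOn n (fun x => curveOf a (f x)) U :=
  ckOn_sol (fun x _ => trace_paramC a (f x)) (CkOn.superpose' (contDiff_param a) hf)

end CkOn

theorem continuous_lamC : Continuous (lamC : SmoothCurve L Mat → SmoothCurve L Mat) :=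
  continuousOn_univ.1 (ckOn_lamC (n := 0) (f := id) continuous_id.continuousOn)

theorem isOpen_coordDomain (a : ℂ) : IsOpen (coordDomain L a) :=
  (isOpen_forall_mem (isOpen_coordDen_ne a)).preimage continuous_lamC

/-- The variation of the tangent direction. -/
noncomputable def paramVar (a : ℂ) (z u : SmoothCurve L ℂ) : SmoothCurve L Mat :=
  superpose (tmap (param a)) (pairL (z, u))

theorem paramVar_apply (a : ℂ) (z u : SmoothCurve L ℂ) {s : ℝ} (hs : s ∈ Icc 0 L) :
    paramVar a z u s = paramDeriv a (z s) (u s) := by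
  rw [paramVar, superpose_apply (contDiffOn_tmap isOpen_univ (contDiff_param a).contDiffOn)
    (fun _ _ => ⟨mem_univ _, mem_univ _⟩) hs, pairL_apply _ hs]
  exact fderiv_param a _ _

/-- The variation of the curve. -/
noncomputable def curveVar (a : ℂ) (z u : SmoothCurve L ℂ) : SmoothCurve L Mat :=
  vary (curveOf a z) (paramVar a z u) (curveOf a z)

theorem hasDirDeriv_curveOf (a : ℂ) {E : Type} [AddCommGroup E] [Module ℝ E] [TopologicalSpace E]
    (A : E →L[ℝ] SmoothCurve L ℂ) (z u : E) :
    HasDirDeriv (fun x => curveOf a (A x)) z u (curveVar a (A z) (A u)) := by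
  refine hasDirDeriv_sol (trace_paramC a (A z)) ?_
  have h1 : HasDirDeriv (superpose (param a)) (A z) (A u) (paramVar a (A z) (A u)) :=
    (hasHadamardDeriv_superpose isOpen_univ (contDiff_param a).contDiffOn
      (fun _ _ => mem_univ _) (A u)).comp (f := id) (by
        have : Tendsto (fun _ : ℝ => A u) (𝓝[≠] 0) (𝓝 (A u)) := tendsto_const_nhds
        refine this.congr' ?_
        filter_upwards [self_mem_nhdsWithin] with t ht
        simp [inv_smul_smul₀ (show t ≠ 0 from ht)])
  refine Tendsto.congr (fun t => ?_) h1
  simp only [map_add, map_smul]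
  rfl

/-- The variation is I g with I' = g U g⁻¹. Differentiating g⁻¹ g' in this direction, the terms
containing I cancel and U remains. -/
theorem dLam_curveVar (a : ℂ) (z u : SmoothCurve L ℂ) {s : ℝ} (hs : s ∈ Icc 0 L) :
    dLam (curveOf a z) (curveVar a z u) s = paramDeriv a (z s) (u s) := by
  have hdet := det_curveOf a z hs
  have h1 : (curveOf a z s).adjugate * curveOf a z s = 1 := by
    rw [Matrix.adjugate_mul, hdet, one_smul]
  have hg : derivL (curveOf a z) s = curveOf a z s * paramC a z s := derivL_sol _ hs
  rw [dLam, velocity, velocity, curveDeriv, curveDeriv, ← derivL_apply _ hs, ← derivL_apply _ hs,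
    inv_eq_adjugate hdet, hg, curveVar, vary, derivL_mulC _ _ hs, derivL_primL, hg,
    mulC_apply _ _ hs, mulC_apply _ _ hs, mulC_apply _ _ hs, adjC_apply _ hs,
    ← paramVar_apply a z u hs]
  generalize primL (mulC (mulC (curveOf a z) (paramVar a z u)) (adjC (curveOf a z))) s = I
  generalize curveOf a z s = G at *
  generalize paramVar a z u s = U at *
  generalize paramC a z s = Λ at *
  calc G.adjugate * (G * U * G.adjugate * G + I * (G * Λ))
        - G.adjugate * (I * G) * G.adjugate * (G * Λ)
      = (G.adjugate * G) * U * (G.adjugate * G) + G.adjugate * I * G * Λ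
        - G.adjugate * I * G * (G.adjugate * G) * Λ := by noncomm_ring
    _ = U := by rw [h1]; noncomm_ring

theorem curveDeriv_tangentRep (a : ℂ) (z u : SmoothCurve L ℂ) {s : ℝ} (hs : s ∈ Icc 0 L) :
    curveDeriv L (tangentRep (curveOf a z) (curveVar a z u)) s = paramDeriv a (z s) (u s) := by
  have h : EqOn (tangentRep (curveOf a z) (curveVar a z u)) (primL (paramVar a z u)) (Icc 0 L) :=
    fun x hx => by
      rw [tangentRep, primL_apply _ hx]
      refine intervalIntegral.integral_congr fun y hy => ?_
      rw [uIcc_of_le hx.1] at hy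
      have hy' : y ∈ Icc 0 L := ⟨hy.1, hy.2.trans hx.2⟩
      exact (dLam_curveVar a z u hy').trans (paramVar_apply a z u hy').symm
  rw [curveDeriv, derivWithin_congr h (h hs), ← derivL_apply _ hs, derivL_primL,
    paramVar_apply a z u hs]

theorem contDiff_areaForm (a : ℂ) : ContDiff ℝ ∞ (areaForm a) := by
  have h1 : ContDiff ℝ ∞ (fun p : ℂ × ℂ × ℂ => (lenSq a p.1)⁻¹) :=
    ((contDiff_lenSq a).comp contDiff_fst).inv fun p => (lenSq_pos a p.1).ne'
  have h2 : ContDiff ℝ ∞ (fun p : ℂ × ℂ × ℂ => conj p.2.1) :=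
    contDiff_conj.comp (contDiff_fst.comp contDiff_snd)
  have h3 : ContDiff ℝ ∞ (fun p : ℂ × ℂ × ℂ => (conj p.2.1 * p.2.2).im) :=
    Complex.imCLM.contDiff.comp (h2.mul (contDiff_snd.comp contDiff_snd))
  exact (contDiff_const.mul h3).mul (h1.mul h1)

/-- The triple of curves. -/
noncomputable def tripleL :
    (SmoothCurve L ℂ × SmoothCurve L ℂ × SmoothCurve L ℂ) →L[ℝ] SmoothCurve L (ℂ × ℂ × ℂ) :=
  pairL.comp ((ContinuousLinearMap.id ℝ _).prodMap pairL)

theorem tripleL_apply (z u v : SmoothCurve L ℂ) {s : ℝ} (hs : s ∈ Icc 0 L) :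
    tripleL (z, u, v) s = (z s, u s, v s) := by
  change pairL (z, pairL (u, v)) s = _
  rw [pairL_apply _ hs, pairL_apply _ hs]

/-- The symplectic form in the coordinate `z`. -/
noncomputable def alphaC (a : ℂ) (z u v : SmoothCurve L ℂ) : ℝ :=
  evalL L (primL (superpose (areaForm a) (tripleL (z, u, v))))

theorem alphaC_eq (a : ℂ) (z u v : SmoothCurve L ℂ) :
    alphaC a z u v = ∫ s in (0 : ℝ)..L, areaForm a (z s, u s, v s) := by
  rw [alphaC, evalL_apply, primL_apply _ (right_mem L)]
  refine intervalIntegral.integral_congr fun s hs => ?_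
  rw [uIcc_of_le hL.out.le] at hs
  rw [superpose_apply' (contDiff_areaForm a) _ hs, tripleL_apply z u v hs]

/-- The pointwise trace is i times a real area form, and the prefactor 1/i removes the i. This is
where the form is seen to be real. -/
theorem omega_curveVar (a : ℂ) (z u v : SmoothCurve L ℂ) :
    omega (curveOf a z) (curveVar a z u) (curveVar a z v) = alphaC a z u v := by
  have h : ∫ s in (0 : ℝ)..L, traceForm (Lam (curveOf a z) s)
      (bracket (curveDeriv L (tangentRep (curveOf a z) (curveVar a z u)) s)
        (curveDeriv L (tangentRep (curveOf a z) (curveVar a z v)) s))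
      = ∫ s in (0 : ℝ)..L, Complex.I * (areaForm a (z s, u s, v s) : ℂ) := by
    refine intervalIntegral.integral_congr fun s hs => ?_
    rw [uIcc_of_le hL.out.le] at hs
    rw [Lam_curveOf a z hs, curveDeriv_tangentRep a z u hs, curveDeriv_tangentRep a z v hs,
      traceForm_bracket_paramDeriv]
  rw [omega, h, intervalIntegral.integral_const_mul, alphaC_eq, intervalIntegral.integral_ofReal,
    ← mul_assoc, one_div, inv_mul_cancel₀ Complex.I_ne_zero, one_mul]

theorem curveVar_injective (a : ℂ) (z : SmoothCurve L ℂ) :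
    Function.Injective (curveVar a z) := by
  intro u v h
  refine ext_on fun s hs => ?_
  have h1 : paramDeriv a (z s) (u s) = paramDeriv a (z s) (v s) := by
    rw [← dLam_curveVar a z u hs, ← dLam_curveVar a z v hs, h]
  have h2 : paramDeriv a (z s) (u s - v s) = 0 := by
    rw [← fderiv_param, map_sub, fderiv_param, fderiv_param, h1, sub_self]
  -- A vector w in the kernel of the derivative is paired with i w: the area form gives a non-zero
  -- multiple of |w|², while the trace vanishes.
  have h3 := traceForm_bracket_paramDeriv a (z s) (u s - v s) (Complex.I * (u s - v s))
  rw [h2] at h3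
  have h4 : areaForm a (z s, u s - v s, Complex.I * (u s - v s)) = 0 := by
    simpa [traceForm, bracket] using h3.symm
  have h5 : (conj (u s - v s) * (Complex.I * (u s - v s))).im = Complex.normSq (u s - v s) := by
    simp only [Complex.mul_im, Complex.mul_re, Complex.conj_re, Complex.conj_im, Complex.I_re,
      Complex.I_im, Complex.normSq_apply]
    ring
  have hq := (lenSq_pos a (z s)).ne'
  simp only [areaForm, h5] at h4
  have : Complex.normSq (u s - v s) = 0 := by simpa [hq] using h4
  exact sub_eq_zero.1 (Complex.normSq_eq_zero.1 this)

end Darboux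

/-! ## The symplectic form in coordinates -/

namespace Darboux

open FrechetCalculus SmoothCurve
open scoped ComplexConjugate

/-! ### A two-form on the real plane -/

section AreaForm

/-- The coefficient of the area form. -/
noncomputable def areaCoeff (a z : ℂ) : ℝ := -4 * ((lenSq a z)⁻¹ * (lenSq a z)⁻¹)

theorem contDiff_areaCoeff (a : ℂ) : ContDiff ℝ ∞ (areaCoeff a) := by
  have h1 : ContDiff ℝ ∞ (fun z : ℂ => (lenSq a z)⁻¹) :=
    (contDiff_lenSq a).inv fun z => (lenSq_pos a z).ne'
  exact contDiff_const.mul (h1.mul h1)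

theorem areaForm_eq (a z u v : ℂ) :
    areaForm a (z, u, v) = areaCoeff a z * (u.re * v.im - u.im * v.re) := by
  simp only [areaForm, areaCoeff, Complex.mul_im, Complex.conj_re, Complex.conj_im]
  ring

theorem tmap_areaForm (a z u v w u' v' : ℂ) :
    tmap (areaForm a) ((z, u, v), (w, u', v'))
      = fderiv ℝ (areaCoeff a) z w * (u.re * v.im - u.im * v.re)
        + areaCoeff a z * (u'.re * v.im + u.re * v'.im - (u'.im * v.re + u.im * v'.re)) := by
  have hl : HasDerivAt (fun t : ℝ => (z, u, v) + t • (w, u', v')) (w, u', v') 0 := by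
    simpa using ((hasDerivAt_id (0 : ℝ)).smul_const (w, u', v')).const_add (z, u, v)
  have hA : HasFDerivAt (areaForm a) (fderiv ℝ (areaForm a) (z, u, v))
      ((z, u, v) + (0 : ℝ) • (w, u', v')) := by
    simpa using ((contDiff_areaForm a).differentiable (by simp) (z, u, v)).hasFDerivAt
  have h1 := hA.comp_hasDerivAt (0 : ℝ) hl
  have hz : HasDerivAt (fun t : ℝ => z + t • w) w 0 := by
    simpa using ((hasDerivAt_id (0 : ℝ)).smul_const w).const_add z
  have hR : HasFDerivAt (areaCoeff a) (fderiv ℝ (areaCoeff a) z) (z + (0 : ℝ) • w) := by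
    simpa using ((contDiff_areaCoeff a).differentiable (by simp) z).hasFDerivAt
  have h2 := hR.comp_hasDerivAt (0 : ℝ) hz
  have hline : ∀ b c : ℝ, HasDerivAt (fun t : ℝ => b + t * c) c 0 := fun b c => by
    simpa using ((hasDerivAt_id (0 : ℝ)).mul_const c).const_add b
  have h3 := h2.mul (((hline u.re u'.re).mul (hline v.im v'.im)).sub
    ((hline u.im u'.im).mul (hline v.re v'.re)))
  refine h1.unique ((h3.congr_of_eventuallyEq (Eventually.of_forall fun t => ?_)).congr_deriv ?_)
  · simp only [Function.comp_apply, Prod.smul_mk, Prod.mk_add_mk, areaForm_eq, Pi.mul_apply,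
      Pi.sub_apply]
    simp
  · simp

/-- The pointwise identity behind the closedness of the area form. -/
theorem areaForm_closed (a z x y w xy yx xw wx yw wy : ℂ) :
    tmap (areaForm a) ((z, y, w), (x, yx, wx)) - tmap (areaForm a) ((z, x, w), (y, xy, wy))
      + tmap (areaForm a) ((z, x, y), (w, xw, yw)) - areaForm a (z, yx - xy, w)
      + areaForm a (z, wx - xw, y) - areaForm a (z, wy - yw, x) = 0 := by
  -- After the terms with derivatives of the fields cancel, a 3-form on a plane remains; it vanishes
  -- visibly once the differential of the density is expanded in the real basis 1, i.
  have hlin : ∀ c : ℂ, fderiv ℝ (areaCoeff a) z c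
      = c.re * fderiv ℝ (areaCoeff a) z 1 + c.im * fderiv ℝ (areaCoeff a) z Complex.I := by
    intro c
    have : c = c.re • (1 : ℂ) + c.im • Complex.I := by
      simp [Complex.re_add_im]
    conv_lhs => rw [this]
    rw [map_add, map_smul, map_smul, smul_eq_mul, smul_eq_mul]
  simp only [tmap_areaForm, areaForm_eq, hlin x, hlin y, hlin w, Complex.sub_re, Complex.sub_im]
  ring

end AreaForm

variable {L : ℝ} [hL : Fact (0 < L)]

/-- The integral over `[0, L]`. -/
noncomputable def integralL : SmoothCurve L ℝ →L[ℝ] ℝ := (evalL L).comp primL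

theorem alphaC_eq_integralL (a : ℂ) (z u v : SmoothCurve L ℂ) :
    alphaC a z u v = integralL (superpose (areaForm a) (tripleL (z, u, v))) := rfl

theorem ckOn_alphaC {E : Type} [AddCommGroup E] [Module ℝ E] [TopologicalSpace E] {n : ℕ}
    {U : Set E} (a : ℂ) {f g h : E → SmoothCurve L ℂ} (hf : CkOn n f U) (hg : CkOn n g U)
    (hh : CkOn n h U) : CkOn n (fun x => alphaC a (f x) (g x) (h x)) U :=
  (CkOn.superpose' (contDiff_areaForm a)
    ((hf.prodMk (hg.prodMk hh)).clm_comp tripleL)).clm_comp integralL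

theorem superpose_areaForm_apply (a : ℂ) (z u v : SmoothCurve L ℂ) {s : ℝ} (hs : s ∈ Icc 0 L) :
    superpose (areaForm a) (tripleL (z, u, v)) s = areaForm a (z s, u s, v s) := by
  rw [superpose_apply' (contDiff_areaForm a) _ hs, tripleL_apply z u v hs]

theorem alphaC_add_left (a : ℂ) (z u u' v : SmoothCurve L ℂ) :
    alphaC a z (u + u') v = alphaC a z u v + alphaC a z u' v := by
  rw [alphaC_eq_integralL, alphaC_eq_integralL, alphaC_eq_integralL, ← map_add]
  refine congr_arg _ (ext_on fun s hs => ?_)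
  rw [add_eval, superpose_areaForm_apply _ _ _ _ hs, superpose_areaForm_apply _ _ _ _ hs,
    superpose_areaForm_apply _ _ _ _ hs, add_eval, areaForm_eq, areaForm_eq, areaForm_eq,
    Complex.add_re, Complex.add_im]
  ring

theorem alphaC_smul_left (a : ℂ) (z : SmoothCurve L ℂ) (c : ℝ) (u v : SmoothCurve L ℂ) :
    alphaC a z (c • u) v = c * alphaC a z u v := by
  rw [alphaC_eq_integralL, alphaC_eq_integralL, ← smul_eq_mul, ← map_smul]
  refine congr_arg _ (ext_on fun s hs => ?_)
  rw [smul_eval, superpose_areaForm_apply _ _ _ _ hs, superpose_areaForm_apply _ _ _ _ hs,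
    smul_eval, areaForm_eq, areaForm_eq, Complex.smul_re, Complex.smul_im]
  simp only [smul_eq_mul]
  ring

theorem alphaC_skew (a : ℂ) (z u v : SmoothCurve L ℂ) : alphaC a z u v = -alphaC a z v u := by
  rw [alphaC_eq_integralL, alphaC_eq_integralL, eq_neg_iff_add_eq_zero, ← map_add,
    ← map_zero (integralL (L := L))]
  refine congr_arg _ (ext_on fun s hs => ?_)
  rw [add_eval, superpose_areaForm_apply _ _ _ _ hs, superpose_areaForm_apply _ _ _ _ hs,
    zero_eval, areaForm_eq, areaForm_eq]
  ring

/-- Pointwise multiplication by the imaginary unit. -/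
noncomputable def mulI (u : SmoothCurve L ℂ) : SmoothCurve L ℂ :=
  superpose (fun z => Complex.I * z) u

theorem contDiff_mulI : ContDiff ℝ ∞ (fun z : ℂ => Complex.I * z) := by fun_prop

theorem mulI_apply (u : SmoothCurve L ℂ) {s : ℝ} (hs : s ∈ Icc 0 L) :
    mulI u s = Complex.I * u s :=
  superpose_apply' contDiff_mulI u hs

/-- Up to sign the integrand is 4|u|² / (|1 + za|² + |z|²)², which is continuous and non-negative,
so a zero integral forces u = 0. -/
theorem eq_zero_of_alphaC_mulI {a : ℂ} {z u : SmoothCurve L ℂ} (h : alphaC a z u (mulI u) = 0) :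
    u = 0 := by
  by_contra hu
  have hne : ∃ s ∈ Icc 0 L, u s ≠ 0 := by
    by_contra! hcon
    exact hu (ext_on fun s hs => by rw [hcon s hs, zero_eval])
  obtain ⟨s₀, hs₀, hus₀⟩ := hne
  set f : SmoothCurve L ℝ := -superpose (areaForm a) (tripleL (z, u, mulI u)) with hf
  have hfs : ∀ s ∈ Icc 0 L, f s = 4 * ((lenSq a (z s))⁻¹ * (lenSq a (z s))⁻¹)
      * Complex.normSq (u s) := by
    intro s hs
    rw [hf, ← zero_sub, sub_eval, superpose_areaForm_apply _ _ _ _ hs, zero_eval, mulI_apply _ hs,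
      areaForm_eq, areaCoeff, Complex.normSq_apply]
    simp
  have hpos : 0 < ∫ s in (0 : ℝ)..L, f s := by
    refine intervalIntegral.integral_pos hL.out f.continuousOn (fun s hs => ?_) ⟨s₀, hs₀, ?_⟩
    · rw [hfs s ⟨hs.1.le, hs.2⟩]
      have := lenSq_pos a (z s)
      have := Complex.normSq_nonneg (u s)
      positivity
    · rw [hfs s₀ hs₀]
      have := lenSq_pos a (z s₀)
      have := Complex.normSq_pos.2 hus₀
      positivity
  have h1 : integralL f = 0 := by
    rw [hf, map_neg, ← alphaC_eq_integralL, h, neg_zero]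
  have h2 : integralL f = ∫ s in (0 : ℝ)..L, f s := primL_apply f (right_mem L)
  linarith

theorem hasDirDeriv_alphaC {E : Type} [AddCommGroup E] [Module ℝ E] [TopologicalSpace E] (a : ℂ)
    {A B C : E → SmoothCurve L ℂ} {x h : E} {A' B' C' : SmoothCurve L ℂ}
    (hA : HasDirDeriv A x h A') (hB : HasDirDeriv B x h B') (hC : HasDirDeriv C x h C') :
    HasDirDeriv (fun y => alphaC a (A y) (B y) (C y)) x h
      (integralL (superpose (tmap (areaForm a))
        (pairL (tripleL (A x, B x, C x), tripleL (A', B', C'))))) := by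
  have h1 := (hasHadamardDeriv_clm tripleL (A x, B x, C x) (A', B', C')).comp
    (f := fun y => (A y, B y, C y)) (hA.prodMk (hB.prodMk hC))
  have h2 := (hasHadamardDeriv_superpose isOpen_univ (contDiff_areaForm a).contDiffOn
    (fun _ _ => mem_univ _) _).comp h1
  exact (hasHadamardDeriv_clm integralL _ _).comp h2

theorem superpose_tmap_areaForm_apply (a : ℂ) (z u v w u' v' : SmoothCurve L ℂ) {s : ℝ}
    (hs : s ∈ Icc 0 L) :
    superpose (tmap (areaForm a)) (pairL (tripleL (z, u, v), tripleL (w, u', v'))) s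
      = tmap (areaForm a) ((z s, u s, v s), (w s, u' s, v' s)) := by
  rw [superpose_apply (contDiffOn_tmap isOpen_univ (contDiff_areaForm a).contDiffOn)
    (fun _ _ => ⟨mem_univ _, mem_univ _⟩) hs, pairL_apply _ hs]
  simp only
  rw [tripleL_apply _ _ _ hs, tripleL_apply _ _ _ hs]

/-! ### The form on a linear space of coordinate curves -/

section Submodule

set_option linter.unusedSectionVars false

variable {S : Submodule ℝ (SmoothCurve L ℂ)}

theorem hasDirDeriv_coe_of_smoothOn {ξ : S → S} (hξ : SmoothOn ξ univ) (x h : S) :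
    HasDirDeriv (fun y => (ξ y : SmoothCurve L ℂ)) x h (dirDeriv ξ x h : S) := by
  obtain ⟨-, ξ', h1, -⟩ := hξ 1
  have h2 := h1 x (mem_univ _) h
  rw [h2.dirDeriv_eq]
  exact (hasHadamardDeriv_clm S.subtypeL _ _).comp h2

theorem hasDirDeriv_coe (x h : S) :
    HasDirDeriv (fun y : S => (y : SmoothCurve L ℂ)) x h (h : SmoothCurve L ℂ) := by
  refine (tendsto_const_nhds (x := (h : SmoothCurve L ℂ))).congr' ?_
  filter_upwards [self_mem_nhdsWithin] with t ht
  simp [inv_smul_smul₀ (show t ≠ 0 from ht)]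

theorem dirDeriv_alphaC (a : ℂ) {η ζ : S → S} (hη : SmoothOn η univ) (hζ : SmoothOn ζ univ)
    (x h : S) :
    dirDeriv (fun y : S => alphaC (L := L) a y (η y) (ζ y)) x h
      = integralL (superpose (tmap (areaForm a)) (pairL (tripleL ((x : SmoothCurve L ℂ),
          (η x : SmoothCurve L ℂ), (ζ x : SmoothCurve L ℂ)), tripleL ((h : SmoothCurve L ℂ),
          ((dirDeriv η x h : S) : SmoothCurve L ℂ), ((dirDeriv ζ x h : S) : SmoothCurve L ℂ))))) :=
  (hasDirDeriv_alphaC a (hasDirDeriv_coe x h) (hasDirDeriv_coe_of_smoothOn hη x h)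
    (hasDirDeriv_coe_of_smoothOn hζ x h)).dirDeriv_eq

/-- All six terms are integrals of pointwise expressions; evaluated at a parameter, their sum is the
closedness identity of the area form on the plane. -/
theorem dForm_alphaC (a : ℂ) {ξ η ζ : S → S} (hξ : SmoothOn ξ univ) (hη : SmoothOn η univ)
    (hζ : SmoothOn ζ univ) (x : S) :
    dForm (fun z u v : S => alphaC (L := L) a z u v) ξ η ζ x = 0 := by
  rw [dForm, dirDeriv_alphaC a hη hζ, dirDeriv_alphaC a hξ hζ, dirDeriv_alphaC a hξ hη]
  simp only [alphaC_eq_integralL]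
  rw [← map_sub, ← map_add, ← map_sub, ← map_add, ← map_sub, ← map_zero (integralL (L := L))]
  refine congr_arg _ (ext_on fun s hs => ?_)
  rw [sub_eval, add_eval, sub_eval, add_eval, sub_eval, superpose_tmap_areaForm_apply _ _ _ _ _ _ _ hs,
    superpose_tmap_areaForm_apply _ _ _ _ _ _ _ hs,
    superpose_tmap_areaForm_apply _ _ _ _ _ _ _ hs,
    superpose_areaForm_apply _ _ _ _ hs, superpose_areaForm_apply _ _ _ _ hs,
    superpose_areaForm_apply _ _ _ _ hs]
  exact areaForm_closed a _ _ _ _ _ _ _ _ _ _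

theorem smoothOn_alphaC (a : ℂ) (U : Set (S × S × S)) :
    SmoothOn (fun p : S × S × S => alphaC (L := L) a p.1 p.2.1 p.2.2) U := fun n =>
  ckOn_alphaC a (ckOn_clm n (S.subtypeL.comp (ContinuousLinearMap.fst ℝ S (S × S))) U)
    (ckOn_clm n (S.subtypeL.comp ((ContinuousLinearMap.fst ℝ S S).comp
      (ContinuousLinearMap.snd ℝ S (S × S)))) U)
    (ckOn_clm n (S.subtypeL.comp ((ContinuousLinearMap.snd ℝ S S).comp
      (ContinuousLinearMap.snd ℝ S (S × S)))) U)

theorem eq_zero_of_forall_alphaC (hI : ∀ z ∈ S, mulI z ∈ S) {a : ℂ} {x u : S}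
    (h : ∀ v : S, alphaC (L := L) a x u v = 0) : u = 0 := by
  have h1 := eq_zero_of_alphaC_mulI (h ⟨mulI (u : SmoothCurve L ℂ), hI _ u.2⟩)
  exact Subtype.ext h1

theorem isSymplecticOn_alphaC (hI : ∀ z ∈ S, mulI z ∈ S) (a : ℂ) :
    IsSymplecticOn (fun z u v : S => alphaC (L := L) a z u v) univ where
  smooth := smoothOn_alphaC a _
  add_left x _ u u' v := alphaC_add_left (L := L) a x u u' v
  smul_left x _ c u v := alphaC_smul_left (L := L) a x c u v
  skew x _ u v := alphaC_skew (L := L) a x u v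
  closed _ _ _ hξ hη hζ x _ := dForm_alphaC a hξ hη hζ x
  nondegenerate _ _ _ hu := eq_zero_of_forall_alphaC hI hu

end Submodule

/-! ## The manifolds of horizontal curves -/

/-- `M` is the set of horizontal curves whose coordinates lie in the closed subspace `S`. -/
structure IsCoordModel (S : Submodule ℝ (SmoothCurve L ℂ)) (M : Set (SmoothCurve L Mat)) :
    Prop where
  isClosed : IsClosed (S : Set (SmoothCurve L ℂ))
  mulI_mem : ∀ z ∈ S, mulI z ∈ S
  subset : M ⊆ Horiz L
  curveOf_mem : ∀ a, ∀ z ∈ S, curveOf a z ∈ M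
  coordC_mem : ∀ a, ∀ g ∈ M, g ∈ coordDomain L a → coordC a g ∈ S

/-! ### Charts, atlas and the manifold structure -/

namespace IsCoordModel

variable {S : Submodule ℝ (SmoothCurve L ℂ)} {M : Set (SmoothCurve L Mat)}

open Classical in
/-- The coordinate, as a map to the model space. -/
noncomputable def toCoord (S : Submodule ℝ (SmoothCurve L ℂ)) (a : ℂ) (g : SmoothCurve L Mat) : S :=
  if h : coordC a g ∈ S then ⟨coordC a g, h⟩ else 0

theorem coe_toCoord (hM : IsCoordModel S M) {a : ℂ} {g : SmoothCurve L Mat} (hg : g ∈ M)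
    (hga : g ∈ coordDomain L a) : (toCoord S a g : SmoothCurve L ℂ) = coordC a g := by
  rw [toCoord, dif_pos (hM.coordC_mem a g hg hga)]

/-- The inverse of the coordinate. -/
noncomputable def ofCoord (hM : IsCoordModel S M) (a : ℂ) (z : S) : M :=
  ⟨curveOf a (z : SmoothCurve L ℂ), hM.curveOf_mem a _ z.2⟩

theorem toCoord_ofCoord (hM : IsCoordModel S M) (a : ℂ) (z : S) :
    toCoord S a (hM.ofCoord a z : SmoothCurve L Mat) = z := by
  have h1 : (hM.ofCoord a z : SmoothCurve L Mat) ∈ coordDomain L a :=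
    curveOf_mem_coordDomain a (z : SmoothCurve L ℂ)
  exact Subtype.ext ((hM.coe_toCoord (hM.ofCoord a z).2 h1).trans
    (coordC_curveOf a (z : SmoothCurve L ℂ)))

theorem ofCoord_toCoord (hM : IsCoordModel S M) {a : ℂ} {g : M}
    (hg : (g : SmoothCurve L Mat) ∈ coordDomain L a) :
    hM.ofCoord a (toCoord S a (g : SmoothCurve L Mat)) = g :=
  Subtype.ext <| (congr_arg (curveOf a) (hM.coe_toCoord g.2 hg)).trans
    (curveOf_coordC (hM.subset g.2) hg)

theorem continuousOn_toCoord (hM : IsCoordModel S M) (a : ℂ) :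
    ContinuousOn (fun g : M => toCoord S a (g : SmoothCurve L Mat))
      (Subtype.val ⁻¹' coordDomain L a) := by
  have h1 : ContinuousOn (coordC a) (coordDomain L a) :=
    ckOn_coordC (n := 0) (f := id) (a := a) continuousOn_id fun _ hx => hx
  refine IsInducing.subtypeVal.continuousOn_iff.2 ?_
  exact (h1.comp continuous_subtype_val.continuousOn fun _ hg => hg).congr
    fun g hg => hM.coe_toCoord g.2 hg

theorem continuousOn_ofCoord (hM : IsCoordModel S M) (a : ℂ) :
    ContinuousOn (hM.ofCoord a) univ := by
  refine IsInducing.subtypeVal.continuousOn_iff.2 ?_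
  exact ckOn_curveOf (n := 0) (a := a) (f := fun z : S => (z : SmoothCurve L ℂ))
    continuous_subtype_val.continuousOn

/-- The chart given by the affine coordinate `z` of the line spanned by `(1 + z a, z)`. -/
noncomputable def chart (hM : IsCoordModel S M) (a : ℂ) : OpenPartialHomeomorph M S where
  toFun g := toCoord S a (g : SmoothCurve L Mat)
  invFun := hM.ofCoord a
  source := Subtype.val ⁻¹' coordDomain L a
  target := univ
  map_source' _ _ := mem_univ _
  map_target' z _ := curveOf_mem_coordDomain a (z : SmoothCurve L ℂ)
  left_inv' _ hg := hM.ofCoord_toCoord hg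
  right_inv' z _ := hM.toCoord_ofCoord a z
  open_source := (isOpen_coordDomain a).preimage continuous_subtype_val
  open_target := isOpen_univ
  continuousOn_toFun := hM.continuousOn_toCoord a
  continuousOn_invFun := hM.continuousOn_ofCoord a

/-- The atlas of the affine coordinates. -/
@[reducible] noncomputable def chartedSpace (hM : IsCoordModel S M) : ChartedSpace S M where
  atlas := range hM.chart
  chartAt g := hM.chart (exists_mem_coordDomain (hM.subset g.2)).choose
  mem_chart_source g := (exists_mem_coordDomain (hM.subset g.2)).choose_spec
  chart_mem_atlas _ := mem_range_self _

theorem smoothOn_symm (hM : IsCoordModel S M) (a : ℂ) (U : Set S) :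
    SmoothOn (fun z => ((hM.chart a).symm z : SmoothCurve L Mat)) U := fun n =>
  ckOn_curveOf (ckOn_clm n S.subtypeL U)

theorem dirDeriv_symm (hM : IsCoordModel S M) (a : ℂ) (z u : S) :
    dirDeriv (fun y => ((hM.chart a).symm y : SmoothCurve L Mat)) z u = curveVar a z u :=
  (hasDirDeriv_curveOf a S.subtypeL z u).dirDeriv_eq

/-- The chart is the restriction of a smooth map on an open set of matrix curves, with values in the
closed model space. The initial property is immediate, and coordinate changes are the case where the
map is an inverse chart. -/
theorem smoothOn_chart_comp (hM : IsCoordModel S M) (a : ℂ) {N : Type} [AddCommGroup N]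
    [Module ℝ N] [TopologicalSpace N] (hN : IsFrechetSpace N) {U : Set N} {f : N → M}
    (hU : IsOpen U) (hf : SmoothOn (fun y => (f y : SmoothCurve L Mat)) U)
    (hfU : MapsTo f U (hM.chart a).source) : SmoothOn (fun y => hM.chart a (f y)) U := by
  obtain ⟨-, p, hp, -⟩ := hN
  -- Congruence and restriction of the codomain need continuous vector space operations on the
  -- source; the seminorms of a Fréchet space provide them.
  have := hp.topologicalAddGroup
  have := hp.continuousSMul
  exact fun n => CkOn.codRestrict hM.isClosed hU ((ckOn_coordC (hf n) hfU).congr hU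
    fun y hy => (hM.coe_toCoord (f y).2 (hfU hy)).symm)

theorem injective_dirDeriv_symm (hM : IsCoordModel S M) (a : ℂ) (z : S) :
    Function.Injective (dirDeriv (fun y => ((hM.chart a).symm y : SmoothCurve L Mat)) z) := by
  intro u v huv
  rw [hM.dirDeriv_symm, hM.dirDeriv_symm] at huv
  exact Subtype.ext (curveVar_injective a (z : SmoothCurve L ℂ) huv)

theorem isFrechetSubmanifold (hM : IsCoordModel S M) :
    @IsFrechetSubmanifold S _ _ _ _ _ _ _ M hM.chartedSpace :=
  letI := hM.chartedSpace
  { model := isFrechetSpace_submodule S hM.isClosed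
    hausdorff := inferInstance
    transition := by
      rintro _ ⟨a, rfl⟩ _ ⟨b, rfl⟩
      exact hM.smoothOn_chart_comp b (isFrechetSpace_submodule S hM.isClosed)
        ((hM.chart a).symm.trans (hM.chart b)).open_source (hM.smoothOn_symm a _)
        fun z hz => hz.2
    inclusion := by
      rintro _ ⟨a, rfl⟩
      exact hM.smoothOn_symm a _
    immersion := by
      rintro _ ⟨a, rfl⟩ z _
      exact hM.injective_dirDeriv_symm a z
    initial := by
      rintro _ ⟨a, rfl⟩ N _ _ _ hN U f hU hf hfU
      exact hM.smoothOn_chart_comp a hN hU hf hfU }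

theorem ofReal_alphaC (hM : IsCoordModel S M) (a : ℂ) (z u v : S) :
    (alphaC (L := L) a z u v : ℂ) = omega ((hM.chart a).symm z : SmoothCurve L Mat)
      (dirDeriv (fun y => ((hM.chart a).symm y : SmoothCurve L Mat)) z u)
      (dirDeriv (fun y => ((hM.chart a).symm y : SmoothCurve L Mat)) z v) := by
  rw [hM.dirDeriv_symm, hM.dirDeriv_symm]
  exact (omega_curveVar a (z : SmoothCurve L ℂ) u v).symm

theorem isSymplecticFrechetManifold (hM : IsCoordModel S M) :
    IsSymplecticFrechetManifold M omega := by
  refine ⟨S, _, _, _, hM.chartedSpace, hM.isFrechetSubmanifold, ?_⟩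
  rintro _ ⟨a, rfl⟩
  exact ⟨fun z u v : S => alphaC (L := L) a z u v, fun z _ u v => hM.ofReal_alphaC a z u v,
    isSymplecticOn_alphaC hM.mulI_mem a⟩

end IsCoordModel

/-- The curves that vanish at `0`. -/
noncomputable def anchored (L : ℝ) [Fact (0 < L)] : Submodule ℝ (SmoothCurve L ℂ) where
  carrier := {z | z 0 = 0}
  add_mem' {z w} hz hw := by
    rw [mem_ofPred_eq] at *
    rw [add_eval, hz, hw, add_zero]
  zero_mem' := rfl
  smul_mem' c z hz := by
    rw [mem_ofPred_eq] at *
    rw [smul_eval, hz, smul_zero]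

theorem isCoordModel_horiz : IsCoordModel (anchored L) (Horiz L) where
  isClosed := isClosed_eq (evalL 0).continuous continuous_const
  mulI_mem z hz := by
    have hz' : z 0 = 0 := hz
    change mulI z 0 = 0
    rw [mulI_apply z (zero_mem L), hz', mul_zero]
  subset := Subset.rfl
  curveOf_mem a z hz := curveOf_mem_horiz a hz
  coordC_mem a g hg hga := coordC_zero hg hga

/-- The periodic curves that vanish at `0`. -/
noncomputable def anchoredPeriodic (L : ℝ) [Fact (0 < L)] : Submodule ℝ (SmoothCurve L ℂ) where
  -- Phrasing the condition through the linear map `jets` lets the closure properties follow from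
  -- linearity.
  carrier := {z | z 0 = 0 ∧ ∀ n, jets z n ⟨0, zero_mem L⟩ = jets z n ⟨L, right_mem L⟩}
  add_mem' {z w} hz hw := by
    refine ⟨(anchored L).add_mem hz.1 hw.1, fun n => ?_⟩
    rw [map_add]
    exact congr_arg₂ (· + ·) (hz.2 n) (hw.2 n)
  zero_mem' := ⟨rfl, fun n => by rw [map_zero]; rfl⟩
  smul_mem' c z hz := by
    refine ⟨(anchored L).smul_mem c hz.1, fun n => ?_⟩
    rw [map_smul]
    exact congr_arg (c • ·) (hz.2 n)

theorem mem_anchoredPeriodic {z : SmoothCurve L ℂ} : z ∈ anchoredPeriodic L ↔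
    z 0 = 0 ∧ ∀ n, iteratedDerivWithin n z (Icc 0 L) 0 = iteratedDerivWithin n z (Icc 0 L) L :=
  Iff.rfl

theorem iteratedDerivWithin_superpose_curve_eq {X Y : Type} [NormedAddCommGroup X]
    [NormedSpace ℝ X] [NormedAddCommGroup Y] [NormedSpace ℝ Y] {Φ : X → Y} {O : Set X}
    (hO : IsOpen O) (hΦ : ContDiffOn ℝ ∞ Φ O) {f : SmoothCurve L X} (hf : ∀ s ∈ Icc 0 L, f s ∈ O)
    (h : ∀ n, iteratedDerivWithin n f (Icc 0 L) 0 = iteratedDerivWithin n f (Icc 0 L) L) (n : ℕ) :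
    iteratedDerivWithin n (superpose Φ f) (Icc 0 L) 0
      = iteratedDerivWithin n (superpose Φ f) (Icc 0 L) L := by
  have he : EqOn (superpose Φ f) (fun s => Φ (f s)) (Icc 0 L) := fun s hs =>
    superpose_apply hΦ hf hs
  rw [iteratedDerivWithin_congr he (zero_mem L), iteratedDerivWithin_congr he (right_mem L)]
  exact iteratedDerivWithin_superpose_eq (uniqueDiffOn L) hO hΦ f.contDiffOn hf (zero_mem L)
    (right_mem L) h n

theorem iteratedDerivWithin_Lam {g : SmoothCurve L Mat} (hg : g ∈ Horiz L) (n : ℕ) {s : ℝ}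
    (hs : s ∈ Icc 0 L) :
    iteratedDerivWithin n (Lam g) (Icc 0 L) s = iteratedDerivWithin n (lamC g) (Icc 0 L) s :=
  iteratedDerivWithin_congr (fun x hx => Lam_eq_lamC hx (hg.2.1 x hx)) hs

/-- Λ and z are obtained from one another by pointwise application of smooth maps, so the jets of
one agree at the two ends exactly when those of the other do. Closedness holds because every
derivative at an end point depends continuously on the curve. -/
theorem isCoordModel_horizPeriodic : IsCoordModel (anchoredPeriodic L) (HorizPeriodic L) where
  isClosed := by
    have : (anchoredPeriodic L : Set (SmoothCurve L ℂ)) = {z | evalL 0 z = 0} ∩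
        ⋂ n, {z | iteratedDerivWithin n z (Icc 0 L) 0 = iteratedDerivWithin n z (Icc 0 L) L} := by
      ext z
      simp [mem_anchoredPeriodic]
    rw [this]
    exact (isClosed_eq (evalL 0).continuous continuous_const).inter (isClosed_iInter fun n =>
      isClosed_eq (continuous_iteratedDerivWithin n (zero_mem L))
        (continuous_iteratedDerivWithin n (right_mem L)))
  mulI_mem z hz := mem_anchoredPeriodic.2 ⟨isCoordModel_horiz.mulI_mem z hz.1,
    iteratedDerivWithin_superpose_curve_eq isOpen_univ contDiff_mulI.contDiffOn
      (fun _ _ => mem_univ _) (mem_anchoredPeriodic.1 hz).2⟩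
  subset _ hg := hg.1
  curveOf_mem a z hz := by
    have hmem := curveOf_mem_horiz a hz.1
    refine ⟨hmem, fun n => ?_⟩
    rw [iteratedDerivWithin_Lam hmem n (zero_mem L), iteratedDerivWithin_Lam hmem n (right_mem L),
      lamC_curveOf]
    exact iteratedDerivWithin_superpose_curve_eq isOpen_univ (contDiff_param a).contDiffOn
      (fun _ _ => mem_univ _) (mem_anchoredPeriodic.1 hz).2 n
  coordC_mem a g hg hga := by
    refine mem_anchoredPeriodic.2 ⟨coordC_zero hg.1 hga,
      iteratedDerivWithin_superpose_curve_eq (isOpen_coordDen_ne a) (contDiffOn_coord a) hga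
        fun n => ?_⟩
    rw [← iteratedDerivWithin_Lam hg.1 n (zero_mem L), ← iteratedDerivWithin_Lam hg.1 n (right_mem L)]
    exact hg.2 n

end Darboux

theorem mainTheorem2 (L : ℝ) (hL : 0 < L) :
    FrechetCalculus.IsSymplecticFrechetManifold (Darboux.Horiz L) Darboux.omega ∧
      FrechetCalculus.IsSymplecticFrechetManifold (Darboux.HorizPeriodic L) Darboux.omega := by
  have : Fact (0 < L) := ⟨hL⟩
  exact ⟨Darboux.isCoordModel_horiz.isSymplecticFrechetManifold,
    Darboux.isCoordModel_horizPeriodic.isSymplecticFrechetManifold⟩
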